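/- Let $d\ge 3$. Consider two reservoirs $r=I,II$ of free spinless fermions in $\mathbb R^d$ with one-particle energy $|k|^2$ ($\hbar=1$), inverse temperatures $\beta^r>0$ and chemical potentials $\mu^r\in\mathbb R$. Let $\mathfrak F$ be the CAR algebra generated by the annihilation operators $a(f)$, $f\in L^2(\mathbb R^d)\oplus L^2(\mathbb R^d)$ (momentum representation). Let $\alpha^r_t$ be the free evolution of reservoir $r$, $\alpha^r_t(a^*(k,r))=e^{it|k|^2}a^*(k,r)$; let $\varphi^r_s$ be its gauge transformations, $\varphi^r_s(a^*(k,r))=e^{is}a^*(k,r)$ (both leave the other reservoir fixed); and put $\alpha^0_t=\alpha^I_t\alpha^{II}_t$. Let $\omega^0$ be the product of the two equilibrium states, i.e. the gauge-invariant quasi-free state with $\omega^0(a^*(k,r)a(l,s))=\delta_{rs}\,\delta(k-l)\,\rho_r(k)$, where $\rho_r(k)=(e^{\beta^r(|k|^2-\mu^r)}+1)^{-1}$. The reservoirs are coupled by a tunnelling interaction $W=g\sum_{N\ge1}\xi^N W_N$, $W_N\in\mathfrak F$, where $W_1=W_1^*$ is the one-body operator $$W_1=\sum_{r,r'}\int\!\!\int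 dk\,dl\;a^*(k,r)\,\widehat w_1((-k,r),(l,r'))\,a(l,r'),$$ $$\widehat w_1((k,r),(l,r'))=(2\pi)^{-d}\int\!\!\int dx\,dy\;e^{-i(k\cdot x+l\cdot y)}\,w_1((x,r),(y,r')).$$ Here the functions $w_1((\cdot,r),(\cdot,r'))$ and their first-order weak derivatives are in $L^1\cap L^2(\mathbb R^{2d})$, and the one-particle operator with kernel $\widehat w_1((-k,r),(l,r'))$ is trace class, so that $W_1=\sum_n a^*(f_n)a(g_n)$ for an expansion $\sum_n f_n\otimes\overline{g_n}$ of this kernel with $\sum_n\|f_n\|\|g_n\|<\infty$. Let $\omega_{\rm stat}=\omega^0\circ\sigma_+$, where $\sigma_+$ is given by its Dyson series $$\sigma_+(x)=\sum_{m\ge0}i^m\int_{0<t_1<\dots<t_m}dt_1\cdots dt_m\,[W(t_m),\dots,[W(t_1),x]\dots],\qquad W(t)=\alpha^0_{-t}(W).$$ Let $\mathcal P^r_{k,l}$, $\mathcal J^r_{k,l}$ be the terms of order $g^k\xi^l$ of the energy and particle gain per unit time of reservoir $r$, $$\mathcal P^r=-\tfrac{d}{ds}\,\omega_{\rm stat}(\alpha^r_s(W))\big|_{s=0},\qquad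 \mathcal J^r=-\tfrac{d}{ds}\,\omega_{\rm stat}(\varphi^r_s(W))\big|_{s=0},$$ and let $\mathcal E_{k,l}=\sum_{r}\beta^r\,(\mathcal P^r_{k,l}-\mu^r\mathcal J^r_{k,l})$ be the corresponding term of the entropy production rate. Put $\mathcal P=\mathcal P^I$, $\mathcal J=\mathcal J^I$ and $x^r=x^r(k)=\beta^r(|k|^2-\mu^r)$. Then the terms of order $g^2\xi^2$ of all these currents are well defined: for $\gamma=\alpha^r$ or $\varphi^r$ and all $s$, the function $t\mapsto\omega^0([\alpha^0_{-t}(W_1),\gamma_s(W_1)])$ is integrable on $(0,\infty)$, and the order-$g^2\xi^2$ term of $\omega_{\rm stat}(\gamma_s(W))$ is differentiable at $s=0$. Moreover: 1. $\mathcal E_{1,1}=\mathcal E_{1,2}=0$ and $\mathcal E_{2,2}=(\beta^I-\beta^{II})\,\mathcal P_{2,2}-(\beta^I\mu^I-\beta^{II}\mu^{II})\,\mathcal J_{2,2}$. 2. $$\mathcal E_{2,2}=2\pi\int_{\mathbb R^{d}}dk\int_{\mathbb R^d}dl\;\delta(|k|^2-|l|^2)\,\bigl|\widehat w_1((-k,II),(l,I))\bigr|^2\,\frac{(x^I-x^{II})(e^{x^I}-e^{x^{II}})}{(e^{x^I}+1)(e^{x^{II}}+1)},$$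 with an integrable integrand and a non-negative fraction. Here $\int dl\,\delta(|k|^2-|l|^2)h(l)=\tfrac12|k|^{d-2}\int_{S^{d-1}}h(|k|\sigma)\,d\sigma$. 3. If the on-shell weight $\int dl\,\delta(|k|^2-|l|^2)\,|\widehat w_1((-k,II),(l,I))|^2$ does not vanish for all $k\in\mathbb R^d$, then $\mathcal E_{2,2}>0$ unless $(\beta^I,\mu^I)=(\beta^{II},\mu^{II})$. If $(\beta^I,\mu^I)=(\beta^{II},\mu^{II})$, then $\mathcal E_{2,2}=0$. -/

import Mathlib

open MeasureTheory

noncomputable section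

namespace Tunnelling

/-- The labels of the two reservoirs. -/
inductive Reservoir
  | I
  | II
  deriving DecidableEq

instance : Fintype Reservoir := ⟨{Reservoir.I, Reservoir.II}, fun r => by cases r <;> decide⟩

/-- Euclidean `d`-space: positions, and momenta. -/
abbrev Space (d : ℕ) := EuclideanSpace ℝ (Fin d)

/-- The one-particle space of the two reservoirs in momentum representation,
`L²(ℝᵈ) ⊕ L²(ℝᵈ)`; `f r k` is the amplitude at momentum `k` in reservoir `r`. -/
abbrev OneParticle (d : ℕ) :=
  PiLp 2 (fun _ : Reservoir => Lp ℂ 2 (volume : Measure (Space d)))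

theorem memLp_phase {d : ℕ} (θ : ℝ → ℝ) (hθ : Continuous θ) (f : Lp ℂ 2 (volume : Measure (Space d))) :
    MemLp (fun k : Space d => Complex.exp (Complex.I * (θ ‖k‖ : ℂ)) * f k) 2 volume := by
  refine (Lp.memLp f).of_le ?_ (Filter.Eventually.of_forall fun k => ?_)
  · exact (by fun_prop : Continuous fun k : Space d =>
      Complex.exp (Complex.I * (θ ‖k‖ : ℂ))).aestronglyMeasurable.mul (Lp.aestronglyMeasurable f)
  · rw [norm_mul, mul_comm Complex.I, Complex.norm_exp_ofReal_mul_I, one_mul]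

/-- Multiplication of the component of `f` in reservoir `r` by the phase `exp (i θ(|k|))`; the
component in the other reservoir is unchanged. -/
def phase {d : ℕ} (r : Reservoir) (θ : ℝ → ℝ) (hθ : Continuous θ) (f : OneParticle d) :
    OneParticle d :=
  WithLp.toLp 2 fun r' => if r' = r then (memLp_phase θ hθ (f r)).toLp _ else f r'

/-- The field algebra of the two reservoirs: `𝔄` is a `C*`-algebra generated by annihilation
operators `a(f)` that are antilinear in `f` and satisfy the canonical anticommutation relations.
This determines `𝔄` up to a unique isomorphism; `star (a f)` is the creation operator `a*(f)`. -/
structure FieldAlgebra (d : ℕ) (𝔄 : Type*) [CStarAlgebra 𝔄] where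
  a : OneParticle d →ₗ⋆[ℂ] 𝔄
  anticomm : ∀ f g, a f * a g + a g * a f = 0
  anticomm_star : ∀ f g, a f * star (a g) + star (a g) * a f = (inner ℂ f g : ℂ) • (1 : 𝔄)
  generates : (StarAlgebra.adjoin ℂ (Set.range a)).topologicalClosure = ⊤

section Algebra

variable {d : ℕ} {𝔄 : Type*} [CStarAlgebra 𝔄]

/-- `α r t` is the free time evolution `e^{itHʳ} (·) e^{-itHʳ}` of reservoir `r`, where
`Hʳ = ∫ |k|² a*(k,r) a(k,r) dk`: it multiplies `a*(k,r)` by `e^{it|k|²}`. -/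
def IsFreeEvolution (F : FieldAlgebra d 𝔄) (α : Reservoir → ℝ → 𝔄 →⋆ₐ[ℂ] 𝔄) : Prop :=
  ∀ r t f, α r t (F.a f) = F.a (phase r (fun κ => t * κ ^ 2) (by fun_prop) f)

/-- `φ r s` is the gauge transformation `e^{isNʳ} (·) e^{-isNʳ}` of reservoir `r`, where
`Nʳ = ∫ a*(k,r) a(k,r) dk`: it multiplies `a*(k,r)` by `e^{is}`. -/
def IsGauge (F : FieldAlgebra d 𝔄) (φ : Reservoir → ℝ → 𝔄 →⋆ₐ[ℂ] 𝔄) : Prop :=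
  ∀ r s f, φ r s (F.a f) = F.a (phase r (fun _ => s) (by fun_prop) f)

/-- `x^r(k) = β^r (|k|² - μ^r)`. -/
def reducedEnergy (β μ : Reservoir → ℝ) (r : Reservoir) (k : Space d) : ℝ :=
  β r * (‖k‖ ^ 2 - μ r)

/-- The Fermi distribution `ρ_r(k)` of reservoir `r`. -/
def fermi (β μ : Reservoir → ℝ) (r : Reservoir) (k : Space d) : ℝ :=
  1 / (Real.exp (reducedEnergy β μ r k) + 1)

/-- `ω` is the product of the equilibrium states of the two free Fermi gases, with inverse
temperatures `β r` and chemical potentials `μ r`: the gauge-invariant quasi-free state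
whose two-point function is given by the Fermi distributions. -/
structure IsProductEquilibrium (F : FieldAlgebra d 𝔄) (β μ : Reservoir → ℝ) (ω : 𝔄 →L[ℂ] ℂ) :
    Prop where
  map_one : ω 1 = 1
  nonneg_re : ∀ x, 0 ≤ (ω (star x * x)).re
  im_eq_zero : ∀ x, (ω (star x * x)).im = 0
  two_point : ∀ f g, ω (star (F.a f) * F.a g) =
    ∑ r, ∫ k, (fermi β μ r k : ℂ) * f r k * (starRingEnd ℂ) (g r k)
  off_diagonal : ∀ (n m : ℕ) (f : Fin n → OneParticle d) (g : Fin m → OneParticle d), n ≠ m →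
    ω ((List.ofFn fun i => star (F.a (f i))).prod * (List.ofFn fun j => F.a (g j)).prod) = 0
  wick : ∀ (n : ℕ) (f g : Fin (n + 1) → OneParticle d),
    ω ((List.ofFn fun i => star (F.a (f i))).prod * (List.ofFn fun j => F.a (g j)).prod) =
      ∑ p : Fin (n + 1), (-1) ^ (n + (p : ℕ)) * ω (star (F.a (f 0)) * F.a (g p)) *
        ω ((List.ofFn fun i : Fin n => star (F.a (f i.succ))).prod *
          (List.ofFn fun j : Fin n => F.a (g (p.succAbove j))).prod)

/-- `[W(t_m), … [W(t_1), x] … ]`, with `W_{N_j}` at the `j`-th place and `W(t) = τ_{-t}(W)`. -/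
def nestedCommutator (τ : ℝ → 𝔄 →⋆ₐ[ℂ] 𝔄) (W : ℕ → 𝔄) (x : 𝔄) :
    (m : ℕ) → (Fin m → ℕ) → (Fin m → ℝ) → 𝔄
  | 0, _, _ => x
  | m + 1, N, t =>
      ⁅τ (-(t (Fin.last m))) (W (N (Fin.last m))),
        nestedCommutator τ W x m (fun i => N i.castSucc) (fun i => t i.castSucc)⁆

/-- The term of order `g^k ξ^l` of `ω_stat(g ∑_{N ≥ 1} ξ^N b_N)`, where `ω_stat = ω ∘ σ₊` and
`σ₊` is given by its Dyson series for the interaction `g ∑_{N ≥ 1} ξ^N W_N`,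
`σ₊(x) = ∑_m i^m ∫_{0 < t_1 < … < t_m} [W(t_m), … [W(t_1), x] … ] dt`. -/
def stationaryTerm (ω : 𝔄 →L[ℂ] ℂ) (τ : ℝ → 𝔄 →⋆ₐ[ℂ] 𝔄) (W b : ℕ → 𝔄) : ℕ → ℕ → ℂ
  | 0, _ => 0
  | m + 1, l =>
      ∑ N ∈ (Finset.Nat.antidiagonalTuple (m + 1) l).filter (fun N => ∀ i, 1 ≤ N i),
        Complex.I ^ m * ∫ t in {t : Fin m → ℝ | (∀ i, 0 < t i) ∧ StrictMono t},
          ω (nestedCommutator τ W (b (N 0)) m (Fin.tail N) t)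

/-- The free time evolution `α⁰ = α^I ⊗ α^II` of both reservoirs. -/
def freeEvolution (α : Reservoir → ℝ → 𝔄 →⋆ₐ[ℂ] 𝔄) (t : ℝ) : 𝔄 →⋆ₐ[ℂ] 𝔄 :=
  (α Reservoir.I t).comp (α Reservoir.II t)

/-- The term of order `g^k ξ^l` of `-(d/ds) ω_stat(γ_s(W))` at `s = 0`, for
`W = g ∑_{N ≥ 1} ξ^N W_N`. If `γ_s = e^{isQ} (·) e^{-isQ}` then this is the current
`ω_stat(-i[Q, W])`, the gain of `Q` per unit of time in the stationary state. -/
def currentTerm (ω : 𝔄 →L[ℂ] ℂ) (τ : ℝ → 𝔄 →⋆ₐ[ℂ] 𝔄) (W : ℕ → 𝔄) (γ : ℝ → 𝔄 →⋆ₐ[ℂ] 𝔄)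
    (k l : ℕ) : ℂ :=
  -deriv (fun s : ℝ => stationaryTerm ω τ W (fun N => γ s (W N)) k l) 0

/-- The term of order `g^k ξ^l` of the energy gain per unit of time of reservoir `r`. -/
def energyCurrent (ω : 𝔄 →L[ℂ] ℂ) (α : Reservoir → ℝ → 𝔄 →⋆ₐ[ℂ] 𝔄) (W : ℕ → 𝔄)
    (r : Reservoir) (k l : ℕ) : ℂ :=
  currentTerm ω (freeEvolution α) W (α r) k l

/-- The term of order `g^k ξ^l` of the gain of particles per unit of time of reservoir `r`. -/
def particleCurrent (ω : 𝔄 →L[ℂ] ℂ) (α φ : Reservoir → ℝ → 𝔄 →⋆ₐ[ℂ] 𝔄) (W : ℕ → 𝔄)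
    (r : Reservoir) (k l : ℕ) : ℂ :=
  currentTerm ω (freeEvolution α) W (φ r) k l

/-- The term of order `g^k ξ^l` of the entropy production rate `∑_r β^r (𝒫^r - μ^r 𝒥^r)`. -/
def entropyProduction (β μ : Reservoir → ℝ) (ω : 𝔄 →L[ℂ] ℂ)
    (α φ : Reservoir → ℝ → 𝔄 →⋆ₐ[ℂ] 𝔄) (W : ℕ → 𝔄) (k l : ℕ) : ℂ :=
  ∑ r, (β r : ℂ) * (energyCurrent ω α W r k l - (μ r : ℂ) * particleCurrent ω α φ W r k l)

/-- A one-body kernel in position space: `w r r' (x, y) = w₁((x, r), (y, r'))`. -/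
abbrev Kernel (d : ℕ) := Reservoir → Reservoir → Space d × Space d → ℂ

/-- `kernelFourier w r r' k l` is `ŵ₁((k, r), (l, r'))`. -/
def kernelFourier (w : Kernel d) (r r' : Reservoir) (k l : Space d) : ℂ :=
  (((2 * Real.pi) ^ d : ℝ) : ℂ)⁻¹ *
    ∫ z : Space d × Space d,
      Complex.exp (-Complex.I * ((inner ℝ k z.1 + inner ℝ l z.2 : ℝ) : ℂ)) * w r r' z

/-- The components of the kernel and their first-order weak derivatives are in `L¹ ∩ L²`. -/
def IsRegularKernel (w : Kernel d) : Prop :=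
  ∀ r r', MemLp (w r r') 1 volume ∧ MemLp (w r r') 2 volume ∧
    ∀ v : Space d × Space d, ∃ w' : Space d × Space d → ℂ,
      MemLp w' 1 volume ∧ MemLp w' 2 volume ∧
        ∀ ψ : Space d × Space d → ℝ, ContDiff ℝ (⊤ : ℕ∞) ψ → HasCompactSupport ψ →
          ∫ z, w r r' z * (fderiv ℝ ψ z v : ℂ) = -∫ z, w' z * (ψ z : ℂ)

/-- `W₁ = ∑_{r,r'} ∫∫ a*(k,r) ŵ₁((-k,r),(l,r')) a(l,r') dk dl`, as an element of the field algebra: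
the one-particle operator with this kernel is trace class, `∑ₙ |fₙ⟩⟨gₙ|`, and
`W₁ = ∑ₙ a*(fₙ) a(gₙ)` (which does not depend on the choice of the expansion). -/
def IsOneBodyInteraction (F : FieldAlgebra d 𝔄) (w : Kernel d) (W₁ : 𝔄) : Prop :=
  ∃ f g : ℕ → OneParticle d,
    Summable (fun n => ‖f n‖ * ‖g n‖) ∧
    (∀ r r', ∀ᵐ z : Space d × Space d,
      HasSum (fun n => f n r z.1 * (starRingEnd ℂ) (g n r' z.2))
        (kernelFourier w r r' (-z.1) z.2)) ∧
    HasSum (fun n => star (F.a (f n)) * F.a (g n)) W₁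

end Algebra

/-- `∫ δ(|k|² - |l|²) h(l) dl`: the integral of `h` over the sphere `|l| = |k|` with respect to
the surface measure, divided by the length `2|k|` of the gradient of `|l|²`. -/
def shellIntegral {d : ℕ} (k : Space d) (h : Space d → ℝ) : ℝ :=
  ‖k‖ ^ (d - 2) / 2 *
    ∫ σ : Metric.sphere (0 : Space d) 1, h (‖k‖ • (σ : Space d)) ∂(volume : Measure (Space d)).toSphere

/-- `∫ δ(|k|² - |l|²) |ŵ₁((-k,II),(l,I))|² dl`. -/
def onShellWeight {d : ℕ} (w : Kernel d) (k : Space d) : ℝ :=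
  shellIntegral k fun l => ‖kernelFourier w Reservoir.II Reservoir.I (-k) l‖ ^ 2

/-- The thermal factor `(x^I - x^II)(e^{x^I} - e^{x^II}) / ((e^{x^I} + 1)(e^{x^II} + 1))` at `k`,
where `x^r = β^r (|k|² - μ^r)`. -/
def thermalFactor {d : ℕ} (β μ : Reservoir → ℝ) (k : Space d) : ℝ :=
  ((reducedEnergy β μ Reservoir.I k - reducedEnergy β μ Reservoir.II k) *
      (Real.exp (reducedEnergy β μ Reservoir.I k) - Real.exp (reducedEnergy β μ Reservoir.II k))) /
    ((Real.exp (reducedEnergy β μ Reservoir.I k) + 1) *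
      (Real.exp (reducedEnergy β μ Reservoir.II k) + 1))

end Tunnelling

end

/-! ### Gaussian regularisation: the dispersive estimate and a Plancherel bound for the kernel. -/

namespace Tunnelling

open Filter Topology Complex

variable {d : ℕ}

/-! At order g the Dyson series contributes only ω⁰ itself. This state is invariant under every
automorphism that multiplies `a(f)` by phases in momentum space (`IsProductEquilibrium.apply_eq`),
so the term does not depend on s and its current vanishes.

At order g²ξ² only i∫₀^∞ ω⁰([W₁(t), γ_s(W₁)]) dt remains. The commutator of one-body operators is
again one-body, so its expectation is a difference of two traces. The kernel of the self-adjoint W₁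
is Hermitian (`kernel_conj_symm`). Hence the second trace is the conjugate of the first, and the
first is a sum over r, r' of integrals of ρ_r(k)|ŵ₁((-k,r),(l,r'))|² against a phase
(`apply_commutator`, `phaseTrace_eq_sum_correlation`).

The analysis rests on decay in time. For u in L¹ the integral ∫ e^{it|l|²}|û(k,l)|² dl is
O(|t|^{-d/2}) uniformly in k (`norm_integral_schrodinger_le`), which is integrable at infinity for d
≥ 3. Differentiation in s brings down |k|², absorbed by the Fermi function, and |l|², absorbed by
the weak derivatives of w₁ (`isDispersive_norm_sq_mul_kernel`).

Conjugation of the differentiated correlation at s = 0 reverses time, so the half-line integral plus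
its conjugate is an integral over all times (`integral_Ioi_correlationDeriv_add_conj`). Fourier
inversion in the energy turns that integral into 2πδ(|k|² - |l|²) (`integral_exp_mul_schrodinger`,
`integral_oscillation`). On the shell the terms r = r' drop out, the two cross terms combine, and
every current takes the form `onShellCurrent`. Weighting with β^r and -β^r μ^r produces (ρ_II -
ρ_I)(x^I - x^II), which is the thermal factor. It is non-negative because exp is increasing, and for
different equilibrium parameters it vanishes only on a null set. -/

/-- The Fourier transform `(2π)⁻ᵈ ∫∫ e^{-i(k·x + l·y)} u(x,y) dx dy`. -/
noncomputable def doubleFourier (u : Space d × Space d → ℂ) (k l : Space d) : ℂ :=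
  (((2 * Real.pi) ^ d : ℝ) : ℂ)⁻¹ *
    ∫ z : Space d × Space d,
      Complex.exp (-Complex.I * ((inner ℝ k z.1 + inner ℝ l z.2 : ℝ) : ℂ)) * u z

theorem norm_exp_neg_I_mul (x : ℝ) : ‖Complex.exp (-Complex.I * (x : ℂ))‖ = 1 := by
  rw [show -Complex.I * (x : ℂ) = ((-x : ℝ) : ℂ) * Complex.I by push_cast; ring,
    Complex.norm_exp_ofReal_mul_I]

theorem norm_exp_I_mul (x : ℝ) : ‖Complex.exp (Complex.I * (x : ℂ))‖ = 1 := by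
  rw [mul_comm, Complex.norm_exp_ofReal_mul_I]

theorem integrable_exp_mul {u : Space d × Space d → ℂ} (hu : Integrable u) (k l : Space d) :
    Integrable fun z : Space d × Space d =>
      Complex.exp (-Complex.I * ((inner ℝ k z.1 + inner ℝ l z.2 : ℝ) : ℂ)) * u z := by
  refine hu.mono (by
    exact (by fun_prop : Continuous fun z : Space d × Space d =>
      Complex.exp (-Complex.I * ((inner ℝ k z.1 + inner ℝ l z.2 : ℝ) : ℂ))).aestronglyMeasurable.mul
      hu.1) (Eventually.of_forall fun z => ?_)
  rw [norm_mul, norm_exp_neg_I_mul, one_mul]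

theorem continuous_doubleFourier {u : Space d × Space d → ℂ} (hu : Integrable u) :
    Continuous fun p : Space d × Space d => doubleFourier u p.1 p.2 := by
  refine continuous_const.mul ?_
  refine continuous_of_dominated (bound := fun z => ‖u z‖)
    (fun p => (integrable_exp_mul hu p.1 p.2).1)
    (fun p => Eventually.of_forall fun z => ?_) hu.norm (Eventually.of_forall fun z => ?_)
  · rw [norm_mul, norm_exp_neg_I_mul, one_mul]
  · fun_prop

theorem norm_doubleFourier_le {u : Space d × Space d → ℂ} (k l : Space d) :
    ‖doubleFourier u k l‖ ≤ ((2 * Real.pi) ^ d)⁻¹ * ∫ z, ‖u z‖ := by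
  rw [doubleFourier, norm_mul, norm_inv, Complex.norm_real,
    Real.norm_of_nonneg (by positivity)]
  gcongr
  refine (norm_integral_le_integral_norm _).trans_eq ?_
  simp_rw [norm_mul, norm_exp_neg_I_mul, one_mul]

/-- With the square written as a double integral over positions, the momenta can be integrated
first, against an explicit Gaussian. -/
theorem normSq_doubleFourier (u : Space d × Space d → ℂ) (k l : Space d) :
    ((‖doubleFourier u k l‖ ^ 2 : ℝ) : ℂ) = ((((2 * Real.pi) ^ d) ^ 2 : ℝ) : ℂ)⁻¹ *
      ∫ p : (Space d × Space d) × (Space d × Space d),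
        Complex.exp (-Complex.I * ((inner ℝ k (p.1.1 - p.2.1) + inner ℝ l (p.1.2 - p.2.2) : ℝ) : ℂ))
          * (u p.1 * (starRingEnd ℂ) (u p.2)) := by
  rw [Complex.ofReal_pow, ← Complex.mul_conj', doubleFourier, map_mul, ← integral_conj, mul_mul_mul_comm,
    ← integral_prod_mul, ← Measure.volume_eq_prod]
  congr 1
  · simp only [map_inv₀, Complex.conj_ofReal]
    push_cast
    ring
  · congr 1
    ext p
    rw [map_mul, ← Complex.exp_conj, mul_mul_mul_comm, ← Complex.exp_add]
    congr 2
    simp only [map_mul, map_neg, Complex.conj_I, Complex.conj_ofReal, inner_sub_right]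
    push_cast
    ring

/-- The transform of a complex Gaussian is a Gaussian with exponent -‖v‖²/(4b), whose real part is
nonpositive when Re b > 0. Only the prefactor survives, uniformly in v. -/
theorem norm_integral_gaussian_le {b : ℂ} (hb : 0 < b.re) (v : Space d) :
    ‖∫ l : Space d, Complex.exp (-b * (‖l‖ : ℂ) ^ 2) * Complex.exp (-Complex.I * ((inner ℝ l v : ℝ) : ℂ))‖
      ≤ (Real.pi / ‖b‖) ^ ((d : ℝ) / 2) := by
  have h := GaussianFourier.integral_cexp_neg_mul_sq_norm_add (V := Space d) hb (-Complex.I) v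
  simp_rw [← Complex.exp_add, real_inner_comm v]
  rw [h, norm_mul]
  have h1 : ‖((Real.pi : ℂ) / b) ^ (((Module.finrank ℝ (Space d) : ℕ) : ℂ) / 2)‖
      = (Real.pi / ‖b‖) ^ ((d : ℝ) / 2) := by
    rw [show (((Module.finrank ℝ (Space d) : ℕ) : ℂ) / 2) = (((d : ℝ) / 2 : ℝ) : ℂ) by
      simp, Complex.norm_cpow_real, norm_div, Complex.norm_real,
      Real.norm_of_nonneg Real.pi_pos.le]
  rw [h1]
  refine mul_le_of_le_one_right (by positivity) ?_
  rw [Complex.norm_exp, Real.exp_le_one_iff]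
  have : (-Complex.I) ^ 2 * (‖v‖ : ℂ) ^ 2 / (4 * b) = ((-(‖v‖ ^ 2 / 4) : ℝ) : ℂ) * b⁻¹ := by
    rw [neg_sq, Complex.I_sq]; push_cast; field_simp
  rw [this, Complex.re_ofReal_mul, Complex.inv_re]
  refine mul_nonpos_of_nonpos_of_nonneg (by linarith [sq_nonneg ‖v‖]) ?_
  exact div_nonneg hb.le (Complex.normSq_nonneg _)

theorem integrable_gaussian {b : ℂ} (hb : 0 < b.re) :
    Integrable fun l : Space d => Complex.exp (-b * (‖l‖ : ℂ) ^ 2) := by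
  simpa using GaussianFourier.integrable_cexp_neg_mul_sq_norm_add (V := Space d) hb 0 0

theorem integral_gaussian_mul_normSq {u : Space d × Space d → ℂ} (hu : Integrable u) {b : ℂ}
    (hb : 0 < b.re) (k : Space d) :
    ∫ l : Space d, Complex.exp (-b * (‖l‖ : ℂ) ^ 2) * ((‖doubleFourier u k l‖ ^ 2 : ℝ) : ℂ) =
      ((((2 * Real.pi) ^ d) ^ 2 : ℝ) : ℂ)⁻¹ *
      ∫ p : (Space d × Space d) × (Space d × Space d),
        Complex.exp (-Complex.I * ((inner ℝ k (p.1.1 - p.2.1) : ℝ) : ℂ)) *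
          (u p.1 * (starRingEnd ℂ) (u p.2)) *
        ∫ l : Space d, Complex.exp (-b * (‖l‖ : ℂ) ^ 2) *
          Complex.exp (-Complex.I * ((inner ℝ l (p.1.2 - p.2.2) : ℝ) : ℂ)) := by
  have huu : Integrable fun p : (Space d × Space d) × (Space d × Space d) =>
      u p.1 * (starRingEnd ℂ) (u p.2) :=
    hu.mul_prod (hu.congr' (g := fun z => (starRingEnd ℂ) (u z))
      (Complex.continuous_conj.comp_aestronglyMeasurable hu.1) (by simp))
  have hI : Integrable (Function.uncurry fun (l : Space d)
      (p : (Space d × Space d) × (Space d × Space d)) =>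
      Complex.exp (-b * (‖l‖ : ℂ) ^ 2) *
      (Complex.exp (-Complex.I * ((inner ℝ k (p.1.1 - p.2.1) + inner ℝ l (p.1.2 - p.2.2) : ℝ) : ℂ))
          * (u p.1 * (starRingEnd ℂ) (u p.2)))) := by
    have := ((integrable_gaussian (d := d) hb).mul_prod huu)
    refine (this.bdd_mul (c := 1) (f := fun q : Space d × ((Space d × Space d) × (Space d × Space d)) =>
      Complex.exp (-Complex.I * ((inner ℝ k (q.2.1.1 - q.2.2.1) +
        inner ℝ q.1 (q.2.1.2 - q.2.2.2) : ℝ) : ℂ))) ?_ ?_).congr ?_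
    · exact Continuous.aestronglyMeasurable (by fun_prop)
    · exact Eventually.of_forall fun q => (norm_exp_neg_I_mul _).le
    · exact Eventually.of_forall fun q => by simp only [Function.uncurry]; ring
  simp_rw [normSq_doubleFourier]
  simp_rw [mul_left_comm (Complex.exp (-b * _)) (_⁻¹)]
  rw [integral_const_mul]
  congr 1
  simp_rw [← integral_const_mul]
  rw [integral_integral_swap hI]
  congr 1
  ext p
  congr 1
  ext l
  rw [Complex.ofReal_add, mul_add, Complex.exp_add]
  ring

/-- The bound involves u only through its L¹ norm and b only through |b|; it is therefore uniform in
k and survives the limit of b to the imaginary axis. -/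
theorem norm_integral_gaussian_mul_normSq_le {u : Space d × Space d → ℂ} (hu : Integrable u) {b : ℂ}
    (hb : 0 < b.re) (k : Space d) :
    ‖∫ l : Space d, Complex.exp (-b * (‖l‖ : ℂ) ^ 2) * ((‖doubleFourier u k l‖ ^ 2 : ℝ) : ℂ)‖ ≤
      (((2 * Real.pi) ^ d) ^ 2)⁻¹ * ((∫ z, ‖u z‖) ^ 2 * (Real.pi / ‖b‖) ^ ((d : ℝ) / 2)) := by
  rw [integral_gaussian_mul_normSq hu hb, norm_mul, norm_inv, Complex.norm_real,
    Real.norm_of_nonneg (by positivity)]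
  gcongr
  have : Integrable fun p : (Space d × Space d) × (Space d × Space d) => ‖u p.1‖ * ‖u p.2‖ :=
    hu.norm.mul_prod hu.norm
  calc _ ≤ ∫ p : (Space d × Space d) × (Space d × Space d),
        ‖u p.1‖ * ‖u p.2‖ * (Real.pi / ‖b‖) ^ ((d : ℝ) / 2) := by
        refine norm_integral_le_of_norm_le (this.mul_const _) (Eventually.of_forall fun p => ?_)
        rw [norm_mul, norm_mul, norm_mul, norm_exp_neg_I_mul, one_mul, RCLike.norm_conj]
        gcongr
        exact norm_integral_gaussian_le hb _
    _ = _ := by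
        rw [integral_mul_const, Measure.volume_eq_prod, integral_prod_mul (fun z => ‖u z‖) (fun z => ‖u z‖), sq]

/-- This is the limit b = ε - it, ε ↓ 0. Integrability of the slice provides the dominating function
on the left; on the right |b| tends to |t|. -/
theorem norm_integral_schrodinger_le {u : Space d × Space d → ℂ} (hu : Integrable u) (k : Space d)
    (hk : Integrable fun l => ‖doubleFourier u k l‖ ^ 2) {t : ℝ} (ht : t ≠ 0) :
    ‖∫ l : Space d, Complex.exp (Complex.I * ((t * ‖l‖ ^ 2 : ℝ) : ℂ)) *
      ((‖doubleFourier u k l‖ ^ 2 : ℝ) : ℂ)‖ ≤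
      (((2 * Real.pi) ^ d) ^ 2)⁻¹ * ((∫ z, ‖u z‖) ^ 2 * (Real.pi / |t|) ^ ((d : ℝ) / 2)) := by
  have hl : Tendsto (fun ε : ℝ => ∫ l : Space d, Complex.exp (-((ε : ℂ) - t * Complex.I) * (‖l‖ : ℂ) ^ 2) *
      ((‖doubleFourier u k l‖ ^ 2 : ℝ) : ℂ)) (𝓝[>] 0)
      (𝓝 (∫ l : Space d, Complex.exp (Complex.I * ((t * ‖l‖ ^ 2 : ℝ) : ℂ)) *
      ((‖doubleFourier u k l‖ ^ 2 : ℝ) : ℂ))) := by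
    refine tendsto_integral_filter_of_dominated_convergence
      (fun l => ‖doubleFourier u k l‖ ^ 2) ?_ ?_ hk ?_
    · refine Eventually.of_forall fun ε => ?_
      exact (by fun_prop : Continuous fun l : Space d =>
        Complex.exp (-((ε : ℂ) - t * Complex.I) * (‖l‖ : ℂ) ^ 2)).aestronglyMeasurable.mul
        hk.ofReal.1
    · filter_upwards [self_mem_nhdsWithin] with ε hε
      refine Eventually.of_forall fun l => ?_
      rw [norm_mul, Complex.norm_real, Real.norm_of_nonneg (sq_nonneg _)]
      refine mul_le_of_le_one_left (sq_nonneg _) ?_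
      rw [Complex.norm_exp, Real.exp_le_one_iff, ← Complex.ofReal_pow, Complex.re_mul_ofReal]
      simp only [Complex.neg_re, Complex.sub_re, Complex.ofReal_re, Complex.re_ofReal_mul,
        Complex.I_re, mul_zero, sub_zero, neg_mul, Left.neg_nonpos_iff]
      exact mul_nonneg (le_of_lt hε) (sq_nonneg _)
    · refine Eventually.of_forall fun l => ?_
      refine Tendsto.mul_const _ ?_
      have : Continuous fun ε : ℝ => Complex.exp (-((ε : ℂ) - t * Complex.I) * (‖l‖ : ℂ) ^ 2) := by
        fun_prop
      have h := (this.tendsto 0).mono_left (nhdsWithin_le_nhds (s := Set.Ioi 0))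
      convert h using 2
      congr 1; push_cast; ring
  have hr : Tendsto (fun ε : ℝ => (((2 * Real.pi) ^ d) ^ 2)⁻¹ * ((∫ z, ‖u z‖) ^ 2 *
      (Real.pi / ‖(ε : ℂ) - t * Complex.I‖) ^ ((d : ℝ) / 2))) (𝓝[>] 0)
      (𝓝 ((((2 * Real.pi) ^ d) ^ 2)⁻¹ * ((∫ z, ‖u z‖) ^ 2 * (Real.pi / |t|) ^ ((d : ℝ) / 2)))) := by
    have : ContinuousAt (fun ε : ℝ => (((2 * Real.pi) ^ d) ^ 2)⁻¹ * ((∫ z, ‖u z‖) ^ 2 *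
        (Real.pi / ‖(ε : ℂ) - t * Complex.I‖) ^ ((d : ℝ) / 2))) 0 := by
      refine continuousAt_const.mul (continuousAt_const.mul (ContinuousAt.rpow_const ?_
        (Or.inr (by positivity))))
      refine continuousAt_const.div (by fun_prop) ?_
      simpa using ht
    simpa [ContinuousAt] using this.tendsto.mono_left (nhdsWithin_le_nhds (s := Set.Ioi 0))
  refine le_of_tendsto_of_tendsto hl.norm hr ?_
  filter_upwards [self_mem_nhdsWithin] with ε hε
  exact norm_integral_gaussian_mul_normSq_le hu (by simpa using hε) k

theorem integral_gaussian_kernel {ε : ℝ} (hε : 0 < ε) (v : Space d) :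
    ∫ l : Space d, Complex.exp (-(ε : ℂ) * (‖l‖ : ℂ) ^ 2) *
        Complex.exp (-Complex.I * ((inner ℝ l v : ℝ) : ℂ)) =
      (((Real.pi / ε) ^ ((d : ℝ) / 2) * Real.exp (-(4 * ε)⁻¹ * ‖v‖ ^ 2) : ℝ) : ℂ) := by
  have h := GaussianFourier.integral_cexp_neg_mul_sq_norm_add (V := Space d) (b := (ε : ℂ))
    (by simpa using hε) (-Complex.I) v
  simp_rw [← Complex.exp_add, real_inner_comm v]
  rw [h]
  push_cast
  rw [Complex.ofReal_cpow (by positivity)]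
  push_cast
  congr 2
  · simp
  · rw [neg_sq, Complex.I_sq]; field_simp

/-- The mass is independent of ε, and one factor (2π)^d for each of the two variables cancels the
normalisation of `doubleFourier` squared. -/
theorem integral_gaussian_kernel_total {ε : ℝ} (hε : 0 < ε) :
    ∫ v : Space d, (Real.pi / ε) ^ ((d : ℝ) / 2) * Real.exp (-(4 * ε)⁻¹ * ‖v‖ ^ 2) =
      (2 * Real.pi) ^ d := by
  rw [integral_const_mul, GaussianFourier.integral_rexp_neg_mul_sq_norm (by positivity),
    finrank_euclideanSpace_fin, ← Real.mul_rpow (by positivity) (by positivity)]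
  rw [show Real.pi / ε * (Real.pi / (4 * ε)⁻¹) = (2 * Real.pi) ^ (2 : ℝ) by
    rw [Real.rpow_two]; field_simp; ring, ← Real.rpow_mul (by positivity)]
  rw [← Real.rpow_natCast]
  congr 1
  ring

theorem integral_gaussian_mul_normSq_prod {u : Space d × Space d → ℂ} (hu : Integrable u) {ε : ℝ}
    (hε : 0 < ε) :
    ∫ p : Space d × Space d, (Complex.exp (-(ε : ℂ) * (‖p.1‖ : ℂ) ^ 2) *
        Complex.exp (-(ε : ℂ) * (‖p.2‖ : ℂ) ^ 2)) * ((‖doubleFourier u p.1 p.2‖ ^ 2 : ℝ) : ℂ) =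
      ((((2 * Real.pi) ^ d) ^ 2 : ℝ) : ℂ)⁻¹ *
      ∫ q : (Space d × Space d) × (Space d × Space d),
        (u q.1 * (starRingEnd ℂ) (u q.2)) *
        ((((Real.pi / ε) ^ ((d : ℝ) / 2) * Real.exp (-(4 * ε)⁻¹ * ‖(q.1 - q.2).1‖ ^ 2)) *
          ((Real.pi / ε) ^ ((d : ℝ) / 2) * Real.exp (-(4 * ε)⁻¹ * ‖(q.1 - q.2).2‖ ^ 2)) : ℝ) : ℂ) := by
  have hb : 0 < (ε : ℂ).re := by simpa using hε
  have huu : Integrable fun p : (Space d × Space d) × (Space d × Space d) =>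
      u p.1 * (starRingEnd ℂ) (u p.2) :=
    hu.mul_prod (hu.congr' (g := fun z => (starRingEnd ℂ) (u z))
      (Complex.continuous_conj.comp_aestronglyMeasurable hu.1) (by simp))
  have hI : Integrable (Function.uncurry fun (p : Space d × Space d)
      (q : (Space d × Space d) × (Space d × Space d)) =>
      (Complex.exp (-(ε : ℂ) * (‖p.1‖ : ℂ) ^ 2) * Complex.exp (-(ε : ℂ) * (‖p.2‖ : ℂ) ^ 2)) *
      (Complex.exp (-Complex.I * ((inner ℝ p.1 (q.1.1 - q.2.1) + inner ℝ p.2 (q.1.2 - q.2.2) : ℝ) : ℂ))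
          * (u q.1 * (starRingEnd ℂ) (u q.2)))) ((volume : Measure (Space d × Space d)).prod
        (volume : Measure ((Space d × Space d) × (Space d × Space d)))) := by
    have := (((integrable_gaussian (d := d) hb).mul_prod (integrable_gaussian (d := d) hb)).mul_prod huu)
    refine (this.bdd_mul (c := 1) (f := fun q : (Space d × Space d) × ((Space d × Space d) × (Space d × Space d)) =>
      Complex.exp (-Complex.I * ((inner ℝ q.1.1 (q.2.1.1 - q.2.2.1) +
        inner ℝ q.1.2 (q.2.1.2 - q.2.2.2) : ℝ) : ℂ))) ?_ ?_).congr ?_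
    · exact Continuous.aestronglyMeasurable (by fun_prop)
    · exact Eventually.of_forall fun q => (norm_exp_neg_I_mul _).le
    · exact Eventually.of_forall fun q => by simp only [Function.uncurry]; ring
  simp_rw [normSq_doubleFourier]
  simp_rw [mul_left_comm (Complex.exp (-(ε : ℂ) * _) * Complex.exp (-(ε : ℂ) * _)) (_⁻¹)]
  rw [integral_const_mul]
  congr 1
  simp_rw [← integral_const_mul]
  rw [integral_integral_swap hI]
  congr 1
  ext q
  rw [Complex.ofReal_mul, Prod.fst_sub, Prod.snd_sub, ← integral_gaussian_kernel hε,
    ← integral_gaussian_kernel hε, ← integral_prod_mul, ← integral_const_mul,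
    Measure.volume_eq_prod]
  congr 1
  ext p
  rw [Complex.ofReal_add, mul_add, Complex.exp_add]
  ring

theorem integrable_gaussian_kernel {ε : ℝ} (hε : 0 < ε) :
    Integrable fun v : Space d => (Real.pi / ε) ^ ((d : ℝ) / 2) * Real.exp (-(4 * ε)⁻¹ * ‖v‖ ^ 2) := by
  refine Integrable.const_mul ?_ _
  have := (integrable_gaussian (d := d) (b := (((4 * ε)⁻¹ : ℝ) : ℂ)) (by
    rw [Complex.ofReal_re]; positivity)).norm
  refine this.congr (Eventually.of_forall fun v => ?_)
  simp only
  rw [← Complex.ofReal_neg, ← Complex.ofReal_pow, ← Complex.ofReal_mul, Complex.norm_exp,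
    Complex.ofReal_re]

/-- Half of Plancherel's theorem. The regularised integral pairs u ⊗ ū with a positive convolution
kernel, so 2|u(q₁)u(q₂)| ≤ |u(q₁)|² + |u(q₂)|² and translation invariance suffice. -/
theorem integral_gaussian_mul_normSq_prod_le {u : Space d × Space d → ℂ} (hu : Integrable u)
    (hu2 : MemLp u 2) {ε : ℝ} (hε : 0 < ε) :
    ∫ p : Space d × Space d, (Real.exp (-ε * ‖p.1‖ ^ 2) * Real.exp (-ε * ‖p.2‖ ^ 2)) *
      ‖doubleFourier u p.1 p.2‖ ^ 2 ≤ ∫ z, ‖u z‖ ^ 2 := by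
  set g : Space d → ℝ := fun v =>
    (Real.pi / ε) ^ ((d : ℝ) / 2) * Real.exp (-(4 * ε)⁻¹ * ‖v‖ ^ 2) with hg
  have hg0 : ∀ v, 0 ≤ g v := fun v => by positivity
  set H : Space d × Space d → ℝ := fun z => g z.1 * g z.2 with hH
  have hHi : Integrable H := (integrable_gaussian_kernel hε).mul_prod (integrable_gaussian_kernel hε)
  have hHt : ∫ z, H z = (2 * Real.pi) ^ d * (2 * Real.pi) ^ d := by
    rw [hH, Measure.volume_eq_prod, integral_prod_mul, hg, integral_gaussian_kernel_total hε]
  have hHneg : ∀ z, H (-z) = H z := fun z => by simp [hH, hg]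
  have hsq : Integrable fun z => ‖u z‖ ^ 2 := hu2.integrable_norm_pow (by norm_num)
  have : (volume : Measure (Space d × Space d)).IsAddHaarMeasure := by
    rw [Measure.volume_eq_prod]; infer_instance
  have h2 : Integrable fun q : (Space d × Space d) × (Space d × Space d) =>
      ‖u q.2‖ ^ 2 * H (q.1 - q.2) :=
    hsq.convolution_integrand (ContinuousLinearMap.mul ℝ ℝ) hHi
  have h1 : Integrable fun q : (Space d × Space d) × (Space d × Space d) =>
      ‖u q.1‖ ^ 2 * H (q.1 - q.2) := by
    refine h2.swap.congr (Eventually.of_forall fun q => ?_)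
    simp only [Function.comp, Prod.fst_swap, Prod.snd_swap]
    rw [← hHneg, neg_sub]
  have e2 : ∫ q : (Space d × Space d) × (Space d × Space d), ‖u q.2‖ ^ 2 * H (q.1 - q.2) =
      (∫ z, ‖u z‖ ^ 2) * ((2 * Real.pi) ^ d * (2 * Real.pi) ^ d) := by
    have := integral_convolution (ContinuousLinearMap.mul ℝ ℝ) hsq hHi (ν := volume) (μ := volume)
    rw [hHt] at this
    rw [Measure.volume_eq_prod, integral_prod _ h2]
    exact this
  have e1 : ∫ q : (Space d × Space d) × (Space d × Space d), ‖u q.1‖ ^ 2 * H (q.1 - q.2) =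
      (∫ z, ‖u z‖ ^ 2) * ((2 * Real.pi) ^ d * (2 * Real.pi) ^ d) := by
    rw [← e2, Measure.volume_eq_prod, ← integral_prod_swap]
    congr 1
    ext q
    simp only [Prod.fst_swap, Prod.snd_swap]
    rw [← hHneg, neg_sub]
  have key := integral_gaussian_mul_normSq_prod hu hε
  have hl : ∫ p : Space d × Space d, (Complex.exp (-(ε : ℂ) * (‖p.1‖ : ℂ) ^ 2) *
        Complex.exp (-(ε : ℂ) * (‖p.2‖ : ℂ) ^ 2)) * ((‖doubleFourier u p.1 p.2‖ ^ 2 : ℝ) : ℂ) =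
      ((∫ p : Space d × Space d, (Real.exp (-ε * ‖p.1‖ ^ 2) * Real.exp (-ε * ‖p.2‖ ^ 2)) *
      ‖doubleFourier u p.1 p.2‖ ^ 2 : ℝ) : ℂ) := by
    rw [← integral_complex_ofReal]
    congr 1
    ext p
    push_cast
    rfl
  rw [hl] at key
  refine (le_abs_self _).trans ?_
  rw [← Real.norm_eq_abs, ← Complex.norm_real, key, norm_mul, norm_inv, Complex.norm_real,
    Real.norm_of_nonneg (by positivity), inv_mul_le_iff₀ (by positivity)]
  calc _ ≤ ∫ q : (Space d × Space d) × (Space d × Space d),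
        (‖u q.1‖ ^ 2 * H (q.1 - q.2) + ‖u q.2‖ ^ 2 * H (q.1 - q.2)) / 2 := by
        refine norm_integral_le_of_norm_le ((h1.add h2).div_const 2)
          (Eventually.of_forall fun q => ?_)
        have hn : 0 ≤ H (q.1 - q.2) := mul_nonneg (hg0 _) (hg0 _)
        change ‖u q.1 * (starRingEnd ℂ) (u q.2) * ((H (q.1 - q.2) : ℝ) : ℂ)‖ ≤ _
        rw [norm_mul, norm_mul, RCLike.norm_conj, Complex.norm_real, Real.norm_of_nonneg hn]
        nlinarith [mul_nonneg hn (sq_nonneg (‖u q.1‖ - ‖u q.2‖))]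
    _ = _ := by
        rw [integral_div, integral_add h1 h2, e1, e2]
        ring

/-- The regularised bound does not depend on ε, so the integrals over an exhausting sequence of
balls stay bounded. -/
theorem integrable_normSq_doubleFourier {u : Space d × Space d → ℂ} (hu : Integrable u)
    (hu2 : MemLp u 2) :
    Integrable fun p : Space d × Space d => ‖doubleFourier u p.1 p.2‖ ^ 2 := by
  have hc : Continuous fun p : Space d × Space d => ‖doubleFourier u p.1 p.2‖ ^ 2 :=
    (continuous_doubleFourier hu).norm.pow 2
  refine AECover.integrable_of_integral_norm_bounded (l := atTop)
    (φ := fun n : ℕ => Metric.closedBall (0 : Space d × Space d) (n + 1))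
    (aecover_closedBall (tendsto_natCast_atTop_atTop.atTop_add tendsto_const_nhds))
    (Real.exp 2 * ∫ z, ‖u z‖ ^ 2) (fun n => ?_)
    (Eventually.of_forall fun n => ?_)
  · exact hc.continuousOn.integrableOn_compact (isCompact_closedBall _ _)
  have hn : (0 : ℝ) < n + 1 := by positivity
  -- With ε = R⁻² and R = n + 1, the product of the two Gaussians is at least e⁻² on the ball of
  -- radius R of the sup norm; this explains the constant `Real.exp 2`.
  set ε : ℝ := ((n + 1 : ℝ) ^ 2)⁻¹ with hε
  have hε0 : 0 < ε := by positivity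
  have hI : Integrable fun p : Space d × Space d =>
      (Real.exp (-ε * ‖p.1‖ ^ 2) * Real.exp (-ε * ‖p.2‖ ^ 2)) * ‖doubleFourier u p.1 p.2‖ ^ 2 := by
    have he : Integrable fun v : Space d => Real.exp (-ε * ‖v‖ ^ 2) := by
      have := (integrable_gaussian (d := d) (b := (ε : ℂ)) (by simpa using hε0)).norm
      refine this.congr (Eventually.of_forall fun v => ?_)
      simp only
      rw [← Complex.ofReal_neg, ← Complex.ofReal_pow, ← Complex.ofReal_mul, Complex.norm_exp,
        Complex.ofReal_re]
    refine (he.mul_prod he).mul_bdd (c := (((2 * Real.pi) ^ d)⁻¹ * ∫ z, ‖u z‖) ^ 2)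
      hc.aestronglyMeasurable (Eventually.of_forall fun p => ?_)
    rw [Real.norm_of_nonneg (by positivity)]
    gcongr
    exact norm_doubleFourier_le _ _
  calc ∫ p in Metric.closedBall (0 : Space d × Space d) (n + 1), ‖‖doubleFourier u p.1 p.2‖ ^ 2‖
      ≤ ∫ p in Metric.closedBall (0 : Space d × Space d) (n + 1), Real.exp 2 *
        ((Real.exp (-ε * ‖p.1‖ ^ 2) * Real.exp (-ε * ‖p.2‖ ^ 2)) * ‖doubleFourier u p.1 p.2‖ ^ 2) := by
        refine setIntegral_mono_on
          (hc.norm.continuousOn.integrableOn_compact (isCompact_closedBall _ _))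
          (hI.const_mul _).integrableOn Metric.isClosed_closedBall.measurableSet fun p hp => ?_
        rw [Real.norm_of_nonneg (by positivity), ← mul_assoc, ← Real.exp_add, ← Real.exp_add]
        refine le_mul_of_one_le_left (by positivity) (Real.one_le_exp ?_)
        rw [mem_closedBall_zero_iff, Prod.norm_def, max_le_iff] at hp
        have a1 : ε * ‖p.1‖ ^ 2 ≤ 1 := by
          rw [hε, inv_mul_le_iff₀ (by positivity), mul_one]
          exact pow_le_pow_left₀ (norm_nonneg _) hp.1 2
        have a2 : ε * ‖p.2‖ ^ 2 ≤ 1 := by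
          rw [hε, inv_mul_le_iff₀ (by positivity), mul_one]
          exact pow_le_pow_left₀ (norm_nonneg _) hp.2 2
        linarith
    _ ≤ ∫ p : Space d × Space d, Real.exp 2 *
        ((Real.exp (-ε * ‖p.1‖ ^ 2) * Real.exp (-ε * ‖p.2‖ ^ 2)) * ‖doubleFourier u p.1 p.2‖ ^ 2) :=
        setIntegral_le_integral (hI.const_mul _) (Eventually.of_forall fun p => by positivity)
    _ ≤ _ := by
        rw [integral_const_mul]
        exact mul_le_mul_of_nonneg_left (integral_gaussian_mul_normSq_prod_le hu hu2 hε0)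
          (Real.exp_pos _).le

end Tunnelling

/-! ### Weak derivatives become multiplication by momenta. -/

namespace Tunnelling

open Filter Topology Complex

variable {d : ℕ}

/-- `u'` is the weak derivative of `u` in the direction `v`. -/
def IsWeakDeriv (u u' : Space d × Space d → ℂ) (v : Space d × Space d) : Prop :=
  ∀ ψ : Space d × Space d → ℝ, ContDiff ℝ (⊤ : ℕ∞) ψ → HasCompactSupport ψ →
    ∫ z, u z * (fderiv ℝ ψ z v : ℂ) = -∫ z, u' z * (ψ z : ℂ)

/-- Bounded functions of a linear form are not compactly supported, so they are cut off by χ(cₙz)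
with cₙ → 0. The derivative of the cutoff carries a factor cₙ and disappears by dominated
convergence. -/
theorem IsWeakDeriv.integral_comp_linear {u u' : Space d × Space d → ℂ} {v : Space d × Space d}
    (h : IsWeakDeriv u u' v) (hu : Integrable u) (hu' : Integrable u')
    (A : Space d × Space d →L[ℝ] ℝ) {p p' : ℝ → ℝ} (hp : ContDiff ℝ (⊤ : ℕ∞) p)
    (hpp : ∀ x, HasDerivAt p (p' x) x) (hp1 : ∀ x, |p x| ≤ 1)
    (hp1' : ∀ x, |p' x| ≤ 1) :
    ∫ z, u z * ((p' (A z) * A v : ℝ) : ℂ) = -∫ z, u' z * ((p (A z) : ℝ) : ℂ) := by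
  let χ : ContDiffBump (0 : Space d × Space d) := ⟨1, 2, by norm_num, by norm_num⟩
  have hχ : ContDiff ℝ (⊤ : ℕ∞) χ := χ.contDiff
  have hχs : HasCompactSupport (χ : Space d × Space d → ℝ) := χ.hasCompactSupport
  have hχd : Continuous (fderiv ℝ (χ : Space d × Space d → ℝ)) := hχ.continuous_fderiv (by simp)
  obtain ⟨C, hC⟩ := (hχs.fderiv (𝕜 := ℝ)).exists_bound_of_continuous hχd
  have hC0 : 0 ≤ C := (norm_nonneg _).trans (hC 0)
  set c : ℕ → ℝ := fun n => ((n : ℝ) + 1)⁻¹ with hc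
  have hc0 : ∀ n, 0 < c n := fun n => by positivity
  have hc1 : ∀ n, c n ≤ 1 := fun n => inv_le_one_of_one_le₀ (by simp)
  have hct : Tendsto c atTop (𝓝 0) := by
    simpa [hc] using tendsto_one_div_add_atTop_nhds_zero_nat (𝕜 := ℝ)
  set ψ : ℕ → Space d × Space d → ℝ := fun n z => χ (c n • z) * p (A z) with hψ
  have hψc : ∀ n, ContDiff ℝ (⊤ : ℕ∞) (ψ n) := fun n =>
    (hχ.comp (contDiff_const_smul (c n))).mul (hp.comp A.contDiff)
  have hψs : ∀ n, HasCompactSupport (ψ n) := fun n =>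
    (hχs.comp_smul (hc0 n).ne').mul_right
  have hψd : ∀ n z, fderiv ℝ (ψ n) z v =
      c n * fderiv ℝ χ (c n • z) v * p (A z) + χ (c n • z) * (p' (A z) * A v) := by
    intro n z
    have h1 : HasFDerivAt (fun z => χ (c n • z))
        ((fderiv ℝ χ (c n • z)).comp (c n • ContinuousLinearMap.id ℝ (Space d × Space d))) z :=
      ((hχ.differentiable (by simp) (c n • z)).hasFDerivAt (x := c n • z)).comp z
        ((hasFDerivAt_id z).const_smul (c n))
    have h2 : HasFDerivAt (fun z => p (A z)) (p' (A z) • A) z :=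
      (hpp (A z)).comp_hasFDerivAt z A.hasFDerivAt
    have h3 : HasFDerivAt (ψ n) _ z := h1.mul h2
    rw [h3.fderiv]
    simp
    ring
  have hlim1 : Tendsto (fun n => ∫ z, u z * (fderiv ℝ (ψ n) z v : ℂ)) atTop
      (𝓝 (∫ z, u z * ((p' (A z) * A v : ℝ) : ℂ))) := by
    refine tendsto_integral_of_dominated_convergence
      (fun z => ‖u z‖ * (C * ‖v‖ + |A v|)) (fun n => ?_) (hu.norm.mul_const _) (fun n => ?_) ?_
    · refine hu.1.mul (Continuous.aestronglyMeasurable ?_)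
      exact Complex.continuous_ofReal.comp
        (((hψc n).continuous_fderiv (by simp)).clm_apply continuous_const)
    · refine Eventually.of_forall fun z => ?_
      rw [norm_mul, Complex.norm_real, hψd]
      gcongr
      refine (norm_add_le _ _).trans (add_le_add ?_ ?_)
      · rw [norm_mul, norm_mul, Real.norm_of_nonneg (hc0 n).le]
        calc c n * ‖fderiv ℝ χ (c n • z) v‖ * ‖p (A z)‖ ≤ 1 * (C * ‖v‖) * 1 := by
              gcongr
              · exact hc1 n
              · exact (ContinuousLinearMap.le_opNorm _ _).trans (by gcongr; exact hC _)
              · exact hp1 _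
          _ = C * ‖v‖ := by ring
      · rw [norm_mul, norm_mul, Real.norm_of_nonneg χ.nonneg]
        calc χ (c n • z) * (‖p' (A z)‖ * ‖A v‖) ≤ 1 * (1 * ‖A v‖) := by
              gcongr
              · exact χ.le_one
              · exact hp1' _
          _ = |A v| := by simp
    · refine Eventually.of_forall fun z => ?_
      refine Tendsto.const_mul _ ((Complex.continuous_ofReal.tendsto _).comp ?_)
      simp_rw [hψd]
      have hz : Tendsto (fun n => c n • z) atTop (𝓝 0) := by simpa using hct.smul_const z
      have hχ1 : Tendsto (fun n => χ (c n • z)) atTop (𝓝 1) := by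
        have := (χ.continuous.tendsto 0).comp hz
        rwa [χ.one_of_mem_closedBall (by simp [χ])] at this
      have hd : Tendsto (fun n => fderiv ℝ χ (c n • z) v) atTop (𝓝 (fderiv ℝ χ 0 v)) :=
        (((hχd.clm_apply continuous_const).tendsto 0).comp hz)
      simpa using ((hct.mul hd).mul_const (p (A z))).add (hχ1.mul_const (p' (A z) * A v))
  have hlim2 : Tendsto (fun n => ∫ z, u' z * (ψ n z : ℂ)) atTop
      (𝓝 (∫ z, u' z * ((p (A z) : ℝ) : ℂ))) := by
    refine tendsto_integral_of_dominated_convergence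
      (fun z => ‖u' z‖) (fun n => ?_) hu'.norm (fun n => ?_) ?_
    · exact hu'.1.mul (Complex.continuous_ofReal.comp (hψc n).continuous).aestronglyMeasurable
    · refine Eventually.of_forall fun z => ?_
      rw [norm_mul, Complex.norm_real, hψ, norm_mul, Real.norm_of_nonneg χ.nonneg]
      refine mul_le_of_le_one_right (norm_nonneg _) (mul_le_one₀ χ.le_one (abs_nonneg _) (hp1 _))
    · refine Eventually.of_forall fun z => ?_
      refine Tendsto.const_mul _ ((Complex.continuous_ofReal.tendsto _).comp ?_)
      have hz : Tendsto (fun n => c n • z) atTop (𝓝 0) := by simpa using hct.smul_const z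
      have hχ1 : Tendsto (fun n => χ (c n • z)) atTop (𝓝 1) := by
        have := (χ.continuous.tendsto 0).comp hz
        rwa [χ.one_of_mem_closedBall (by simp [χ])] at this
      simpa using hχ1.mul_const (p (A z))
  refine tendsto_nhds_unique hlim1 (hlim2.neg.congr fun n => ?_)
  rw [h (ψ n) (hψc n) (hψs n)]

/-- The test functions in the weak derivative are real, so the exponential is treated through its
cosine and sine. -/
theorem IsWeakDeriv.doubleFourier_eq {u u' : Space d × Space d → ℂ} {v : Space d × Space d}
    (h : IsWeakDeriv u u' v) (hu : Integrable u) (hu' : Integrable u') (k l : Space d) :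
    doubleFourier u' k l =
      Complex.I * ((inner ℝ k v.1 + inner ℝ l v.2 : ℝ) : ℂ) * doubleFourier u k l := by
  let A : Space d × Space d →L[ℝ] ℝ :=
    (innerSL ℝ k).comp (ContinuousLinearMap.fst ℝ _ _) +
      (innerSL ℝ l).comp (ContinuousLinearMap.snd ℝ _ _)
  have hA : ∀ z, A z = inner ℝ k z.1 + inner ℝ l z.2 := fun z => by simp [A]
  have h1 := h.integral_comp_linear hu hu' A Real.contDiff_cos Real.hasDerivAt_cos Real.abs_cos_le_one (fun x => by simpa using Real.abs_sin_le_one x)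
  have h2 := h.integral_comp_linear hu hu' A Real.contDiff_sin Real.hasDerivAt_sin Real.abs_sin_le_one Real.abs_cos_le_one
  have hbd : ∀ {f : Space d × Space d → ℂ} (_ : Integrable f) {p : ℝ → ℝ} (_ : Continuous p)
      (_ : ∀ x, |p x| ≤ 1), Integrable fun z => f z * ((p (A z) : ℝ) : ℂ) := by
    intro f hf p hp hp1
    refine hf.mul_bdd (c := 1) (Continuous.aestronglyMeasurable (by fun_prop))
      (Eventually.of_forall fun z => ?_)
    rw [Complex.norm_real]; exact hp1 _
  have hexp : ∀ {f : Space d × Space d → ℂ} (_ : Integrable f),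
      ∫ z, Complex.exp (-Complex.I * ((inner ℝ k z.1 + inner ℝ l z.2 : ℝ) : ℂ)) * f z =
      (∫ z, f z * ((Real.cos (A z) : ℝ) : ℂ)) - Complex.I * ∫ z, f z * ((Real.sin (A z) : ℝ) : ℂ) := by
    intro f hf
    rw [← integral_const_mul, ← integral_sub (hbd hf Real.continuous_cos Real.abs_cos_le_one)
      ((hbd hf Real.continuous_sin Real.abs_sin_le_one).const_mul _)]
    congr 1
    ext z
    rw [← hA, show -Complex.I * ((A z : ℝ) : ℂ) = ((-A z : ℝ) : ℂ) * Complex.I by push_cast; ring,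
      Complex.exp_mul_I, ← Complex.ofReal_cos, ← Complex.ofReal_sin, Real.cos_neg, Real.sin_neg]
    push_cast
    ring
  have e1 : ∫ z, u' z * ((Real.cos (A z) : ℝ) : ℂ) =
      (A v : ℂ) * ∫ z, u z * ((Real.sin (A z) : ℝ) : ℂ) := by
    rw [← integral_const_mul, ← neg_eq_iff_eq_neg.mpr h1, ← integral_neg]
    congr 1
    ext z
    push_cast [Pi.neg_apply]
    ring
  have e2 : ∫ z, u' z * ((Real.sin (A z) : ℝ) : ℂ) =
      -((A v : ℂ) * ∫ z, u z * ((Real.cos (A z) : ℝ) : ℂ)) := by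
    rw [← integral_const_mul, ← neg_eq_iff_eq_neg.mpr h2]
    congr 2
    ext z
    push_cast
    ring
  rw [doubleFourier, doubleFourier, hexp hu, hexp hu', e1, e2, ← hA]
  linear_combination ((A v : ℂ) * (((2 * Real.pi) ^ d : ℝ) : ℂ)⁻¹ *
    ∫ z, u z * ((Real.sin (A z) : ℝ) : ℂ)) * Complex.I_sq

end Tunnelling

/-! ### Polar coordinates and Fourier inversion in the energy variable. -/

namespace Tunnelling

open Filter Topology Complex

variable {d : ℕ}

section Polar

variable {G : Type*} [NormedAddCommGroup G]

theorem homeomorphUnitSphereProd_smul (x : ({0}ᶜ : Set (Space d))) :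
    ((homeomorphUnitSphereProd (Space d) x).2 : ℝ) •
      ((homeomorphUnitSphereProd (Space d) x).1 : Space d) = x := by
  rw [← homeomorphUnitSphereProd_symm_apply_coe, Homeomorph.symm_apply_apply]

theorem integrable_polar [NeZero d] {f : Space d → G} (hf : Integrable f) :
    Integrable (fun q : Metric.sphere (0 : Space d) 1 × Set.Ioi (0 : ℝ) =>
      f ((q.2 : ℝ) • (q.1 : Space d)))
      ((volume : Measure (Space d)).toSphere.prod (Measure.volumeIoiPow (d - 1))) := by
  have h := (volume : Measure (Space d)).measurePreserving_homeomorphUnitSphereProd.integrable_comp_emb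
    (g := fun q => f ((q.2 : ℝ) • (q.1 : Space d))) (Homeomorph.measurableEmbedding _)
  rw [finrank_euclideanSpace_fin] at h
  rw [← h]
  simp only [Function.comp_def, homeomorphUnitSphereProd_smul]
  exact (integrableOn_iff_comap_subtypeVal (by measurability)).1 hf.integrableOn

variable [NormedSpace ℝ G]

theorem integral_polar_prod [NeZero d] (f : Space d → G) :
    ∫ l, f l = ∫ q : Metric.sphere (0 : Space d) 1 × Set.Ioi (0 : ℝ),
      f ((q.2 : ℝ) • (q.1 : Space d))
      ∂((volume : Measure (Space d)).toSphere.prod (Measure.volumeIoiPow (d - 1))) := by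
  have h := (volume : Measure (Space d)).measurePreserving_homeomorphUnitSphereProd.integral_comp
    (Homeomorph.measurableEmbedding _) (fun q => f ((q.2 : ℝ) • (q.1 : Space d)))
  rw [finrank_euclideanSpace_fin] at h
  rw [← h]
  simp only [homeomorphUnitSphereProd_smul]
  rw [integral_subtype_comap (measurableSet_singleton _).compl fun x ↦ f x,
    restrict_compl_singleton]

theorem integrable_volumeIoiPow_iff (n : ℕ) (g : ℝ → G) :
    Integrable (fun r : Set.Ioi (0 : ℝ) => g r) (Measure.volumeIoiPow n) ↔
      IntegrableOn (fun r => r ^ n • g r) (Set.Ioi 0) := by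
  rw [Measure.volumeIoiPow, integrable_withDensity_iff_integrable_smul' (by fun_prop) (by simp),
    integrableOn_iff_comap_subtypeVal measurableSet_Ioi]
  refine integrable_congr (.of_forall ?_)
  rintro ⟨x, hx : 0 < x⟩
  simp (disch := positivity) [ENNReal.toReal_ofReal]

theorem integral_volumeIoiPow (n : ℕ) (g : ℝ → G) :
    ∫ r : Set.Ioi (0 : ℝ), g r ∂(Measure.volumeIoiPow n) = ∫ r in Set.Ioi 0, r ^ n • g r := by
  simp only [Measure.volumeIoiPow, ENNReal.ofReal]
  rw [integral_withDensity_eq_integral_smul,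
    integral_subtype_comap measurableSet_Ioi fun a ↦ Real.toNNReal (a ^ n) • g a,
    setIntegral_congr_fun measurableSet_Ioi fun x hx ↦ ?_]
  · rw [NNReal.smul_def, Real.coe_toNNReal _ (pow_nonneg hx.out.le _)]
  · exact (measurable_subtype_coe.pow_const _).real_toNNReal

theorem integrableOn_polar [NeZero d] {f : Space d → G} (hf : Integrable f) :
    IntegrableOn (fun r : ℝ => r ^ (d - 1) • ∫ σ : Metric.sphere (0 : Space d) 1,
      f (r • (σ : Space d)) ∂(volume : Measure (Space d)).toSphere) (Set.Ioi 0) :=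
  (integrable_volumeIoiPow_iff _ fun r : ℝ => ∫ σ : Metric.sphere (0 : Space d) 1,
      f (r • (σ : Space d)) ∂(volume : Measure (Space d)).toSphere).1
    (integrable_polar hf).integral_prod_right

theorem integral_polar [NeZero d] {f : Space d → G} (hf : Integrable f) :
    ∫ l, f l = ∫ r in Set.Ioi (0 : ℝ), r ^ (d - 1) • ∫ σ : Metric.sphere (0 : Space d) 1,
      f (r • (σ : Space d)) ∂(volume : Measure (Space d)).toSphere := by
  rw [integral_polar_prod, integral_prod_symm _ (integrable_polar hf)]
  exact integral_volumeIoiPow _ fun r : ℝ => ∫ σ : Metric.sphere (0 : Space d) 1,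
      f (r • (σ : Space d)) ∂(volume : Measure (Space d)).toSphere

end Polar

/-- The density of `m(l) dl` with respect to the energy `e = |l|²`. -/
noncomputable def shellDensity (m : Space d → ℝ) (e : ℝ) : ℝ :=
  (Set.Ioi (0 : ℝ)).indicator (fun e => √e ^ (d - 2) / 2 *
    ∫ σ : Metric.sphere (0 : Space d) 1, m (√e • (σ : Space d))
      ∂(volume : Measure (Space d)).toSphere) e

theorem shellDensity_norm_sq (m : Space d → ℝ) {k : Space d} (hk : k ≠ 0) :
    shellDensity m (‖k‖ ^ 2) = shellIntegral k m := by
  have : 0 < ‖k‖ := norm_pos_iff.2 hk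
  rw [shellDensity, Set.indicator_of_mem (by exact pow_pos this 2), shellIntegral,
    Real.sqrt_sq this.le]

theorem continuous_sphere_integral {m : Space d → ℝ} (hm : Continuous m) :
    Continuous fun r : ℝ => ∫ σ : Metric.sphere (0 : Space d) 1, m (r • (σ : Space d))
      ∂(volume : Measure (Space d)).toSphere := by
  have := continuous_parametric_integral_of_continuous
    (μ := (volume : Measure (Space d)).toSphere)
    (f := fun (r : ℝ) (σ : Metric.sphere (0 : Space d) 1) => m (r • (σ : Space d)))
    (by fun_prop) isCompact_univ
  simpa using this

theorem continuousAt_shellDensity {m : Space d → ℝ} (hm : Continuous m) {e : ℝ} (he : 0 < e) :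
    ContinuousAt (shellDensity m) e := by
  have h : Continuous fun e : ℝ => √e ^ (d - 2) / 2 *
    ∫ σ : Metric.sphere (0 : Space d) 1, m (√e • (σ : Space d))
      ∂(volume : Measure (Space d)).toSphere :=
    ((Real.continuous_sqrt.pow _).div_const 2).mul
      ((continuous_sphere_integral hm).comp Real.continuous_sqrt)
  refine h.continuousAt.congr ?_
  filter_upwards [Ioi_mem_nhds he] with x hx
  rw [shellDensity, Set.indicator_of_mem hx]

/-- The substitution e = r² has Jacobian 2r: it cancels the denominator 2 and raises the power
r^{d-2} to r^{d-1}. -/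
theorem smul_shellDensity_sq (hd : 2 ≤ d) (m : Space d → ℝ) {r : ℝ} (hr : 0 < r) :
    (|(2 : ℝ)| * r ^ ((2 : ℝ) - 1)) • shellDensity m (r ^ (2 : ℝ)) =
      r ^ (d - 1) • ∫ σ : Metric.sphere (0 : Space d) 1, m (r • (σ : Space d))
        ∂(volume : Measure (Space d)).toSphere := by
  rw [Real.rpow_two, shellDensity, Set.indicator_of_mem (by exact pow_pos hr 2),
    Real.sqrt_sq hr.le, show (2 : ℝ) - 1 = 1 by norm_num, Real.rpow_one, abs_two,
    show d - 1 = (d - 2) + 1 by omega, pow_succ]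
  simp only [smul_eq_mul]
  ring

theorem integrable_shellDensity (hd : 2 ≤ d) {m : Space d → ℝ} (hm : Integrable m) :
    Integrable (shellDensity m) := by
  have : NeZero d := ⟨by omega⟩
  change Integrable ((Set.Ioi (0 : ℝ)).indicator _)
  rw [integrable_indicator_iff measurableSet_Ioi]
  have h : IntegrableOn (shellDensity m) (Set.Ioi 0) := by
    rw [← integrableOn_Ioi_comp_rpow_iff (p := 2) _ (by norm_num)]
    exact (integrableOn_polar hm).congr_fun (fun r hr => (smul_shellDensity_sq hd m hr).symm)
      measurableSet_Ioi
  refine h.congr_fun (fun r hr => ?_) measurableSet_Ioi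
  rw [shellDensity, Set.indicator_of_mem hr]

/-- The phase depends on l only through |l|², so it passes through the spherical integral, and
`shellDensity` is the density of the image of m(l) dl under l ↦ |l|². -/
theorem integral_exp_mul_shellDensity (hd : 2 ≤ d) {m : Space d → ℝ} (hm : Integrable m) (t : ℝ) :
    ∫ e : ℝ, Complex.exp (Complex.I * ((t * e : ℝ) : ℂ)) * (shellDensity m e : ℂ) =
      ∫ l : Space d, Complex.exp (Complex.I * ((t * ‖l‖ ^ 2 : ℝ) : ℂ)) * (m l : ℂ) := by
  have : NeZero d := ⟨by omega⟩
  have hI : Integrable fun l : Space d =>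
      Complex.exp (Complex.I * ((t * ‖l‖ ^ 2 : ℝ) : ℂ)) * (m l : ℂ) := by
    refine hm.ofReal.bdd_mul (c := 1) (Continuous.aestronglyMeasurable (by fun_prop))
      (Eventually.of_forall fun l => (norm_exp_I_mul _).le)
  rw [integral_polar hI, ← setIntegral_eq_integral_of_forall_compl_eq_zero (s := Set.Ioi 0),
    ← integral_comp_rpow_Ioi _ (two_ne_zero (α := ℝ))]
  · refine setIntegral_congr_fun measurableSet_Ioi fun r hr => ?_
    have h := smul_shellDensity_sq hd m hr
    have hn : ∀ σ : Metric.sphere (0 : Space d) 1, ‖r • (σ : Space d)‖ = r := fun σ => by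
      rw [norm_smul, Real.norm_of_nonneg (le_of_lt hr)]; simp
    simp_rw [hn]
    rw [integral_const_mul, integral_complex_ofReal]
    simp only [Complex.real_smul, smul_eq_mul, Real.rpow_two] at h ⊢
    have h' := congrArg (fun x : ℝ => (x : ℂ)) h
    simp only [Complex.ofReal_mul] at h'
    rw [Complex.ofReal_mul]
    linear_combination Complex.exp (Complex.I * ((t * r ^ 2 : ℝ) : ℂ)) * h'
  · intro e he
    rw [shellDensity, Set.indicator_of_notMem he]; simp

/-- The Fourier transform with phase e^{-2πiξe} is the Schrödinger evolution at time t = -2πξ. -/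
theorem fourier_shellDensity (hd : 2 ≤ d) {m : Space d → ℝ} (hm : Integrable m) (ξ : ℝ) :
    FourierTransform.fourier (fun e => (shellDensity m e : ℂ)) ξ =
      ∫ l : Space d, Complex.exp (Complex.I * (((-2 * Real.pi * ξ) * ‖l‖ ^ 2 : ℝ) : ℂ)) * (m l : ℂ) := by
  rw [← integral_exp_mul_shellDensity hd hm, Real.fourier_eq']
  congr 1
  ext e
  rw [smul_eq_mul]
  congr 2
  simp
  ring

/-- Fourier inversion on the energy shell. -/
theorem integral_exp_mul_schrodinger (hd : 2 ≤ d) {m : Space d → ℝ} (hm : Integrable m)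
    (hmc : Continuous m)
    (hS : Integrable fun t : ℝ =>
      ∫ l : Space d, Complex.exp (Complex.I * ((t * ‖l‖ ^ 2 : ℝ) : ℂ)) * (m l : ℂ))
    {k : Space d} (hk : k ≠ 0) :
    ∫ t : ℝ, Complex.exp (-Complex.I * ((t * ‖k‖ ^ 2 : ℝ) : ℂ)) *
      ∫ l : Space d, Complex.exp (Complex.I * ((t * ‖l‖ ^ 2 : ℝ) : ℂ)) * (m l : ℂ) =
      2 * Real.pi * (shellIntegral k m : ℂ) := by
  set S : ℝ → ℂ := fun t =>
    ∫ l : Space d, Complex.exp (Complex.I * ((t * ‖l‖ ^ 2 : ℝ) : ℂ)) * (m l : ℂ) with hSdef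
  have hpi : (-2 * Real.pi) ≠ 0 := by simp [Real.pi_ne_zero]
  have hF : FourierTransform.fourier (fun e => (shellDensity m e : ℂ)) =
      fun ξ => S (-2 * Real.pi * ξ) := funext fun ξ => fourier_shellDensity hd hm ξ
  have hFi : Integrable (FourierTransform.fourier (fun e => (shellDensity m e : ℂ))) := by
    rw [hF]; exact hS.comp_mul_left' hpi
  have hinv := Integrable.fourierInv_fourier_eq (integrable_shellDensity hd hm).ofReal hFi
    (v := ‖k‖ ^ 2) (Complex.continuous_ofReal.continuousAt.comp
      (continuousAt_shellDensity hmc (by have := norm_pos_iff.2 hk; positivity)))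
  rw [shellDensity_norm_sq m hk, hF, Real.fourierInv_eq'] at hinv
  rw [← hinv]
  -- The substitution t = -2πξ in the inversion integral yields the factor 2π of the golden rule.
  have := Measure.integral_comp_mul_left
    (fun t : ℝ => Complex.exp (-Complex.I * ((t * ‖k‖ ^ 2 : ℝ) : ℂ)) * S t) (-2 * Real.pi)
  rw [show |(-2 * Real.pi)⁻¹| = (2 * Real.pi)⁻¹ by
    rw [abs_inv, neg_mul, abs_neg, abs_of_pos (by positivity)]] at this
  rw [Complex.real_smul] at this
  have h2 : ((2 * Real.pi : ℝ) : ℂ) ≠ 0 := by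
    rw [Complex.ofReal_ne_zero]; positivity
  rw [Complex.ofReal_inv, eq_inv_mul_iff_mul_eq₀ h2] at this
  rw [← this]
  push_cast
  congr 2
  ext t
  rw [smul_eq_mul]
  congr 2
  simp
  ring

end Tunnelling

/-! ### Dispersive weights, integrable time decay and oscillatory integrals. -/

namespace Tunnelling

open Filter Topology Complex

variable {d : ℕ}

/-- A non-negative weight on pairs of momenta for which the free Schrödinger evolution in the
second variable decays as `|t|^{-d/2}`, uniformly in the first one. -/
structure IsDispersive (M : Space d × Space d → ℝ) : Prop where
  continuous : Continuous M
  nonneg : ∀ z, 0 ≤ M z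
  integrable : Integrable M
  decay : ∃ C, 0 ≤ C ∧ ∀ k, Integrable (fun l => M (k, l)) → ∀ t : ℝ, t ≠ 0 →
    ‖∫ l : Space d, Complex.exp (Complex.I * ((t * ‖l‖ ^ 2 : ℝ) : ℂ)) * (M (k, l) : ℂ)‖ ≤
      C * |t| ^ (-((d : ℝ) / 2))

theorem isDispersive_normSq_doubleFourier {u : Space d × Space d → ℂ} (hu : Integrable u)
    (hu2 : MemLp u 2) : IsDispersive fun z : Space d × Space d => ‖doubleFourier u (-z.1) z.2‖ ^ 2 where
  continuous := ((continuous_doubleFourier hu).comp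
    (by fun_prop : Continuous fun z : Space d × Space d => (-z.1, z.2))).norm.pow 2
  nonneg z := by positivity
  integrable := by
    have h := integrable_normSq_doubleFourier hu hu2
    have hmp : MeasurePreserving (fun z : Space d × Space d => (-z.1, z.2)) :=
      (Measure.measurePreserving_neg (volume : Measure (Space d))).prod (MeasurePreserving.id volume)
    exact hmp.integrable_comp_of_integrable h
  decay := by
    refine ⟨(((2 * Real.pi) ^ d) ^ 2)⁻¹ * ((∫ z, ‖u z‖) ^ 2 * Real.pi ^ ((d : ℝ) / 2)),
      by positivity, fun k hk t ht => ?_⟩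
    refine (norm_integral_schrodinger_le hu (-k) hk ht).trans_eq ?_
    rw [Real.div_rpow Real.pi_pos.le (abs_nonneg t), Real.rpow_neg (abs_nonneg t)]
    ring

theorem IsDispersive.sum {ι : Type*} (s : Finset ι) {M : ι → Space d × Space d → ℝ}
    (h : ∀ i ∈ s, IsDispersive (M i)) : IsDispersive fun z => ∑ i ∈ s, M i z where
  continuous := continuous_finsetSum _ fun i hi => (h i hi).continuous
  nonneg z := Finset.sum_nonneg fun i hi => (h i hi).nonneg z
  integrable := integrable_finsetSum _ fun i hi => (h i hi).integrable
  decay := by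
    choose! C hC0 hC using fun i hi => (h i hi).decay
    refine ⟨∑ i ∈ s, C i, Finset.sum_nonneg hC0, fun k hk t ht => ?_⟩
    have hk' : ∀ i ∈ s, Integrable fun l => M i (k, l) := fun i hi => by
      refine hk.mono' ((h i hi).continuous.comp
        (by fun_prop : Continuous fun l : Space d => (k, l))).aestronglyMeasurable
        (Eventually.of_forall fun l => ?_)
      rw [Real.norm_of_nonneg ((h i hi).nonneg _)]
      exact Finset.single_le_sum (f := fun i => M i (k, l)) (fun j hj => (h j hj).nonneg _) hi
    simp_rw [Complex.ofReal_sum, Finset.mul_sum]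
    rw [integral_finsetSum, Finset.sum_mul]
    · exact (norm_sum_le _ _).trans (Finset.sum_le_sum fun i hi => hC i hi k (hk' i hi) t ht)
    · intro i hi
      exact (hk' i hi).ofReal.bdd_mul (c := 1) (Continuous.aestronglyMeasurable (by fun_prop))
        (Eventually.of_forall fun l => (norm_exp_I_mul _).le)

theorem isDispersive_kernel {w : Kernel d} (hw : IsRegularKernel w) (r r' : Reservoir) :
    IsDispersive fun z : Space d × Space d => ‖kernelFourier w r r' (-z.1) z.2‖ ^ 2 :=
  isDispersive_normSq_doubleFourier (memLp_one_iff_integrable.1 (hw r r').1) (hw r r').2.1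

/-- Summed over the coordinates, |l_j ŵ|² is |l|²|ŵ|², and l_j ŵ is up to a factor of modulus one
the transform of the weak derivative along the j-th direction of the second position. That
derivative is in L¹ ∩ L², so each summand is dispersive. -/
theorem isDispersive_norm_sq_mul_kernel {w : Kernel d} (hw : IsRegularKernel w) (r r' : Reservoir) :
    IsDispersive fun z : Space d × Space d => ‖z.2‖ ^ 2 * ‖kernelFourier w r r' (-z.1) z.2‖ ^ 2 := by
  obtain ⟨h1, -, h3⟩ := hw r r'
  choose w' hw1 hw2 hd using fun j : Fin d =>
    h3 ((0 : Space d), EuclideanSpace.single j (1 : ℝ))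
  have h := IsDispersive.sum Finset.univ fun j _ =>
    isDispersive_normSq_doubleFourier (memLp_one_iff_integrable.1 (hw1 j)) (hw2 j)
  convert h using 2 with z
  have e : ∀ j, doubleFourier (w' j) (-z.1) z.2 =
      Complex.I * ((z.2 j : ℝ) : ℂ) * doubleFourier (w r r') (-z.1) z.2 := fun j => by
    rw [IsWeakDeriv.doubleFourier_eq (hd j) (memLp_one_iff_integrable.1 h1)
      (memLp_one_iff_integrable.1 (hw1 j))]
    simp [EuclideanSpace.inner_single_right]
  simp_rw [e, norm_mul, Complex.norm_I, one_mul, Complex.norm_real, mul_pow]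
  rw [← Finset.sum_mul, EuclideanSpace.norm_sq_eq]
  rfl

/-- The time decay `(1 + |t|)^{-3/2}`. -/
noncomputable def timeDecay (t : ℝ) : ℝ := (1 + |t|) ^ (-(3 / 2 : ℝ))

theorem timeDecay_pos (t : ℝ) : 0 < timeDecay t := by unfold timeDecay; positivity

theorem integrable_timeDecay : Integrable timeDecay := by
  have := integrable_one_add_norm (E := ℝ) (μ := volume) (r := 3 / 2) (by norm_num)
  exact this

/-- Peetre's inequality 1 + |t| ≤ (1 + |s|)(1 + |t + s|): a bounded shift of time costs only a
constant. -/
theorem timeDecay_add_le (t s : ℝ) : timeDecay (t + s) ≤ (1 + |s|) ^ (3 / 2 : ℝ) * timeDecay t := by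
  have h : 1 + |t| ≤ (1 + |s|) * (1 + |t + s|) := by
    have : |t| ≤ |t + s| + |s| := by
      have := abs_sub (t + s) s
      rwa [add_sub_cancel_right] at this
    nlinarith [abs_nonneg s, abs_nonneg (t + s)]
  unfold timeDecay
  rw [Real.rpow_neg (by positivity), Real.rpow_neg (by positivity), ← div_eq_mul_inv,
    inv_eq_one_div, div_le_div_iff₀ (by positivity) (by positivity), one_mul,
    ← Real.mul_rpow (by positivity) (by positivity)]
  gcongr

/-- The bound m serves for |t| ≤ 1 and the power for |t| > 1, where d ≥ 3 gives |t|^{-d/2} ≤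
|t|^{-3/2}. The constant 4 majorises 2^{3/2}. -/
theorem le_timeDecay (hd : 3 ≤ d) {x m C t : ℝ} (hm : 0 ≤ m) (hC : 0 ≤ C) (h1 : x ≤ m)
    (h2 : t ≠ 0 → x ≤ C * |t| ^ (-((d : ℝ) / 2))) : x ≤ 4 * (m + C) * timeDecay t := by
  have key : ∀ a : ℝ, 0 ≤ a → a ≤ 1 → 1 ≤ 4 * (1 + a) ^ (-(3 / 2 : ℝ)) := fun a h0 h1 => by
    have : (1 + a) ^ (3 / 2 : ℝ) ≤ 4 := by
      calc (1 + a) ^ (3 / 2 : ℝ) ≤ 2 ^ (2 : ℝ) := by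
            refine (Real.rpow_le_rpow (by positivity) (by linarith) (by norm_num)).trans
              (Real.rpow_le_rpow_of_exponent_le one_le_two (by norm_num))
        _ = 4 := by norm_num
    rw [Real.rpow_neg (by positivity), ← div_eq_mul_inv, le_div_iff₀ (by positivity)]
    linarith
  rcases le_or_gt |t| 1 with ht | ht
  · have := key _ (abs_nonneg t) ht
    calc x ≤ m + C := by linarith
      _ = (m + C) * 1 := (mul_one _).symm
      _ ≤ (m + C) * (4 * (1 + |t|) ^ (-(3 / 2 : ℝ))) := by gcongr
      _ = _ := by unfold timeDecay; ring
  · have ht0 : t ≠ 0 := by rintro rfl; simp at ht; linarith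
    have hpos : 0 < |t| := abs_pos.2 ht0
    have hle : |t| ^ (-((d : ℝ) / 2)) ≤ 4 * timeDecay t := by
      have h3 : (3 : ℝ) ≤ d := by exact_mod_cast hd
      calc |t| ^ (-((d : ℝ) / 2)) ≤ |t| ^ (-(3 / 2 : ℝ)) :=
            Real.rpow_le_rpow_of_exponent_le ht.le (by linarith)
        _ ≤ |t| ^ (-(3 / 2 : ℝ)) * (4 * (1 + |t|⁻¹) ^ (-(3 / 2 : ℝ))) :=
            le_mul_of_one_le_right (by positivity) (key _ (by positivity) (inv_le_one_of_one_le₀ ht.le))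
        _ = 4 * (|t| * (1 + |t|⁻¹)) ^ (-(3 / 2 : ℝ)) := by
            rw [Real.mul_rpow (by positivity) (by positivity)]; ring
        _ = _ := by
            unfold timeDecay
            rw [mul_add, mul_one, mul_inv_cancel₀ hpos.ne', add_comm]
    calc x ≤ C * |t| ^ (-((d : ℝ) / 2)) := h2 ht0
      _ ≤ C * (4 * timeDecay t) := by gcongr
      _ ≤ (m + C) * (4 * timeDecay t) := by
          have := timeDecay_pos t
          gcongr; linarith
      _ = _ := by ring

/-- The free Schrödinger evolution of a slice of the weight `M`. -/
noncomputable def sliceEvolution (M : Space d × Space d → ℝ) (k : Space d) (t : ℝ) : ℂ :=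
  ∫ l : Space d, Complex.exp (Complex.I * ((t * ‖l‖ ^ 2 : ℝ) : ℂ)) * (M (k, l) : ℂ)

theorem IsDispersive.slice_bound (hd : 3 ≤ d) {M : Space d × Space d → ℝ} (hM : IsDispersive M) :
    ∃ C, 0 ≤ C ∧ ∀ k, Integrable (fun l => M (k, l)) → ∀ t : ℝ,
      ‖sliceEvolution M k t‖ ≤ 4 * ((∫ l, M (k, l)) + C) * timeDecay t := by
  obtain ⟨C, hC0, hC⟩ := hM.decay
  refine ⟨C, hC0, fun k hk t => le_timeDecay hd (integral_nonneg fun l => hM.nonneg _) hC0 ?_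
    fun ht => hC k hk t ht⟩
  refine (norm_integral_le_integral_norm _).trans_eq (integral_congr_ae (Eventually.of_forall
    fun l => ?_))
  simp only
  rw [norm_mul, norm_exp_I_mul, one_mul, Complex.norm_real, Real.norm_of_nonneg (hM.nonneg _)]

/-- A bounded, continuous and integrable function of the momentum. -/
structure IsWeight (c : Space d → ℝ) : Prop where
  continuous : Continuous c
  integrable : Integrable c
  bounded : ∃ B, ∀ k, |c k| ≤ B

/-- The oscillatory integral of `c(k) M(k,l) e^{i(t₂|l|² - t₁|k|²)}`. -/
noncomputable def oscillation (c : Space d → ℝ) (M : Space d × Space d → ℝ) (t₁ t₂ : ℝ) : ℂ :=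
  ∫ z : Space d × Space d,
    Complex.exp (Complex.I * ((t₂ * ‖z.2‖ ^ 2 - t₁ * ‖z.1‖ ^ 2 : ℝ) : ℂ)) * ((c z.1 * M z : ℝ) : ℂ)

section Oscillation

variable {c : Space d → ℝ} {M : Space d × Space d → ℝ}

theorem IsWeight.integrable_mul (hc : IsWeight c) (hM : IsDispersive M) :
    Integrable fun z : Space d × Space d => c z.1 * M z := by
  obtain ⟨B, hB⟩ := hc.bounded
  exact hM.integrable.bdd_mul (c := B) (hc.continuous.comp continuous_fst).aestronglyMeasurable
    (Eventually.of_forall fun z => hB _)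

theorem oscillation_eq (hc : IsWeight c) (hM : IsDispersive M) (t₁ t₂ : ℝ) :
    oscillation c M t₁ t₂ = ∫ k : Space d,
      (c k : ℂ) * (Complex.exp (-Complex.I * ((t₁ * ‖k‖ ^ 2 : ℝ) : ℂ)) * sliceEvolution M k t₂) := by
  have hI : Integrable fun z : Space d × Space d =>
      Complex.exp (Complex.I * ((t₂ * ‖z.2‖ ^ 2 - t₁ * ‖z.1‖ ^ 2 : ℝ) : ℂ)) *
        ((c z.1 * M z : ℝ) : ℂ) :=
    (hc.integrable_mul hM).ofReal.bdd_mul (c := 1) (Continuous.aestronglyMeasurable (by fun_prop))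
        (Eventually.of_forall fun l => (norm_exp_I_mul _).le)
  rw [oscillation, Measure.volume_eq_prod, integral_prod _ hI]
  congr 1
  ext k
  rw [sliceEvolution, ← integral_const_mul, ← integral_const_mul]
  congr 1
  ext l
  rw [show Complex.I * ((t₂ * ‖l‖ ^ 2 - t₁ * ‖k‖ ^ 2 : ℝ) : ℂ) =
    -Complex.I * ((t₁ * ‖k‖ ^ 2 : ℝ) : ℂ) + Complex.I * ((t₂ * ‖l‖ ^ 2 : ℝ) : ℂ) by push_cast; ring,
    Complex.exp_add]
  push_cast
  ring

theorem IsDispersive.ae_slice (hM : IsDispersive M) :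
    ∀ᵐ k : Space d, Integrable fun l => M (k, l) :=
  Integrable.prod_right_ae (by simpa [Measure.volume_eq_prod] using hM.integrable)

theorem IsWeight.integrable_mul_slice (hc : IsWeight c) (hM : IsDispersive M) (C : ℝ) :
    Integrable fun k => |c k| * (4 * ((∫ l, M (k, l)) + C)) := by
  have h1 : Integrable fun k => |c k| * ∫ l, M (k, l) := by
    obtain ⟨B, hB⟩ := hc.bounded
    exact hM.integrable.integral_prod_left.bdd_mul (c := B) hc.continuous.abs.aestronglyMeasurable
      (Eventually.of_forall fun z => by rw [Real.norm_eq_abs, abs_abs]; exact hB _)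
  exact ((h1.add (hc.integrable.abs.mul_const C)).const_mul 4).congr
    (Eventually.of_forall fun k => by simp only [Pi.add_apply]; ring)

/-- All the decay comes from the inner integral over l, hence from t₂; the phase in t₁ has modulus
one. The remaining integral over k converges because c is both bounded and integrable. -/
theorem exists_oscillation_bound (hd : 3 ≤ d) (hc : IsWeight c) (hM : IsDispersive M) :
    ∃ C, 0 ≤ C ∧ ∀ t₁ t₂, ‖oscillation c M t₁ t₂‖ ≤ C * timeDecay t₂ := by
  obtain ⟨C, hC0, hC⟩ := hM.slice_bound hd
  refine ⟨∫ k, |c k| * (4 * ((∫ l, M (k, l)) + C)), integral_nonneg fun k => ?_, fun t₁ t₂ => ?_⟩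
  · have : 0 ≤ ∫ l, M (k, l) := integral_nonneg fun l => hM.nonneg _
    simp only [Pi.zero_apply]
    positivity
  rw [oscillation_eq hc hM, ← integral_mul_const]
  refine norm_integral_le_of_norm_le ((hc.integrable_mul_slice hM C).mul_const _) ?_
  filter_upwards [hM.ae_slice] with k hk
  rw [norm_mul, norm_mul, Complex.norm_real, norm_exp_neg_I_mul, one_mul, mul_assoc,
    Real.norm_eq_abs]
  gcongr
  exact hC k hk t₂

theorem continuous_oscillation (hc : IsWeight c) (hM : IsDispersive M) :
    Continuous fun p : ℝ × ℝ => oscillation c M p.1 p.2 := by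
  have hI := (hc.integrable_mul hM).ofReal (𝕜 := ℂ)
  refine continuous_of_dominated (bound := fun z => ‖((c z.1 * M z : ℝ) : ℂ)‖) (fun p => ?_)
    (fun p => Eventually.of_forall fun z => ?_) hI.norm (Eventually.of_forall fun z => ?_)
  · exact (Continuous.aestronglyMeasurable (by fun_prop)).mul hI.1
  · rw [norm_mul, norm_exp_I_mul, one_mul]
  · fun_prop

theorem integrable_oscillation (hd : 3 ≤ d) (hc : IsWeight c) (hM : IsDispersive M) (x y : ℝ) :
    Integrable fun t => oscillation c M (t + x) (t + y) := by
  obtain ⟨C, hC0, hC⟩ := exists_oscillation_bound hd hc hM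
  refine ((integrable_timeDecay.comp_add_right y).const_mul C).mono'
    ((continuous_oscillation hc hM).comp
      (by fun_prop : Continuous fun t : ℝ => (t + x, t + y))).aestronglyMeasurable
    (Eventually.of_forall fun t => hC _ _)

theorem stronglyMeasurable_sliceEvolution (hM : Continuous M) :
    StronglyMeasurable fun p : ℝ × Space d => sliceEvolution M p.2 p.1 := by
  have : Continuous fun q : (ℝ × Space d) × Space d =>
      Complex.exp (Complex.I * ((q.1.1 * ‖q.2‖ ^ 2 : ℝ) : ℂ)) * (M (q.1.2, q.2) : ℂ) := by fun_prop
  exact this.stronglyMeasurable.integral_prod_right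

/-- Absolute integrability jointly in time and momentum, which permits integrating over t first for
fixed k. -/
theorem integrable_mul_sliceEvolution (hd : 3 ≤ d) (hc : IsWeight c) (hM : IsDispersive M) :
    Integrable (Function.uncurry fun (t : ℝ) (k : Space d) => (c k : ℂ) *
      (Complex.exp (-Complex.I * ((t * ‖k‖ ^ 2 : ℝ) : ℂ)) * sliceEvolution M k t))
      ((volume : Measure ℝ).prod (volume : Measure (Space d))) := by
  obtain ⟨C, hC0, hC⟩ := hM.slice_bound hd
  refine (integrable_timeDecay.mul_prod (hc.integrable_mul_slice hM C)).mono' ?_ ?_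
  · exact (hc.continuous.comp continuous_snd).measurable.complex_ofReal.aestronglyMeasurable.mul
      ((Continuous.aestronglyMeasurable (by fun_prop)).mul
        (stronglyMeasurable_sliceEvolution hM.continuous).aestronglyMeasurable)
  · have h := (Measure.quasiMeasurePreserving_snd (μ := (volume : Measure ℝ))
      (ν := (volume : Measure (Space d)))).ae hM.ae_slice
    filter_upwards [h] with p hp
    simp only [Function.uncurry]
    rw [norm_mul, norm_mul, Complex.norm_real, norm_exp_neg_I_mul, one_mul, mul_comm (timeDecay _),
      mul_assoc, Real.norm_eq_abs]
    gcongr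
    exact hC _ hp _

/-- Inversion applies to almost every k: the slice must be integrable, and k = 0 is excluded since
the energy density need not be continuous at energy zero. -/
theorem ae_integral_mul_sliceEvolution (hd : 3 ≤ d) (c : Space d → ℝ) (hM : IsDispersive M) :
    ∀ᵐ k : Space d, ∫ t : ℝ, (c k : ℂ) *
      (Complex.exp (-Complex.I * ((t * ‖k‖ ^ 2 : ℝ) : ℂ)) * sliceEvolution M k t) =
      2 * Real.pi * ((c k * shellIntegral k fun l => M (k, l) : ℝ) : ℂ) := by
  obtain ⟨C, hC0, hC⟩ := hM.slice_bound hd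
  have : NeZero d := ⟨by omega⟩
  filter_upwards [hM.ae_slice, (measure_eq_zero_iff_ae_notMem.1
    (measure_singleton (μ := (volume : Measure (Space d))) 0))] with k hk hk0
  rw [integral_const_mul, Complex.ofReal_mul]
  simp only [sliceEvolution]
  rw [integral_exp_mul_schrodinger (by omega) hk
    (hM.continuous.comp (by fun_prop : Continuous fun l : Space d => (k, l))) ?_ (by simpa using hk0)]
  · ring
  · refine (integrable_timeDecay.const_mul (4 * ((∫ l, M (k, l)) + C))).mono' ?_
      (Eventually.of_forall fun t => (hC k hk t).trans_eq (by ring))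
    exact ((stronglyMeasurable_sliceEvolution hM.continuous).comp_measurable
      (by fun_prop : Measurable fun t : ℝ => (t, k))).aestronglyMeasurable

/-- No direct estimate on spheres is needed: up to 2π the function is almost everywhere the time
integral of a jointly integrable function. -/
theorem integrable_mul_shellIntegral (hd : 3 ≤ d) (hc : IsWeight c) (hM : IsDispersive M) :
    Integrable fun k => c k * shellIntegral k fun l => M (k, l) := by
  have h := (integrable_mul_sliceEvolution hd hc hM).integral_prod_right
  have h2 := ((h.congr (ae_integral_mul_sliceEvolution hd c hM)).const_mul
    (2 * Real.pi : ℂ)⁻¹).re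
  refine h2.congr (Eventually.of_forall fun k => ?_)
  simp only
  rw [inv_mul_cancel_left₀ (by simp [Real.pi_ne_zero])]
  exact Complex.ofReal_re _

theorem integral_oscillation (hd : 3 ≤ d) (hc : IsWeight c) (hM : IsDispersive M) :
    ∫ t, oscillation c M t t =
      2 * Real.pi * ((∫ k, c k * shellIntegral k fun l => M (k, l) : ℝ) : ℂ) := by
  simp_rw [oscillation_eq hc hM]
  rw [integral_integral_swap (integrable_mul_sliceEvolution hd hc hM),
    ← integral_complex_ofReal, ← integral_const_mul]
  exact integral_congr_ae (ae_integral_mul_sliceEvolution hd c hM)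

theorem oscillation_neg (c : Space d → ℝ) (M : Space d × Space d → ℝ) (t₁ t₂ : ℝ) :
    oscillation c M (-t₁) (-t₂) = (starRingEnd ℂ) (oscillation c M t₁ t₂) := by
  rw [oscillation, oscillation, ← integral_conj]
  congr 1
  ext z
  rw [map_mul, Complex.conj_ofReal, ← Complex.exp_conj, map_mul, Complex.conj_I, Complex.conj_ofReal]
  congr 2
  push_cast
  ring

end Oscillation

end Tunnelling

/-! ### Correlation functions and their derivative in the flow parameter. -/

namespace Tunnelling

open Filter Topology Complex

variable {d : ℕ} {c : Space d → ℝ} {M : Space d × Space d → ℝ}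

/-- The derivative brings down a'|l|² - a|k|². The factor |l|² is attached to M and |k|² to c, so
that both terms are again oscillatory integrals with admissible data. -/
theorem hasDerivAt_oscillation (hc : IsWeight c) (hc1 : IsWeight fun k => ‖k‖ ^ 2 * c k)
    (hM : IsDispersive M) (hM1 : IsDispersive fun z => ‖z.2‖ ^ 2 * M z) (a a' t s : ℝ) :
    HasDerivAt (fun s => oscillation c M (t + s * a) (t + s * a'))
      (Complex.I * (a' * oscillation c (fun z => ‖z.2‖ ^ 2 * M z) (t + s * a) (t + s * a') -
        a * oscillation (fun k => ‖k‖ ^ 2 * c k) M (t + s * a) (t + s * a'))) s := by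
  have hI := hc.integrable_mul hM
  have hI1 := hc.integrable_mul hM1
  have hI2 := hc1.integrable_mul hM
  have hF : ∀ s, Integrable fun z : Space d × Space d =>
      Complex.exp (Complex.I * (((t + s * a') * ‖z.2‖ ^ 2 - (t + s * a) * ‖z.1‖ ^ 2 : ℝ) : ℂ)) *
        ((c z.1 * M z : ℝ) : ℂ) := fun s =>
    hI.ofReal.bdd_mul (c := 1) (Continuous.aestronglyMeasurable (by fun_prop))
        (Eventually.of_forall fun l => (norm_exp_I_mul _).le)
  have hMc := hM.continuous
  have hcc := hc.continuous
  have h := (hasDerivAt_integral_of_dominated_loc_of_deriv_le (μ := volume) (x₀ := s) (s := Set.univ)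
    (F := fun s (z : Space d × Space d) => Complex.exp (Complex.I *
      (((t + s * a') * ‖z.2‖ ^ 2 - (t + s * a) * ‖z.1‖ ^ 2 : ℝ) : ℂ)) * ((c z.1 * M z : ℝ) : ℂ))
    (F' := fun s z => Complex.exp (Complex.I *
      (((t + s * a') * ‖z.2‖ ^ 2 - (t + s * a) * ‖z.1‖ ^ 2 : ℝ) : ℂ)) *
        (Complex.I * ((a' * ‖z.2‖ ^ 2 - a * ‖z.1‖ ^ 2 : ℝ) : ℂ)) * ((c z.1 * M z : ℝ) : ℂ))
    (bound := fun z => |a'| * |c z.1 * (‖z.2‖ ^ 2 * M z)| + |a| * |‖z.1‖ ^ 2 * c z.1 * M z|)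
    univ_mem (Eventually.of_forall fun s => (hF s).1) (hF s)
    (Continuous.aestronglyMeasurable (by fun_prop)) ?_ ?_ ?_).2
  · refine h.congr_deriv ?_
    simp only [oscillation]
    rw [← integral_const_mul, ← integral_const_mul, ← integral_sub, ← integral_const_mul]
    · congr 1
      ext z
      push_cast
      ring
    · exact (hI1.ofReal.bdd_mul (c := 1) (Continuous.aestronglyMeasurable (by fun_prop))
        (Eventually.of_forall fun l => (norm_exp_I_mul _).le)).const_mul _
    · exact (hI2.ofReal.bdd_mul (c := 1) (Continuous.aestronglyMeasurable (by fun_prop))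
        (Eventually.of_forall fun l => (norm_exp_I_mul _).le)).const_mul _
  · refine Eventually.of_forall fun z s _ => ?_
    rw [norm_mul, norm_mul, norm_exp_I_mul, one_mul, norm_mul, Complex.norm_I, one_mul,
      Complex.norm_real, Complex.norm_real, ← norm_mul, ← abs_mul, ← abs_mul,
      show (a' * ‖z.2‖ ^ 2 - a * ‖z.1‖ ^ 2) * (c z.1 * M z) =
        a' * (c z.1 * (‖z.2‖ ^ 2 * M z)) - a * (‖z.1‖ ^ 2 * c z.1 * M z) by ring]
    exact abs_sub _ _
  · exact (hI1.abs.const_mul _).add (hI2.abs.const_mul _)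
  · refine Eventually.of_forall fun z s _ => ?_
    refine HasDerivAt.mul_const ?_ _
    have h1 : HasDerivAt (fun s : ℝ => (t + s * a') * ‖z.2‖ ^ 2 - (t + s * a) * ‖z.1‖ ^ 2)
        (a' * ‖z.2‖ ^ 2 - a * ‖z.1‖ ^ 2) s := by
      have e1 := (((hasDerivAt_id s).mul_const a').const_add t).mul_const (‖z.2‖ ^ 2)
      have e2 := (((hasDerivAt_id s).mul_const a).const_add t).mul_const (‖z.1‖ ^ 2)
      simpa using e1.fun_sub e2
    exact (h1.ofReal_comp.const_mul Complex.I).cexp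

/-- The correlation function of a pair of reservoirs, with phases `s (a |k|² + b)` and
`s (a' |l|² + b')`. -/
noncomputable def correlation (c : Space d → ℝ) (M : Space d × Space d → ℝ) (a a' b b' t s : ℝ) : ℂ :=
  Complex.exp (Complex.I * ((s * (b' - b) : ℝ) : ℂ)) * oscillation c M (t + s * a) (t + s * a')

/-- `-i` times the derivative of `correlation` with respect to `s`. -/
noncomputable def correlationDeriv (c : Space d → ℝ) (M : Space d × Space d → ℝ)
    (a a' b b' t s : ℝ) : ℂ :=
  Complex.exp (Complex.I * ((s * (b' - b) : ℝ) : ℂ)) *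
    (a' * oscillation c (fun z => ‖z.2‖ ^ 2 * M z) (t + s * a) (t + s * a') -
      a * oscillation (fun k => ‖k‖ ^ 2 * c k) M (t + s * a) (t + s * a') +
      (b' - b) * oscillation c M (t + s * a) (t + s * a'))

theorem hasDerivAt_correlation (hc : IsWeight c) (hc1 : IsWeight fun k => ‖k‖ ^ 2 * c k)
    (hM : IsDispersive M) (hM1 : IsDispersive fun z => ‖z.2‖ ^ 2 * M z) (a a' b b' t s : ℝ) :
    HasDerivAt (correlation c M a a' b b' t) (Complex.I * correlationDeriv c M a a' b b' t s) s := by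
  have h1 : HasDerivAt (fun s : ℝ => Complex.exp (Complex.I * ((s * (b' - b) : ℝ) : ℂ)))
      (Complex.exp (Complex.I * ((s * (b' - b) : ℝ) : ℂ)) * (Complex.I * ((b' - b : ℝ) : ℂ))) s := by
    have : HasDerivAt (fun s : ℝ => s * (b' - b)) (b' - b) s := by
      simpa using (hasDerivAt_id s).mul_const (b' - b)
    exact (this.ofReal_comp.const_mul Complex.I).cexp
  refine (h1.fun_mul (hasDerivAt_oscillation hc hc1 hM hM1 a a' t s)).congr_deriv ?_
  rw [correlationDeriv]
  push_cast
  ring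

theorem integrable_correlation (hd : 3 ≤ d) (hc : IsWeight c) (hM : IsDispersive M)
    (a a' b b' s : ℝ) : Integrable fun t => correlation c M a a' b b' t s :=
  (integrable_oscillation hd hc hM _ _).const_mul _

theorem integrable_correlationDeriv (hd : 3 ≤ d) (hc : IsWeight c)
    (hc1 : IsWeight fun k => ‖k‖ ^ 2 * c k) (hM : IsDispersive M)
    (hM1 : IsDispersive fun z => ‖z.2‖ ^ 2 * M z) (a a' b b' s : ℝ) :
    Integrable fun t => correlationDeriv c M a a' b b' t s :=
  ((((integrable_oscillation hd hc hM1 _ _).const_mul _).sub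
    ((integrable_oscillation hd hc1 hM _ _).const_mul _)).add
    ((integrable_oscillation hd hc hM _ _).const_mul _)).const_mul _

theorem exists_correlationDeriv_bound (hd : 3 ≤ d) (hc : IsWeight c)
    (hc1 : IsWeight fun k => ‖k‖ ^ 2 * c k) (hM : IsDispersive M)
    (hM1 : IsDispersive fun z => ‖z.2‖ ^ 2 * M z) (a a' b b' : ℝ) :
    ∃ C, ∀ t s, |s| ≤ 1 → ‖correlationDeriv c M a a' b b' t s‖ ≤ C * timeDecay t := by
  obtain ⟨C1, h10, h1⟩ := exists_oscillation_bound hd hc hM1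
  obtain ⟨C2, h20, h2⟩ := exists_oscillation_bound hd hc1 hM
  obtain ⟨C3, h30, h3⟩ := exists_oscillation_bound hd hc hM
  refine ⟨(|a'| * C1 + |a| * C2 + |b' - b| * C3) * (1 + |a'|) ^ (3 / 2 : ℝ), fun t s hs => ?_⟩
  -- For |s| ≤ 1 the shift s a' is at most |a'|, which makes the bound uniform in s and allows
  -- differentiation under the time integral.
  have ht : timeDecay (t + s * a') ≤ (1 + |a'|) ^ (3 / 2 : ℝ) * timeDecay t := by
    refine (timeDecay_add_le _ _).trans (mul_le_mul_of_nonneg_right ?_ (timeDecay_pos t).le)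
    refine Real.rpow_le_rpow (by positivity) (add_le_add_right ?_ 1) (by norm_num)
    rw [abs_mul]
    exact mul_le_of_le_one_left (abs_nonneg _) hs
  calc ‖correlationDeriv c M a a' b b' t s‖
      ≤ |a'| * (C1 * timeDecay (t + s * a')) + |a| * (C2 * timeDecay (t + s * a')) +
        |b' - b| * (C3 * timeDecay (t + s * a')) := by
        rw [correlationDeriv, norm_mul, norm_exp_I_mul, one_mul]
        refine (norm_add_le _ _).trans (add_le_add ((norm_sub_le _ _).trans (add_le_add ?_ ?_)) ?_)
        · rw [norm_mul, Complex.norm_real, Real.norm_eq_abs]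
          gcongr
          exact h1 _ _
        · rw [norm_mul, Complex.norm_real, Real.norm_eq_abs]
          gcongr
          exact h2 _ _
        · rw [norm_mul, ← Complex.ofReal_sub, Complex.norm_real, Real.norm_eq_abs]
          gcongr
          exact h3 _ _
    _ = (|a'| * C1 + |a| * C2 + |b' - b| * C3) * timeDecay (t + s * a') := by ring
    _ ≤ _ := by
        rw [mul_assoc]
        gcongr

theorem hasDerivAt_integral_correlation (hd : 3 ≤ d) (hc : IsWeight c)
    (hc1 : IsWeight fun k => ‖k‖ ^ 2 * c k) (hM : IsDispersive M)
    (hM1 : IsDispersive fun z => ‖z.2‖ ^ 2 * M z) (a a' b b' : ℝ) :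
    HasDerivAt (fun s => ∫ t in Set.Ioi 0, correlation c M a a' b b' t s)
      (∫ t in Set.Ioi 0, Complex.I * correlationDeriv c M a a' b b' t 0) 0 := by
  obtain ⟨C, hC⟩ := exists_correlationDeriv_bound hd hc hc1 hM hM1 a a' b b'
  exact (hasDerivAt_integral_of_dominated_loc_of_deriv_le (μ := volume.restrict (Set.Ioi 0))
    (x₀ := 0) (s := Metric.ball 0 1)
    (F := fun s t => correlation c M a a' b b' t s)
    (F' := fun s t => Complex.I * correlationDeriv c M a a' b b' t s)
    (bound := fun t => C * timeDecay t) (Metric.ball_mem_nhds _ one_pos)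
    (Eventually.of_forall fun s => (integrable_correlation hd hc hM a a' b b' s).1.restrict)
    (integrable_correlation hd hc hM a a' b b' 0).restrict
    ((integrable_correlationDeriv hd hc hc1 hM hM1 a a' b b' 0).1.restrict.const_mul _)
    (Eventually.of_forall fun t s hs => by
      rw [norm_mul, Complex.norm_I, one_mul]
      refine hC t s ?_
      rw [Metric.mem_ball, dist_zero_right] at hs
      exact hs.le)
    (integrable_timeDecay.const_mul C).restrict
    (Eventually.of_forall fun t s _ => hasDerivAt_correlation hc hc1 hM hM1 a a' b b' t s)).2

theorem shellIntegral_mul_left {k : Space d} (y : ℝ → ℝ) (m : Space d → ℝ) :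
    (shellIntegral k fun l => y ‖l‖ * m l) = y ‖k‖ * shellIntegral k m := by
  have hn : ∀ σ : Metric.sphere (0 : Space d) 1, ‖‖k‖ • (σ : Space d)‖ = ‖k‖ := fun σ => by
    rw [norm_smul, norm_norm]; simp
  simp only [shellIntegral, hn]
  rw [integral_const_mul]
  ring

/-- On the shell |l|² may be replaced by |k|², so the charge transferred in a tunnelling event
becomes (a' - a)|k|² + (b' - b). -/
theorem integral_correlationDeriv (hd : 3 ≤ d) (hc : IsWeight c)
    (hc1 : IsWeight fun k => ‖k‖ ^ 2 * c k) (hM : IsDispersive M)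
    (hM1 : IsDispersive fun z => ‖z.2‖ ^ 2 * M z) (a a' b b' : ℝ) :
    ∫ t, correlationDeriv c M a a' b b' t 0 = 2 * Real.pi * ((∫ k, c k *
      (((a' - a) * ‖k‖ ^ 2 + (b' - b)) * shellIntegral k fun l => M (k, l)) : ℝ) : ℂ) := by
  have i1 := integrable_oscillation hd hc hM1 0 0
  have i2 := integrable_oscillation hd hc1 hM 0 0
  have i3 := integrable_oscillation hd hc hM 0 0
  have j2 := integrable_mul_shellIntegral hd hc1 hM
  have j3 := integrable_mul_shellIntegral hd hc hM
  simp only [add_zero] at i1 i2 i3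
  simp only [correlationDeriv, zero_mul, Complex.ofReal_zero, mul_zero, Complex.exp_zero, one_mul,
    add_zero]
  rw [integral_add ((i1.const_mul _).sub' (i2.const_mul _)) (i3.const_mul _),
    integral_sub (i1.const_mul _) (i2.const_mul _), integral_const_mul, integral_const_mul,
    integral_const_mul, integral_oscillation hd hc hM1, integral_oscillation hd hc1 hM,
    integral_oscillation hd hc hM]
  simp only [shellIntegral_mul_left (fun x => x ^ 2)]
  have e : (∫ k, c k * (((a' - a) * ‖k‖ ^ 2 + (b' - b)) * shellIntegral k fun l => M (k, l))) =
      (a' - a) * (∫ k, ‖k‖ ^ 2 * c k * shellIntegral k fun l => M (k, l)) +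
      (b' - b) * (∫ k, c k * shellIntegral k fun l => M (k, l)) := by
    rw [← integral_const_mul, ← integral_const_mul, ← integral_add (j2.const_mul _) (j3.const_mul _)]
    congr 1
    ext k
    ring
  have e' : (∫ k, c k * (‖k‖ ^ 2 * shellIntegral k fun l => M (k, l))) =
      ∫ k, ‖k‖ ^ 2 * c k * shellIntegral k fun l => M (k, l) := by
    congr 1
    ext k
    ring
  rw [e, e']
  push_cast
  ring

/-- At s = 0 the weights are real and only the phase is complex, so conjugation is the reflection t
↦ -t and supplies the missing half-line. -/
theorem integral_Ioi_correlationDeriv_add_conj (hd : 3 ≤ d) (hc : IsWeight c)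
    (hc1 : IsWeight fun k => ‖k‖ ^ 2 * c k) (hM : IsDispersive M)
    (hM1 : IsDispersive fun z => ‖z.2‖ ^ 2 * M z) (a a' b b' : ℝ) :
    (∫ t in Set.Ioi 0, correlationDeriv c M a a' b b' t 0) +
      (starRingEnd ℂ) (∫ t in Set.Ioi 0, correlationDeriv c M a a' b b' t 0) =
      ∫ t, correlationDeriv c M a a' b b' t 0 := by
  have hi := integrable_correlationDeriv hd hc hc1 hM hM1 a a' b b' 0
  have h : ∀ t, (starRingEnd ℂ) (correlationDeriv c M a a' b b' t 0) =
      correlationDeriv c M a a' b b' (-t) 0 := fun t => by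
    simp only [correlationDeriv, zero_mul, Complex.ofReal_zero, mul_zero, Complex.exp_zero, one_mul,
      add_zero, oscillation_neg, map_add, map_sub, map_mul, Complex.conj_ofReal]
  rw [← integral_conj]
  simp_rw [h]
  rw [integral_comp_neg_Ioi 0 fun t => correlationDeriv c M a a' b b' t 0, neg_zero, add_comm]
  exact intervalIntegral.integral_Iic_add_Ioi hi.integrableOn hi.integrableOn

end Tunnelling

/-! ### Invariance of the equilibrium state, and traces of products of kernels. -/

namespace Tunnelling

open Filter Topology Complex

variable {d : ℕ} {𝔄 : Type*} [CStarAlgebra 𝔄]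

theorem continuous_starAlgHom (γ : 𝔄 →⋆ₐ[ℂ] 𝔄) : Continuous γ :=
  AddMonoidHomClass.continuous_of_bound γ 1 fun x => by
    rw [one_mul]; exact NonUnitalStarAlgHom.norm_apply_le γ x

section Gauge

variable (F : FieldAlgebra d 𝔄)

/-- The normal-ordered monomial `a*(f₁) ⋯ a*(fₙ) a(g₁) ⋯ a(gₘ)`. -/
noncomputable def normalMonomial (L L' : List (OneParticle d)) : 𝔄 :=
  (L.map fun f => star (F.a f)).prod * (L'.map F.a).prod

/-- The linear span of the normal-ordered monomials. -/
noncomputable def normalSpan : Submodule ℂ 𝔄 :=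
  Submodule.span ℂ (Set.range fun p : List (OneParticle d) × List (OneParticle d) =>
    normalMonomial F p.1 p.2)

variable {F}

theorem normalMonomial_mem (L L' : List (OneParticle d)) : normalMonomial F L L' ∈ normalSpan F :=
  Submodule.subset_span ⟨(L, L'), rfl⟩

theorem star_mul_mem_normalSpan (f : OneParticle d) {x : 𝔄} (hx : x ∈ normalSpan F) :
    star (F.a f) * x ∈ normalSpan F := by
  induction hx using Submodule.span_induction with
  | mem x hx =>
    obtain ⟨p, rfl⟩ := hx
    have := normalMonomial_mem (F := F) (f :: p.1) p.2
    simpa [normalMonomial, mul_assoc] using this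
  | zero => simp
  | add x y _ _ hx hy => rw [mul_add]; exact add_mem hx hy
  | smul c x _ hx => rw [mul_smul_comm]; exact Submodule.smul_mem _ _ hx

/-- Anticommuting `a(f)` past one creation operator costs a shorter normal-ordered monomial, so
induction on the number of creation operators applies. -/
theorem mul_mem_normalSpan (f : OneParticle d) {x : 𝔄} (hx : x ∈ normalSpan F) :
    F.a f * x ∈ normalSpan F := by
  induction hx using Submodule.span_induction with
  | mem x hx =>
    obtain ⟨⟨L, L'⟩, rfl⟩ := hx
    induction L with
    | nil =>
      have := normalMonomial_mem (F := F) [] (f :: L')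
      simpa [normalMonomial, mul_assoc] using this
    | cons h L ih =>
      have e : F.a f * normalMonomial F (h :: L) L' =
          (inner ℂ f h : ℂ) • normalMonomial F L L' -
            star (F.a h) * (F.a f * normalMonomial F L L') := by
        have := congrArg (· * normalMonomial F L L') (F.anticomm_star f h)
        simp only [add_mul, smul_mul_assoc, one_mul] at this
        rw [← this]
        simp [normalMonomial, mul_assoc]
      simp only at ih ⊢
      rw [e]
      exact sub_mem (Submodule.smul_mem _ _ (normalMonomial_mem _ _))
        (star_mul_mem_normalSpan h ih)
  | zero => simp
  | add x y _ _ hx hy => rw [mul_add]; exact add_mem hx hy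
  | smul c x _ hx => rw [mul_smul_comm]; exact Submodule.smul_mem _ _ hx

/-- The span contains 1 and is stable under left multiplication by `a(f)` and its adjoint, hence
contains the algebra they generate, which is dense. -/
theorem dense_normalSpan : (normalSpan F).topologicalClosure = ⊤ := by
  have h1 : ∀ x ∈ StarAlgebra.adjoin ℂ (Set.range F.a), ∀ y ∈ normalSpan F, x * y ∈ normalSpan F := by
    intro x hx
    rw [← StarSubalgebra.mem_toSubalgebra, StarAlgebra.adjoin_toSubalgebra] at hx
    induction hx using Algebra.adjoin_induction with
    | mem x hx =>
      intro y hy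
      rcases hx with ⟨f, rfl⟩ | ⟨f, hf⟩
      · exact mul_mem_normalSpan f hy
      · rw [show x = star (F.a f) by rw [hf, star_star]]
        exact star_mul_mem_normalSpan f hy
    | algebraMap r =>
      intro y hy
      rw [← Algebra.smul_def]
      exact Submodule.smul_mem _ _ hy
    | add x y _ _ hx hy => intro z hz; rw [add_mul]; exact add_mem (hx z hz) (hy z hz)
    | mul x y _ _ hx hy => intro z hz; rw [mul_assoc]; exact hx _ (hy z hz)
  have h2 : ∀ x ∈ StarAlgebra.adjoin ℂ (Set.range F.a), x ∈ normalSpan F := fun x hx => by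
    have := h1 x hx 1 (by simpa [normalMonomial] using normalMonomial_mem (F := F) [] [])
    rwa [mul_one] at this
  rw [eq_top_iff]
  intro x _
  have hx : x ∈ (StarAlgebra.adjoin ℂ (Set.range F.a)).topologicalClosure := by
    rw [F.generates]; trivial
  exact closure_mono (fun y hy => h2 y hy) hx

/-- Wick's recursion expresses every value through two-point functions, which `U` preserves. -/
theorem IsProductEquilibrium.apply_monomial_eq {β μ : Reservoir → ℝ} {ω : 𝔄 →L[ℂ] ℂ}
    (hω : IsProductEquilibrium F β μ ω) (U : OneParticle d → OneParticle d)
    (hU : ∀ f g, ω (star (F.a (U f)) * F.a (U g)) = ω (star (F.a f) * F.a g)) :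
    ∀ (n : ℕ) (f g : Fin n → OneParticle d),
      ω ((List.ofFn fun i => star (F.a (U (f i)))).prod * (List.ofFn fun j => F.a (U (g j))).prod) =
      ω ((List.ofFn fun i => star (F.a (f i))).prod * (List.ofFn fun j => F.a (g j)).prod) := by
  intro n
  induction n with
  | zero => intro f g; simp
  | succ n ih =>
    intro f g
    rw [hω.wick n (fun i => U (f i)) (fun i => U (g i)), hω.wick n f g]
    refine Finset.sum_congr rfl fun p _ => ?_
    rw [hU, ih (fun i => f i.succ) (fun j => g (p.succAbove j))]

theorem ofFn_map {G H : Type*} (b : G → H) (L : List G) :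
    L.map b = List.ofFn fun i : Fin L.length => b (L.get i) := by
  rw [← List.ofFn_get (List.map b L)]
  apply List.ext_get <;> simp

/-- An equilibrium state is invariant under the automorphisms that preserve its two-point
function. -/
theorem IsProductEquilibrium.apply_eq {β μ : Reservoir → ℝ} {ω : 𝔄 →L[ℂ] ℂ}
    (hω : IsProductEquilibrium F β μ ω) (U : OneParticle d → OneParticle d)
    (hU : ∀ f g, ω (star (F.a (U f)) * F.a (U g)) = ω (star (F.a f) * F.a g))
    (γ : 𝔄 →⋆ₐ[ℂ] 𝔄) (hγ : ∀ f, γ (F.a f) = F.a (U f)) (x : 𝔄) : ω (γ x) = ω x := by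
  have hγc : Continuous γ := continuous_starAlgHom γ
  have hclosed : IsClosed {x | ω (γ x) = ω x} :=
    isClosed_eq (ω.continuous.comp hγc) ω.continuous
  have hx : x ∈ closure (normalSpan F : Set 𝔄) := by
    have : x ∈ (normalSpan F).topologicalClosure := by rw [dense_normalSpan]; trivial
    exact this
  refine closure_minimal (s := (normalSpan F : Set 𝔄)) ?_ hclosed hx
  suffices h : ∀ y ∈ normalSpan F, ω (γ y) = ω y from h
  intro y hy
  induction hy using Submodule.span_induction with
  | mem y hy =>
    obtain ⟨⟨L, L'⟩, rfl⟩ := hy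
    simp only [normalMonomial, map_mul, map_list_prod, List.map_map,
      Function.comp_def, map_star, hγ]
    rw [ofFn_map, ofFn_map, ofFn_map, ofFn_map]
    by_cases hl : L.length = L'.length
    · obtain ⟨n, hn⟩ : ∃ n, n = L.length := ⟨_, rfl⟩
      -- The two lengths are made variables so that their equality can be substituted.
      have key : ∀ (m m' : ℕ) (f : Fin m → OneParticle d) (g : Fin m' → OneParticle d), m = m' →
          ω ((List.ofFn fun i => star (F.a (U (f i)))).prod *
            (List.ofFn fun j => F.a (U (g j))).prod) =
          ω ((List.ofFn fun i => star (F.a (f i))).prod * (List.ofFn fun j => F.a (g j)).prod) := by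
        rintro m _ f g rfl
        exact hω.apply_monomial_eq U hU m f g
      exact key _ _ L.get L'.get hl
    · rw [hω.off_diagonal _ _ (fun i => U (L.get i)) (fun i => U (L'.get i)) hl,
        hω.off_diagonal _ _ L.get L'.get hl]
  | zero => simp
  | add x y _ _ hx hy => rw [map_add, map_add, map_add, hx, hy]
  | smul c x _ hx => rw [map_smul, map_smul, map_smul, hx]

end Gauge

/-- `f'` is obtained from `f` by multiplying its component in each reservoir `r` by the phase
`exp (i θ r |k|)`. -/
def IsPhase (θ : Reservoir → ℝ → ℝ) (f f' : OneParticle d) : Prop :=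
  ∀ r, (f' r : Space d → ℂ) =ᵐ[volume] fun k => Complex.exp (Complex.I * (θ r ‖k‖ : ℂ)) * f r k

theorem isPhase_phase (r : Reservoir) (θ : ℝ → ℝ) (hθ : Continuous θ) (f : OneParticle d) :
    IsPhase (fun r' κ => if r' = r then θ κ else 0) f (phase r θ hθ f) := by
  intro r'
  by_cases h : r' = r
  · simp only [phase, h, if_true]
    exact MemLp.coeFn_toLp _
  · simp only [phase, h, if_false]
    simp

theorem IsPhase.trans {θ θ' : Reservoir → ℝ → ℝ} {f f' f'' : OneParticle d}
    (h : IsPhase θ f f') (h' : IsPhase θ' f' f'') :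
    IsPhase (fun r κ => θ r κ + θ' r κ) f f'' := by
  intro r
  filter_upwards [h r, h' r] with k hk hk'
  rw [hk', hk, ← mul_assoc, ← Complex.exp_add, ← mul_add]
  push_cast
  rw [add_comm (θ' _ _ : ℂ)]

theorem IsPhase.norm_apply_eq {θ : Reservoir → ℝ → ℝ} {f f' : OneParticle d}
    (h : IsPhase θ f f') (r : Reservoir) : ‖f' r‖ = ‖f r‖ := by
  rw [Lp.norm_def, Lp.norm_def]
  congr 1
  refine eLpNorm_congr_norm_ae ?_
  filter_upwards [h r] with k hk
  rw [hk, norm_mul, norm_exp_I_mul, one_mul]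

theorem IsProductEquilibrium.two_point_phase {F : FieldAlgebra d 𝔄} {β μ : Reservoir → ℝ}
    {ω : 𝔄 →L[ℂ] ℂ} (hω : IsProductEquilibrium F β μ ω) {θ : Reservoir → ℝ → ℝ}
    {f f' g g' : OneParticle d} (hf : IsPhase θ f f') (hg : IsPhase θ g g') :
    ω (star (F.a f') * F.a g') = ω (star (F.a f) * F.a g) := by
  rw [hω.two_point, hω.two_point]
  refine Finset.sum_congr rfl fun r _ => integral_congr_ae ?_
  filter_upwards [hf r, hg r] with k hk hk'
  rw [hk, hk', map_mul, ← Complex.exp_conj, map_mul, Complex.conj_I, Complex.conj_ofReal]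
  have : Complex.exp (Complex.I * (θ r ‖k‖ : ℂ)) * Complex.exp (-Complex.I * (θ r ‖k‖ : ℂ)) = 1 := by
    rw [← Complex.exp_add]; simp
  linear_combination (fermi β μ r k : ℂ) * f r k * (starRingEnd ℂ) (g r k) * this

theorem IsProductEquilibrium.apply_phase_eq {F : FieldAlgebra d 𝔄} {β μ : Reservoir → ℝ}
    {ω : 𝔄 →L[ℂ] ℂ} (hω : IsProductEquilibrium F β μ ω) {θ : Reservoir → ℝ → ℝ}
    {U : OneParticle d → OneParticle d} (hU : ∀ f, IsPhase θ f (U f)) (γ : 𝔄 →⋆ₐ[ℂ] 𝔄)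
    (hγ : ∀ f, γ (F.a f) = F.a (U f)) (x : 𝔄) : ω (γ x) = ω x :=
  hω.apply_eq U (fun f g => hω.two_point_phase (hU f) (hU g)) γ hγ x

section Trace

theorem integrable_mul_conj (f g : Lp ℂ 2 (volume : Measure (Space d))) :
    Integrable fun k => f k * (starRingEnd ℂ) (g k) := by
  have h := L2.integrable_inner (𝕜 := ℂ) g f
  refine h.congr (Eventually.of_forall fun k => ?_)
  simp [RCLike.inner_apply]

theorem integral_norm_mul_norm_le (f g : Lp ℂ 2 (volume : Measure (Space d))) :
    ∫ k, ‖f k‖ * ‖g k‖ ≤ ‖f‖ * ‖g‖ := by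
  have e : ∀ h : Lp ℂ 2 (volume : Measure (Space d)), ‖h‖ = (∫ k, ‖h k‖ ^ (2 : ℝ)) ^ (1 / (2 : ℝ)) := by
    intro h
    rw [Lp.norm_def, (Lp.memLp h).eLpNorm_eq_integral_rpow_norm (by norm_num) (by norm_num),
      ENNReal.toReal_ofReal (by positivity)]
    simp
  rw [e f, e g]
  refine integral_mul_norm_le_Lp_mul_Lq Real.HolderConjugate.two_two ?_ ?_
  · simpa using Lp.memLp f
  · simpa using Lp.memLp g

theorem hasSum_prod_mul {ι κ : Type*} {x : ι → ℂ} {y : κ → ℂ} {a b : ℂ} (hx : HasSum x a)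
    (hy : HasSum y b) : HasSum (fun p : ι × κ => x p.1 * y p.2) (a * b) := by
  refine hx.mul hy ?_
  have h : Summable fun p : ι × κ => ‖x p.1‖ * ‖y p.2‖ :=
    hx.summable.norm.mul_of_nonneg hy.summable.norm (fun _ => norm_nonneg _) fun _ => norm_nonneg _
  refine Summable.of_norm (h.congr fun p => ?_)
  rw [norm_mul]

/-- This is tr(c T T') for T = ∑|fₙ⟩⟨gₙ| and T' = ∑|f'ₘ⟩⟨g'ₘ|. Sum and integral may be exchanged
because the integrals of the norms are at most B(‖fₙ‖‖gₙ‖)(‖f'ₘ‖‖g'ₘ‖), by Cauchy–Schwarz in each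
momentum. -/
theorem hasSum_trace {ι κ : Type*} [Countable ι] [Countable κ]
    {f g : ι → Lp ℂ 2 (volume : Measure (Space d))} {f' g' : κ → Lp ℂ 2 (volume : Measure (Space d))}
    (hs : Summable fun n => ‖f n‖ * ‖g n‖) (hs' : Summable fun n => ‖f' n‖ * ‖g' n‖)
    {K K' : Space d × Space d → ℂ}
    (hK : ∀ᵐ z : Space d × Space d, HasSum (fun n => f n z.1 * (starRingEnd ℂ) (g n z.2)) (K z))
    (hK' : ∀ᵐ z : Space d × Space d, HasSum (fun n => f' n z.1 * (starRingEnd ℂ) (g' n z.2)) (K' z))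
    {c : Space d → ℂ} (hc : Continuous c) {B : ℝ} (hB : ∀ k, ‖c k‖ ≤ B) :
    HasSum (fun p : ι × κ => (∫ l, f' p.2 l * (starRingEnd ℂ) (g p.1 l)) *
        (∫ k, c k * f p.1 k * (starRingEnd ℂ) (g' p.2 k)))
      (∫ z : Space d × Space d, c z.1 * (K z * K' z.swap)) := by
  have hB0 : 0 ≤ B := (norm_nonneg _).trans (hB 0)
  have hi : ∀ p : ι × κ, Integrable fun k => c k * f p.1 k * (starRingEnd ℂ) (g' p.2 k) := fun p => by
    simp_rw [mul_assoc]
    exact (integrable_mul_conj _ _).bdd_mul (c := B) hc.aestronglyMeasurable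
      (Eventually.of_forall fun k => hB k)
  have hF : ∀ p : ι × κ, Integrable fun z : Space d × Space d =>
      (c z.1 * f p.1 z.1 * (starRingEnd ℂ) (g' p.2 z.1)) * (f' p.2 z.2 * (starRingEnd ℂ) (g p.1 z.2)) :=
    fun p => (hi p).mul_prod (integrable_mul_conj _ _)
  have hsum : Summable fun p : ι × κ => ∫ z : Space d × Space d,
      ‖(c z.1 * f p.1 z.1 * (starRingEnd ℂ) (g' p.2 z.1)) *
        (f' p.2 z.2 * (starRingEnd ℂ) (g p.1 z.2))‖ := by
    have hs2 : Summable fun p : ι × κ => B * ((‖f p.1‖ * ‖g p.1‖) * (‖f' p.2‖ * ‖g' p.2‖)) :=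
      (hs.mul_of_nonneg hs' (fun _ => by positivity) (fun _ => by positivity)).mul_left B
    refine hs2.of_nonneg_of_le (fun p => integral_nonneg fun z => norm_nonneg _) fun p => ?_
    simp_rw [norm_mul _ (f' p.2 _ * _)]
    rw [Measure.volume_eq_prod, integral_prod_mul
      (fun k => ‖c k * f p.1 k * (starRingEnd ℂ) (g' p.2 k)‖)
      (fun l => ‖f' p.2 l * (starRingEnd ℂ) (g p.1 l)‖)]
    have b1 : ∫ k, ‖c k * f p.1 k * (starRingEnd ℂ) (g' p.2 k)‖ ≤ B * (‖f p.1‖ * ‖g' p.2‖) := by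
      refine le_trans ?_ (mul_le_mul_of_nonneg_left (integral_norm_mul_norm_le _ _) hB0)
      rw [← integral_const_mul]
      refine integral_mono_of_nonneg (Eventually.of_forall fun _ => norm_nonneg _)
        (((integrable_mul_conj (f p.1) (g' p.2)).norm.const_mul B).congr
          (Eventually.of_forall fun k => by simp)) (Eventually.of_forall fun k => ?_)
      simp only
      rw [norm_mul, norm_mul, RCLike.norm_conj, mul_assoc]
      gcongr
      exact hB k
    have b2 : ∫ k, ‖f' p.2 k * (starRingEnd ℂ) (g p.1 k)‖ ≤ ‖f' p.2‖ * ‖g p.1‖ := by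
      refine le_trans (le_of_eq ?_) (integral_norm_mul_norm_le _ _)
      simp
    calc _ ≤ (B * (‖f p.1‖ * ‖g' p.2‖)) * (‖f' p.2‖ * ‖g p.1‖) :=
          mul_le_mul b1 b2 (integral_nonneg fun _ => norm_nonneg _) (by positivity)
      _ = _ := by ring
  have h := hasSum_integral_of_summable_integral_norm hF hsum
  have e1 : ∀ p : ι × κ, (∫ l, f' p.2 l * (starRingEnd ℂ) (g p.1 l)) *
        (∫ k, c k * f p.1 k * (starRingEnd ℂ) (g' p.2 k)) =
      ∫ z : Space d × Space d, (c z.1 * f p.1 z.1 * (starRingEnd ℂ) (g' p.2 z.1)) *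
        (f' p.2 z.2 * (starRingEnd ℂ) (g p.1 z.2)) := fun p => by
    rw [Measure.volume_eq_prod, integral_prod_mul
      (fun k => c k * f p.1 k * (starRingEnd ℂ) (g' p.2 k))
      (fun l => f' p.2 l * (starRingEnd ℂ) (g p.1 l)), mul_comm]
  have e2 : ∫ z : Space d × Space d, c z.1 * (K z * K' z.swap) =
      ∫ z : Space d × Space d, ∑' p : ι × κ,
        (c z.1 * f p.1 z.1 * (starRingEnd ℂ) (g' p.2 z.1)) *
        (f' p.2 z.2 * (starRingEnd ℂ) (g p.1 z.2)) := by
    have hK2 : ∀ᵐ z : Space d × Space d,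
        HasSum (fun n => f' n z.2 * (starRingEnd ℂ) (g' n z.1)) (K' z.swap) := by
      have := (Measure.measurePreserving_swap (μ := (volume : Measure (Space d)))
        (ν := (volume : Measure (Space d)))).quasiMeasurePreserving.ae hK'
      exact this
    refine integral_congr_ae ?_
    filter_upwards [hK, hK2] with z h1 h2
    have h3 := (hasSum_prod_mul h1 h2).mul_left (c z.1)
    rw [← h3.tsum_eq]
    congr 1
    ext p
    ring
  simp_rw [e1]
  rw [e2]
  exact h

end Trace

end Tunnelling

/-! ### One-body commutators, the Hermitian kernel and the trace formula. -/

namespace Tunnelling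

open Filter Topology Complex

variable {d : ℕ} {𝔄 : Type*} [CStarAlgebra 𝔄] {F : FieldAlgebra d 𝔄}

theorem inner_oneParticle (f g : OneParticle d) :
    (inner ℂ f g : ℂ) = ∑ r, ∫ l, g r l * (starRingEnd ℂ) (f r l) := by
  rw [PiLp.inner_apply]
  refine Finset.sum_congr rfl fun r _ => ?_
  rw [L2.inner_def]
  refine integral_congr_ae (Eventually.of_forall fun k => ?_)
  simp [RCLike.inner_apply]

/-- The one-particle vector with amplitude `u` in reservoir `r` and zero in the other one. -/
noncomputable def inReservoir (r : Reservoir) (u : Lp ℂ 2 (volume : Measure (Space d))) :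
    OneParticle d :=
  WithLp.toLp 2 (Pi.single r u)

theorem inner_inReservoir_left (r : Reservoir) (u : Lp ℂ 2 (volume : Measure (Space d)))
    (f : OneParticle d) :
    (inner ℂ (inReservoir r u) f : ℂ) = ∫ l, f r l * (starRingEnd ℂ) (u l) := by
  have h : (inner ℂ (inReservoir r u) f : ℂ) = inner ℂ u (f r) := by
    rw [PiLp.inner_apply, Finset.sum_eq_single r]
    · simp [inReservoir]
    · intro r' _ h
      simp [inReservoir, h]
    · simp
  rw [h, L2.inner_def]
  refine integral_congr_ae (Eventually.of_forall fun k => ?_)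
  simp [RCLike.inner_apply]

theorem inner_inReservoir_right (r : Reservoir) (u : Lp ℂ 2 (volume : Measure (Space d)))
    (f : OneParticle d) :
    (inner ℂ f (inReservoir r u) : ℂ) = ∫ l, u l * (starRingEnd ℂ) (f r l) := by
  rw [← inner_conj_symm, inner_inReservoir_left, ← integral_conj]
  refine integral_congr_ae (Eventually.of_forall fun k => ?_)
  simp [mul_comm]

theorem commutator_star (f g h : OneParticle d) :
    star (F.a f) * F.a g * star (F.a h) - star (F.a h) * (star (F.a f) * F.a g) =
      (inner ℂ g h : ℂ) • star (F.a f) := by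
  have h1 := F.anticomm_star g h
  have h2 : star (F.a h) * star (F.a f) = -(star (F.a f) * star (F.a h)) := by
    have := congrArg star (F.anticomm f h)
    simp only [star_add, star_mul, star_zero] at this
    exact eq_neg_of_add_eq_zero_left this
  rw [← mul_assoc, h2, mul_assoc, eq_sub_of_add_eq h1, mul_sub, mul_smul_comm, mul_one]
  simp only [neg_mul, mul_assoc]
  abel

/-- Commutation is a derivation, so the product splits into `commutator_star` and its adjoint; no
quartic term is left. -/
theorem commutator_oneBody (f g f' g' : OneParticle d) :
    ⁅star (F.a f) * F.a g, star (F.a f') * F.a g'⁆ =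
      (inner ℂ g f' : ℂ) • (star (F.a f) * F.a g') - (inner ℂ g' f : ℂ) • (star (F.a f') * F.a g) := by
  have h1 := commutator_star (F := F) f g f'
  have h2 := congrArg star (commutator_star (F := F) g f g')
  simp only [star_sub, star_mul, star_star, star_smul, RCLike.star_def, inner_conj_symm] at h2
  rw [Ring.lie_def]
  have e : star (F.a f) * F.a g * (star (F.a f') * F.a g') -
      star (F.a f') * F.a g' * (star (F.a f) * F.a g) =
      (star (F.a f) * F.a g * star (F.a f') - star (F.a f') * (star (F.a f) * F.a g)) * F.a g' -
      star (F.a f') * (F.a g' * (star (F.a f) * F.a g) - star (F.a f) * F.a g * F.a g') := by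
    noncomm_ring
  rw [e, h1, h2, smul_mul_assoc, mul_smul_comm]

/-- The anticommutator of `a(h')` with [X, a*(h)] is the scalar ⟨h', T h⟩, where T is the
one-particle operator of X. The matrix elements of T are thus determined by X and not by the chosen
expansion. -/
theorem hasSum_inner_mul_inner {ω : 𝔄 →L[ℂ] ℂ} (hω1 : ω 1 = 1) {f g : ℕ → OneParticle d} {X : 𝔄}
    (hX : HasSum (fun n => star (F.a (f n)) * F.a (g n)) X) (h h' : OneParticle d) :
    HasSum (fun n => (inner ℂ (g n) h : ℂ) * inner ℂ h' (f n))
      (ω (F.a h' * (X * star (F.a h) - star (F.a h) * X) +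
        (X * star (F.a h) - star (F.a h) * X) * F.a h')) := by
  have h1 := (hX.mul_right (star (F.a h))).sub (hX.mul_left (star (F.a h)))
  have h2 := ((h1.mul_left (F.a h')).add (h1.mul_right (F.a h'))).mapL ω
  have e : ∀ n, (inner ℂ (g n) h : ℂ) * inner ℂ h' (f n) =
      ω (F.a h' * (star (F.a (f n)) * F.a (g n) * star (F.a h) -
          star (F.a h) * (star (F.a (f n)) * F.a (g n))) +
        (star (F.a (f n)) * F.a (g n) * star (F.a h) -
          star (F.a h) * (star (F.a (f n)) * F.a (g n))) * F.a h') := fun n => by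
    rw [commutator_star, mul_smul_comm, smul_mul_assoc, ← smul_add, F.anticomm_star, smul_smul,
      map_smul, hω1, smul_eq_mul, mul_one]
  simp_rw [e]
  exact h2

/-- Near a point where D ≠ 0, the real part of conj(D z)·D stays above half its value at z, so its
integral over a small ball is positive. -/
theorem eq_zero_of_integral_ball_eq_zero {D : Space d × Space d → ℂ} (hD : Continuous D)
    (h : ∀ z ε, 0 < ε → ∫ x in Metric.ball z ε, D x = 0) (z : Space d × Space d) : D z = 0 := by
  by_contra hz
  set φ : Space d × Space d → ℝ := fun x => ((starRingEnd ℂ) (D z) * D x).re with hφ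
  have hφc : Continuous φ := by fun_prop
  have hφz : 0 < φ z := by
    simp only [hφ]
    rw [mul_comm, Complex.mul_conj, Complex.ofReal_re]
    exact Complex.normSq_pos.2 hz
  obtain ⟨ε, hε, hb⟩ := Metric.eventually_nhds_iff_ball.1
    (hφc.continuousAt.eventually (lt_mem_nhds (half_lt_self hφz)))
  have hDi : IntegrableOn D (Metric.ball z ε) :=
    (hD.continuousOn.integrableOn_compact (isCompact_closedBall z ε)).mono_set
      Metric.ball_subset_closedBall
  have h0 : ∫ x in Metric.ball z ε, φ x = 0 := by
    have : ∫ x in Metric.ball z ε, φ x = (∫ x in Metric.ball z ε, (starRingEnd ℂ) (D z) * D x).re :=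
      integral_re (hDi.const_mul _)
    rw [this, integral_const_mul, h z ε hε, mul_zero, Complex.zero_re]
  have h1 : ∫ _ in Metric.ball z ε, φ z / 2 ≤ ∫ x in Metric.ball z ε, φ x :=
    setIntegral_mono_on (integrableOn_const (measure_ball_lt_top.ne)) (hDi.const_mul _).re
      Metric.isOpen_ball.measurableSet fun x hx => (hb x hx).le
  rw [h0, setIntegral_const, smul_eq_mul] at h1
  have h2 : 0 < volume.real (Metric.ball z ε) :=
    ENNReal.toReal_pos (Metric.measure_ball_pos _ _ hε).ne' measure_ball_lt_top.ne
  nlinarith [mul_pos h2 hφz]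

theorem integrable_kernel_mul {K : Space d × Space d → ℂ} (hK : Continuous K)
    (z : Space d × Space d) (ε : ℝ) : IntegrableOn K (Metric.ball z ε) :=
  (hK.continuousOn.integrableOn_compact (isCompact_closedBall z ε)).mono_set
    Metric.ball_subset_closedBall

/-- The expansion of a self-adjoint one-body interaction has a Hermitian kernel. -/
theorem kernel_conj_symm {ω : 𝔄 →L[ℂ] ℂ} (hω1 : ω 1 = 1) {f g : ℕ → OneParticle d} {X : 𝔄}
    (hs : Summable fun n => ‖f n‖ * ‖g n‖)
    (hX : HasSum (fun n => star (F.a (f n)) * F.a (g n)) X) (hsa : IsSelfAdjoint X)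
    {K : Reservoir → Reservoir → Space d × Space d → ℂ} (hKc : ∀ r r', Continuous (K r r'))
    (hK : ∀ r r', ∀ᵐ z : Space d × Space d,
      HasSum (fun n => f n r z.1 * (starRingEnd ℂ) (g n r' z.2)) (K r r' z))
    (r r' : Reservoir) (z : Space d × Space d) : K r' r z.swap = (starRingEnd ℂ) (K r r' z) := by
  have hs' : ∀ r r', Summable fun n => ‖f n r‖ * ‖g n r'‖ := fun r r' =>
    hs.of_nonneg_of_le (fun n => by positivity) fun n =>
      mul_le_mul (PiLp.norm_apply_le _ _) (PiLp.norm_apply_le _ _) (norm_nonneg _) (norm_nonneg _)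
  have hX' : HasSum (fun n => star (F.a (g n)) * F.a (f n)) X := by
    have := hX.star
    rw [hsa.star_eq] at this
    simpa using this
  have tr : ∀ (r r' : Reservoir) (u v : Lp ℂ 2 (volume : Measure (Space d))),
      HasSum (fun n => (∫ l, u l * (starRingEnd ℂ) (g n r' l)) *
        (∫ k, f n r k * (starRingEnd ℂ) (v k)))
        (∫ z : Space d × Space d, K r r' z * (u z.2 * (starRingEnd ℂ) (v z.1))) := by
    intro r r' u v
    -- Taking the rank-one operator |u⟩⟨v| as second factor turns the trace into the matrix element
    -- ⟨v, T u⟩.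
    have h := hasSum_trace (κ := Unit) (f' := fun _ => u) (g' := fun _ => v)
      (K' := fun z => u z.1 * (starRingEnd ℂ) (v z.2)) (hs' r r') (Summable.of_finite) (hK r r')
      (Eventually.of_forall fun z => hasSum_unique _) (c := fun _ => 1) continuous_const (B := 1)
      (fun _ => by simp)
    rw [← (Equiv.prodPUnit ℕ).symm.hasSum_iff] at h
    simpa [Function.comp_def] using h
  have key : ∀ u v : Lp ℂ 2 (volume : Measure (Space d)),
      ∫ z : Space d × Space d, K r r' z * (u z.2 * (starRingEnd ℂ) (v z.1)) =
      ∫ z : Space d × Space d, (starRingEnd ℂ) (K r' r z.swap) * (u z.2 * (starRingEnd ℂ) (v z.1)) := by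
    intro u v
    -- The expansion of X and its adjoint, with f and g exchanged, represent the same element, so
    -- they have the same matrix elements.
    have h1 := hasSum_inner_mul_inner hω1 hX (inReservoir r' u) (inReservoir r v)
    have h2 := hasSum_inner_mul_inner hω1 hX' (inReservoir r' u) (inReservoir r v)
    simp only [inner_inReservoir_left, inner_inReservoir_right] at h1 h2
    have e1 := (tr r r' u v).unique h1
    have h3 := Complex.hasSum_conj'.2 (tr r' r v u)
    have e3 : ∀ n, (starRingEnd ℂ) ((∫ l, v l * (starRingEnd ℂ) (g n r l)) *
        (∫ k, f n r' k * (starRingEnd ℂ) (u k))) =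
        (∫ l, u l * (starRingEnd ℂ) (f n r' l)) * (∫ k, g n r k * (starRingEnd ℂ) (v k)) :=
      fun n => by
        rw [map_mul, ← integral_conj, ← integral_conj, mul_comm]
        simp only [map_mul, Complex.conj_conj, mul_comm]
    simp_rw [e3] at h3
    rw [e1, ← h3.unique h2, ← integral_conj, Measure.volume_eq_prod, ← integral_prod_swap]
    congr 1
    ext z
    simp only [map_mul, Complex.conj_conj, Prod.fst_swap, Prod.snd_swap]
    ring
  have hD : Continuous fun z : Space d × Space d =>
      K r r' z - (starRingEnd ℂ) (K r' r z.swap) :=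
    (hKc r r').sub (Complex.continuous_conj.comp ((hKc r' r).comp continuous_swap))
  have hz := eq_zero_of_integral_ball_eq_zero hD (fun z ε _ => ?_) z
  · rw [← Complex.conj_conj (K r' r z.swap), ← sub_eq_zero.1 hz]
  have hA : ∀ x : Space d, volume (Metric.ball x ε) ≠ ⊤ := fun x => measure_ball_lt_top.ne
  -- A ball of the product is the product of two balls in the sup metric, so indicators of balls
  -- test the kernels on every ball.
  let u : Lp ℂ 2 (volume : Measure (Space d)) :=
    indicatorConstLp 2 (Metric.isOpen_ball (x := z.2) (ε := ε)).measurableSet (hA _) 1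
  let v : Lp ℂ 2 (volume : Measure (Space d)) :=
    indicatorConstLp 2 (Metric.isOpen_ball (x := z.1) (ε := ε)).measurableSet (hA _) 1
  have hu : (u : Space d → ℂ) =ᵐ[volume] (Metric.ball z.2 ε).indicator fun _ => 1 :=
    indicatorConstLp_coeFn
  have hv : (v : Space d → ℂ) =ᵐ[volume] (Metric.ball z.1 ε).indicator fun _ => 1 :=
    indicatorConstLp_coeFn
  have huv : ∀ᵐ x : Space d × Space d, u x.2 * (starRingEnd ℂ) (v x.1) =
      (Metric.ball z ε).indicator (fun _ => 1) x := by
    have h1 := (Measure.quasiMeasurePreserving_fst (μ := (volume : Measure (Space d)))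
      (ν := (volume : Measure (Space d)))).ae hv
    have h2 := (Measure.quasiMeasurePreserving_snd (μ := (volume : Measure (Space d)))
      (ν := (volume : Measure (Space d)))).ae hu
    filter_upwards [h1, h2] with x h1 h2
    rw [h1, h2, ← ball_prod_same]
    by_cases a1 : x.1 ∈ Metric.ball z.1 ε <;> by_cases a2 : x.2 ∈ Metric.ball z.2 ε <;>
      simp [Set.indicator, a1, a2]
  have hint : ∀ D : Space d × Space d → ℂ,
      ∫ x : Space d × Space d, D x * (u x.2 * (starRingEnd ℂ) (v x.1)) =
      ∫ x in Metric.ball z ε, D x := fun D => by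
    rw [← integral_indicator Metric.isOpen_ball.measurableSet]
    refine integral_congr_ae ?_
    filter_upwards [huv] with x hx
    rw [hx]
    by_cases a : x ∈ Metric.ball z ε <;> simp [Set.indicator, a]
  have hk := key u v
  rw [hint, hint fun x => (starRingEnd ℂ) (K r' r x.swap)] at hk
  rw [integral_sub (integrable_kernel_mul (hKc r r') z ε) (integrable_kernel_mul
    (K := fun x => (starRingEnd ℂ) (K r' r x.swap))
    (Complex.continuous_conj.comp ((hKc r' r).comp continuous_swap)) z ε), hk, sub_self]

/-- The *-homomorphism `γ` multiplies the creation operators `a*(k,r)` by `exp (i θ r |k|)`. -/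
def HasPhase (F : FieldAlgebra d 𝔄) (γ : 𝔄 →⋆ₐ[ℂ] 𝔄) (θ : Reservoir → ℝ → ℝ) : Prop :=
  ∃ U : OneParticle d → OneParticle d, (∀ f, IsPhase θ f (U f)) ∧ ∀ f, γ (F.a f) = F.a (U f)

theorem HasPhase.comp {γ γ' : 𝔄 →⋆ₐ[ℂ] 𝔄} {θ θ' : Reservoir → ℝ → ℝ} (h : HasPhase F γ θ)
    (h' : HasPhase F γ' θ') : HasPhase F (γ.comp γ') fun r κ => θ' r κ + θ r κ := by
  obtain ⟨U, hU, hγ⟩ := h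
  obtain ⟨U', hU', hγ'⟩ := h'
  exact ⟨fun f => U (U' f), fun f => (hU' f).trans (hU (U' f)), fun f => by
    rw [StarAlgHom.comp_apply, hγ', hγ]⟩

theorem HasPhase.apply_eq {γ : 𝔄 →⋆ₐ[ℂ] 𝔄} {θ : Reservoir → ℝ → ℝ} (h : HasPhase F γ θ)
    {β μ : Reservoir → ℝ} {ω : 𝔄 →L[ℂ] ℂ} (hω : IsProductEquilibrium F β μ ω) (x : 𝔄) :
    ω (γ x) = ω x := by
  obtain ⟨U, hU, hγ⟩ := h
  exact hω.apply_phase_eq hU γ hγ x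

theorem continuous_fermi (β μ : Reservoir → ℝ) (r : Reservoir) :
    Continuous (fermi (d := d) β μ r) := by
  unfold fermi reducedEnergy
  refine Continuous.div (by fun_prop) (by fun_prop) fun k => by positivity

theorem fermi_nonneg (β μ : Reservoir → ℝ) (r : Reservoir) (k : Space d) : 0 ≤ fermi β μ r k := by
  unfold fermi; positivity

theorem fermi_le_one (β μ : Reservoir → ℝ) (r : Reservoir) (k : Space d) : fermi β μ r k ≤ 1 := by
  unfold fermi
  rw [div_le_one (by positivity)]
  linarith [Real.exp_pos (reducedEnergy β μ r k)]

/-- The sum over all reservoirs of `∫∫ ρ_r(k) |K_{rr'}(k,l)|² e^{i(θ_r(k) - θ_{r'}(l))}`. -/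
noncomputable def phaseTrace (β μ : Reservoir → ℝ)
    (K : Reservoir → Reservoir → Space d × Space d → ℂ) (θ : Reservoir → ℝ → ℝ) : ℂ :=
  ∑ r', ∑ r, ∫ z : Space d × Space d,
    Complex.exp (Complex.I * ((θ r ‖z.1‖ - θ r' ‖z.2‖ : ℝ) : ℂ)) *
      ((fermi β μ r z.1 * ‖K r r' z‖ ^ 2 : ℝ) : ℂ)

theorem phaseTrace_neg (β μ : Reservoir → ℝ) (K : Reservoir → Reservoir → Space d × Space d → ℂ)
    (θ : Reservoir → ℝ → ℝ) :
    phaseTrace β μ K (fun r κ => -θ r κ) = (starRingEnd ℂ) (phaseTrace β μ K θ) := by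
  simp only [phaseTrace, map_sum]
  refine Finset.sum_congr rfl fun r' _ => Finset.sum_congr rfl fun r _ => ?_
  rw [← integral_conj]
  congr 1
  ext z
  rw [map_mul, Complex.conj_ofReal, ← Complex.exp_conj, map_mul, Complex.conj_I, Complex.conj_ofReal]
  congr 2
  push_cast
  ring

theorem hasSum_phase_kernel {f g f' g' : ℕ → OneParticle d} {θ : Reservoir → ℝ → ℝ}
    {r r' : Reservoir} {K : Space d × Space d → ℂ}
    (hK : ∀ᵐ z : Space d × Space d,
      HasSum (fun n => f n r z.1 * (starRingEnd ℂ) (g n r' z.2)) (K z))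
    (hf : ∀ n, IsPhase θ (f n) (f' n)) (hg : ∀ n, IsPhase θ (g n) (g' n)) :
    ∀ᵐ z : Space d × Space d, HasSum (fun n => f' n r z.1 * (starRingEnd ℂ) (g' n r' z.2))
      (Complex.exp (Complex.I * ((θ r ‖z.1‖ - θ r' ‖z.2‖ : ℝ) : ℂ)) * K z) := by
  have h1 : ∀ᵐ z : Space d × Space d, ∀ n,
      f' n r z.1 = Complex.exp (Complex.I * (θ r ‖z.1‖ : ℂ)) * f n r z.1 :=
    (Measure.quasiMeasurePreserving_fst (μ := (volume : Measure (Space d)))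
      (ν := (volume : Measure (Space d)))).ae (ae_all_iff.2 fun n => hf n r)
  have h2 : ∀ᵐ z : Space d × Space d, ∀ n,
      g' n r' z.2 = Complex.exp (Complex.I * (θ r' ‖z.2‖ : ℂ)) * g n r' z.2 :=
    (Measure.quasiMeasurePreserving_snd (μ := (volume : Measure (Space d)))
      (ν := (volume : Measure (Space d)))).ae (ae_all_iff.2 fun n => hg n r')
  filter_upwards [hK, h1, h2] with z h h1 h2
  have e : ∀ n, f' n r z.1 * (starRingEnd ℂ) (g' n r' z.2) =
      Complex.exp (Complex.I * ((θ r ‖z.1‖ - θ r' ‖z.2‖ : ℝ) : ℂ)) *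
        (f n r z.1 * (starRingEnd ℂ) (g n r' z.2)) := fun n => by
    rw [h1, h2, map_mul, ← Complex.exp_conj, map_mul, Complex.conj_I, Complex.conj_ofReal,
      Complex.ofReal_sub, mul_sub, sub_eq_add_neg, Complex.exp_add, neg_mul]
    ring
  simp_rw [e]
  exact h.mul_left _

/-- A one-body operator with a Hermitian kernel, after two gauge-invariant evolutions. -/
theorem hasSum_phaseTrace {f g f₁ g₁ f₂ g₂ : ℕ → OneParticle d} {θ η : Reservoir → ℝ → ℝ}
    {K : Reservoir → Reservoir → Space d × Space d → ℂ} (hs : Summable fun n => ‖f n‖ * ‖g n‖)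
    (hK : ∀ r r', ∀ᵐ z : Space d × Space d,
      HasSum (fun n => f n r z.1 * (starRingEnd ℂ) (g n r' z.2)) (K r r' z))
    (hKs : ∀ r r' z, K r' r z.swap = (starRingEnd ℂ) (K r r' z))
    (hf₁ : ∀ n, IsPhase θ (f n) (f₁ n)) (hg₁ : ∀ n, IsPhase θ (g n) (g₁ n))
    (hf₂ : ∀ n, IsPhase η (f n) (f₂ n)) (hg₂ : ∀ n, IsPhase η (g n) (g₂ n))
    {β μ : Reservoir → ℝ} {ω : 𝔄 →L[ℂ] ℂ} (hω : IsProductEquilibrium F β μ ω) :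
    HasSum (fun p : ℕ × ℕ => (inner ℂ (g₁ p.1) (f₂ p.2) : ℂ) *
        ω (star (F.a (f₁ p.1)) * F.a (g₂ p.2)))
      (phaseTrace β μ K fun r κ => θ r κ - η r κ) := by
  have hs' : ∀ {θ : Reservoir → ℝ → ℝ} {f' g' : ℕ → OneParticle d}
      (_ : ∀ n, IsPhase θ (f n) (f' n)) (_ : ∀ n, IsPhase θ (g n) (g' n)) (r r' : Reservoir),
      Summable fun n => ‖f' n r‖ * ‖g' n r'‖ := by
    intro θ f' g' hf hg r r'
    refine hs.of_nonneg_of_le (fun n => by positivity) fun n => ?_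
    rw [(hf n).norm_apply_eq, (hg n).norm_apply_eq]
    exact mul_le_mul (PiLp.norm_apply_le _ _) (PiLp.norm_apply_le _ _) (norm_nonneg _)
      (norm_nonneg _)
  simp_rw [inner_oneParticle, hω.two_point, Finset.sum_mul_sum, phaseTrace]
  refine hasSum_sum fun r' _ => hasSum_sum fun r _ => ?_
  have h := hasSum_trace (hs' hf₁ hg₁ r r') (hs' hf₂ hg₂ r' r)
    (hasSum_phase_kernel (hK r r') hf₁ hg₁) (hasSum_phase_kernel (hK r' r) hf₂ hg₂)
    (c := fun k => (fermi β μ r k : ℂ)) (Complex.continuous_ofReal.comp (continuous_fermi β μ r))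
    (B := 1) (fun k => by
      rw [Complex.norm_real, Real.norm_of_nonneg (fermi_nonneg β μ r k)]
      exact fermi_le_one β μ r k)
  have e : ∫ z : Space d × Space d, Complex.exp (Complex.I *
        ((θ r ‖z.1‖ - η r ‖z.1‖ - (θ r' ‖z.2‖ - η r' ‖z.2‖) : ℝ) : ℂ)) *
      ((fermi β μ r z.1 * ‖K r r' z‖ ^ 2 : ℝ) : ℂ) =
      ∫ z : Space d × Space d, (fermi β μ r z.1 : ℂ) *
        (Complex.exp (Complex.I * ((θ r ‖z.1‖ - θ r' ‖z.2‖ : ℝ) : ℂ)) * K r r' z *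
        (Complex.exp (Complex.I * ((η r' ‖z.swap.1‖ - η r ‖z.swap.2‖ : ℝ) : ℂ)) *
          K r' r z.swap)) := by
    congr 1
    ext z
    have h2 := Complex.mul_conj' (K r r' z)
    rw [hKs, show Complex.I * ((θ r ‖z.1‖ - η r ‖z.1‖ - (θ r' ‖z.2‖ - η r' ‖z.2‖) : ℝ) : ℂ) =
      Complex.I * ((θ r ‖z.1‖ - θ r' ‖z.2‖ : ℝ) : ℂ) +
      Complex.I * ((η r' ‖z.swap.1‖ - η r ‖z.swap.2‖ : ℝ) : ℂ) by
        simp only [Prod.fst_swap, Prod.snd_swap]; push_cast; ring, Complex.exp_add,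
      Complex.ofReal_mul, Complex.ofReal_pow, ← h2]
    ring
  rw [e]
  exact h

theorem HasPhase.hasSum {γ : 𝔄 →⋆ₐ[ℂ] 𝔄} {θ : Reservoir → ℝ → ℝ} (h : HasPhase F γ θ)
    {f g : ℕ → OneParticle d} {X : 𝔄} (hX : HasSum (fun n => star (F.a (f n)) * F.a (g n)) X) :
    ∃ f' g' : ℕ → OneParticle d, (∀ n, IsPhase θ (f n) (f' n)) ∧ (∀ n, IsPhase θ (g n) (g' n)) ∧
      HasSum (fun n => star (F.a (f' n)) * F.a (g' n)) (γ X) := by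
  obtain ⟨U, hU, hγ⟩ := h
  refine ⟨fun n => U (f n), fun n => U (g n), fun n => hU _, fun n => hU _, ?_⟩
  have := hX.map γ (continuous_starAlgHom γ)
  simpa only [Function.comp_def, map_mul, map_star, hγ] using this

/-- The two terms of the one-body commutator have opposite relative phases θ - η and η - θ, and
`phaseTrace_neg` identifies the second trace with the conjugate of the first. -/
theorem apply_commutator {f g : ℕ → OneParticle d} {θ η : Reservoir → ℝ → ℝ}
    {K : Reservoir → Reservoir → Space d × Space d → ℂ} (hs : Summable fun n => ‖f n‖ * ‖g n‖)
    (hK : ∀ r r', ∀ᵐ z : Space d × Space d,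
      HasSum (fun n => f n r z.1 * (starRingEnd ℂ) (g n r' z.2)) (K r r' z))
    (hKs : ∀ r r' z, K r' r z.swap = (starRingEnd ℂ) (K r r' z))
    {β μ : Reservoir → ℝ} {ω : 𝔄 →L[ℂ] ℂ} (hω : IsProductEquilibrium F β μ ω) {X : 𝔄}
    (hX : HasSum (fun n => star (F.a (f n)) * F.a (g n)) X) {γ γ' : 𝔄 →⋆ₐ[ℂ] 𝔄}
    (hγ : HasPhase F γ θ) (hγ' : HasPhase F γ' η) :
    ω ⁅γ X, γ' X⁆ = phaseTrace β μ K (fun r κ => θ r κ - η r κ) -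
      (starRingEnd ℂ) (phaseTrace β μ K fun r κ => θ r κ - η r κ) := by
  obtain ⟨f₁, g₁, hf₁, hg₁, h₁⟩ := hγ.hasSum hX
  obtain ⟨f₂, g₂, hf₂, hg₂, h₂⟩ := hγ'.hasSum hX
  have t₁ := hasSum_phaseTrace hs hK hKs hf₁ hg₁ hf₂ hg₂ hω
  have t₂ := hasSum_phaseTrace hs hK hKs hf₂ hg₂ hf₁ hg₁ hω
  -- The second term of the commutator carries the two summation indices in the opposite order.
  rw [← (Equiv.prodComm ℕ ℕ).hasSum_iff] at t₂
  rw [show (fun r κ => η r κ - θ r κ) = fun r κ => -(θ r κ - η r κ) by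
    ext r κ; ring, phaseTrace_neg] at t₂
  have t := t₁.sub t₂
  -- The double series converges unconditionally, so it may be summed over the expansion of γ' X
  -- first and then over that of γ X; each of these sums is continuous in the algebra.
  refine (t.prod_fiberwise (g := fun n => ω ⁅star (F.a (f₁ n)) * F.a (g₁ n), γ' X⁆)
    fun n => ?_).unique ?_ |> Eq.symm
  · have := (((h₂.mul_left (star (F.a (f₁ n)) * F.a (g₁ n))).sub
      (h₂.mul_right (star (F.a (f₁ n)) * F.a (g₁ n)))).mapL ω)
    simp_rw [← Ring.lie_def, commutator_oneBody, map_sub, map_smul, smul_eq_mul] at this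
    exact this
  · have := (((h₁.mul_right (γ' X)).sub (h₁.mul_left (γ' X))).mapL ω)
    simp_rw [← Ring.lie_def] at this
    exact this

end Tunnelling

/-! ### Fermi weights and symmetry of the energy shell. -/

namespace Tunnelling

open Filter Topology Complex

variable {d : ℕ}

theorem isWeight_of_gaussian_bound {c : Space d → ℝ} (hc : Continuous c) {C b : ℝ} (hb : 0 < b)
    (h : ∀ k, |c k| ≤ C * Real.exp (-b * ‖k‖ ^ 2)) : IsWeight c where
  continuous := hc
  integrable := by
    have hi : Integrable fun k : Space d => Real.exp (-b * ‖k‖ ^ 2) := by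
      refine (integrable_gaussian (d := d) (b := (b : ℂ)) (by simpa using hb)).norm.congr
        (Eventually.of_forall fun v => ?_)
      simp only
      rw [← Complex.ofReal_neg, ← Complex.ofReal_pow, ← Complex.ofReal_mul, Complex.norm_exp,
        Complex.ofReal_re]
    exact (hi.const_mul C).mono' hc.aestronglyMeasurable (Eventually.of_forall h)
  bounded := by
    have hC : 0 ≤ C := by
      have := (abs_nonneg _).trans (h 0)
      simpa using this
    refine ⟨C, fun k => (h k).trans (mul_le_of_le_one_right hC ?_)⟩
    rw [Real.exp_le_one_iff]
    nlinarith [sq_nonneg ‖k‖]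

theorem fermi_le_exp {β μ : Reservoir → ℝ} (r : Reservoir) (k : Space d) :
    fermi β μ r k ≤ Real.exp (β r * μ r) * Real.exp (-β r * ‖k‖ ^ 2) := by
  rw [fermi, ← Real.exp_add, show β r * μ r + -β r * ‖k‖ ^ 2 = -reducedEnergy β μ r k by
    rw [reducedEnergy]; ring, Real.exp_neg, one_div]
  gcongr
  linarith

theorem isWeight_fermi {β μ : Reservoir → ℝ} (hβ : ∀ r, 0 < β r) (r : Reservoir) :
    IsWeight (fermi (d := d) β μ r) :=
  isWeight_of_gaussian_bound (continuous_fermi β μ r) (hβ r) fun k => by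
    rw [abs_of_nonneg (fermi_nonneg β μ r k)]
    exact fermi_le_exp r k

theorem isWeight_norm_sq_mul_fermi {β μ : Reservoir → ℝ} (hβ : ∀ r, 0 < β r) (r : Reservoir) :
    IsWeight fun k : Space d => ‖k‖ ^ 2 * fermi β μ r k := by
  refine isWeight_of_gaussian_bound (C := 2 / β r * Real.exp (β r * μ r)) (b := β r / 2)
    ((continuous_norm.pow 2).mul (continuous_fermi β μ r)) (half_pos (hβ r)) fun k => ?_
  have h0 := hβ r
  rw [abs_of_nonneg (mul_nonneg (sq_nonneg _) (fermi_nonneg β μ r k))]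
  -- The inequality y ≤ e^y with y = β|k|²/2 spends half of the Gaussian decay on the factor |k|².
  have h1 : ‖k‖ ^ 2 ≤ 2 / β r * Real.exp (β r / 2 * ‖k‖ ^ 2) := by
    have := Real.add_one_le_exp (β r / 2 * ‖k‖ ^ 2)
    calc ‖k‖ ^ 2 = 2 / β r * (β r / 2 * ‖k‖ ^ 2) := by field_simp
      _ ≤ _ := by gcongr; linarith
  calc ‖k‖ ^ 2 * fermi β μ r k ≤ (2 / β r * Real.exp (β r / 2 * ‖k‖ ^ 2)) *
        (Real.exp (β r * μ r) * Real.exp (-β r * ‖k‖ ^ 2)) :=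
        mul_le_mul h1 (fermi_le_exp r k) (fermi_nonneg _ _ _ _) (by positivity)
    _ = 2 / β r * Real.exp (β r * μ r) * (Real.exp (β r / 2 * ‖k‖ ^ 2) *
        Real.exp (-β r * ‖k‖ ^ 2)) := by ring
    _ = _ := by
        rw [← Real.exp_add]
        congr 2
        ring

/-- Exchanging the two momenta on the energy shell. -/
theorem integral_mul_shellIntegral_swap [NeZero d] {φ : ℝ → ℝ} {N : Space d × Space d → ℝ}
    (hN : Continuous N)
    (h1 : Integrable fun k => φ ‖k‖ * shellIntegral k fun l => N (k, l))
    (h2 : Integrable fun k => φ ‖k‖ * shellIntegral k fun l => N (l, k)) :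
    ∫ k, φ ‖k‖ * shellIntegral k (fun l => N (k, l)) =
      ∫ k, φ ‖k‖ * shellIntegral k fun l => N (l, k) := by
  rw [integral_polar h1, integral_polar h2]
  refine setIntegral_congr_fun measurableSet_Ioi fun r hr => ?_
  have hn : ∀ σ : Metric.sphere (0 : Space d) 1, ‖r • (σ : Space d)‖ = r := fun σ => by
    rw [norm_smul, Real.norm_of_nonneg (le_of_lt hr)]; simp
  simp only [shellIntegral, hn]
  congr 1
  rw [integral_const_mul, integral_const_mul, integral_const_mul, integral_const_mul]
  congr 2
  -- Both momenta lie on the sphere of radius r, so exchanging them is Fubini on a product of two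
  -- compact spheres.
  refine integral_integral_swap ?_
  have hc : Continuous (Function.uncurry fun σ τ : Metric.sphere (0 : Space d) 1 =>
      N (r • (σ : Space d), r • (τ : Space d))) := by
    simp only [Function.uncurry_def]
    fun_prop
  rw [← integrableOn_univ]
  exact hc.continuousOn.integrableOn_compact isCompact_univ

theorem continuous_shellIntegral {N : Space d × Space d → ℝ} (hN : Continuous N) :
    Continuous fun k : Space d => shellIntegral k fun l => N (k, l) := by
  have := continuous_parametric_integral_of_continuous
    (μ := (volume : Measure (Space d)).toSphere)
    (f := fun (k : Space d) (σ : Metric.sphere (0 : Space d) 1) => N (k, ‖k‖ • (σ : Space d)))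
    (by simp only [Function.uncurry_def]; fun_prop) isCompact_univ
  simp only [Measure.restrict_univ] at this
  exact ((continuous_norm.pow _).div_const 2).mul this

theorem shellIntegral_nonneg {k : Space d} {h : Space d → ℝ} (hh : ∀ l, 0 ≤ h l) :
    0 ≤ shellIntegral k h :=
  mul_nonneg (by positivity) (integral_nonneg fun σ => hh _)

/-! ### Positivity of the thermal factor. -/

section Thermal

variable {β μ : Reservoir → ℝ}

theorem thermalFactor_eq (β μ : Reservoir → ℝ) (k : Space d) :
    thermalFactor β μ k = (fermi β μ Reservoir.II k - fermi β μ Reservoir.I k) *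
      (reducedEnergy β μ Reservoir.I k - reducedEnergy β μ Reservoir.II k) := by
  rw [thermalFactor, fermi, fermi]
  have h1 : Real.exp (reducedEnergy β μ Reservoir.I k) + 1 ≠ 0 := by positivity
  have h2 : Real.exp (reducedEnergy β μ Reservoir.II k) + 1 ≠ 0 := by positivity
  field_simp
  ring

theorem mul_exp_sub_nonneg (x y : ℝ) : 0 ≤ (x - y) * (Real.exp x - Real.exp y) := by
  rcases le_total x y with h | h
  · exact mul_nonneg_of_nonpos_of_nonpos (by linarith) (by linarith [Real.exp_le_exp.2 h])
  · exact mul_nonneg (by linarith) (by linarith [Real.exp_le_exp.2 h])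

theorem thermalFactor_nonneg (β μ : Reservoir → ℝ) (k : Space d) : 0 ≤ thermalFactor β μ k :=
  div_nonneg (mul_exp_sub_nonneg _ _) (by positivity)

theorem reducedEnergy_eq_of_thermalFactor_eq_zero {k : Space d} (h : thermalFactor β μ k = 0) :
    reducedEnergy β μ Reservoir.I k = reducedEnergy β μ Reservoir.II k := by
  rw [thermalFactor, div_eq_zero_iff, or_iff_left (by positivity), mul_eq_zero] at h
  rcases h with h | h
  · exact sub_eq_zero.1 h
  · exact Real.exp_injective (sub_eq_zero.1 h)

theorem thermalFactor_eq_zero (h : (β Reservoir.I, μ Reservoir.I) = (β Reservoir.II, μ Reservoir.II))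
    (k : Space d) : thermalFactor β μ k = 0 := by
  rw [Prod.mk.injEq] at h
  simp [thermalFactor, reducedEnergy, h.1, h.2]

/-- The factor vanishes only where x^I = x^II. For β^I ≠ β^II this confines k to one sphere; for
equal β and different μ it never happens. -/
theorem ae_thermalFactor_ne_zero [Nontrivial (Space d)] (hβ : ∀ r, 0 < β r)
    (h : (β Reservoir.I, μ Reservoir.I) ≠ (β Reservoir.II, μ Reservoir.II)) :
    ∀ᵐ k : Space d, thermalFactor β μ k ≠ 0 := by
  -- If the quotient is negative or its denominator is zero, ρ takes the default value 0; this is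
  -- harmless, since a sphere of radius 0 is also null.
  set ρ : ℝ := √((β Reservoir.I * μ Reservoir.I - β Reservoir.II * μ Reservoir.II) /
    (β Reservoir.I - β Reservoir.II)) with hρ
  have hnull := measure_eq_zero_iff_ae_notMem.1
    (Measure.addHaar_sphere (volume : Measure (Space d)) 0 ρ)
  filter_upwards [hnull] with k hk h0
  have he := reducedEnergy_eq_of_thermalFactor_eq_zero h0
  rw [reducedEnergy, reducedEnergy] at he
  by_cases hb : β Reservoir.I = β Reservoir.II
  · refine h (Prod.ext hb ?_)
    have := hβ Reservoir.II
    rw [hb] at he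
    have := mul_left_cancel₀ this.ne' he
    simp only
    linarith
  · refine hk ?_
    have hb' : β Reservoir.I - β Reservoir.II ≠ 0 := sub_ne_zero.2 hb
    rw [mem_sphere_zero_iff_norm, hρ, show (β Reservoir.I * μ Reservoir.I -
      β Reservoir.II * μ Reservoir.II) / (β Reservoir.I - β Reservoir.II) = ‖k‖ ^ 2 by
        rw [div_eq_iff hb']; linarith, Real.sqrt_sq (norm_nonneg _)]

/-- By continuity S is nonzero on a nonempty open set, which has positive measure, and the thermal
factor is nonzero almost everywhere on it. -/
theorem integral_shell_mul_thermalFactor_pos [Nontrivial (Space d)] (hβ : ∀ r, 0 < β r)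
    (h : (β Reservoir.I, μ Reservoir.I) ≠ (β Reservoir.II, μ Reservoir.II)) {S : Space d → ℝ}
    (hS : Continuous S) (hS0 : ∀ k, 0 ≤ S k) (hSi : Integrable fun k => S k * thermalFactor β μ k)
    (hne : ∃ k, S k ≠ 0) : 0 < ∫ k, S k * thermalFactor β μ k := by
  rw [integral_pos_iff_support_of_nonneg
    (fun k => mul_nonneg (hS0 k) (thermalFactor_nonneg β μ k)) hSi]
  have hpos : 0 < volume {k | S k ≠ 0} :=
    (isOpen_ne_fun hS continuous_const).measure_pos _ hne
  refine hpos.trans_le (measure_mono_ae ?_)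
  filter_upwards [ae_thermalFactor_ne_zero hβ h] with k hk hSk
  exact mul_ne_zero hSk hk

end Thermal

/-! ### Perturbation terms of the stationary state and the on-shell currents. -/

section Stationary

variable {𝔄 : Type*} [CStarAlgebra 𝔄]

theorem stationaryTerm_two_two (ω : 𝔄 →L[ℂ] ℂ) (τ : ℝ → 𝔄 →⋆ₐ[ℂ] 𝔄) (W b : ℕ → 𝔄) :
    stationaryTerm ω τ W b 2 2 = Complex.I * ∫ t in Set.Ioi (0 : ℝ), ω ⁅τ (-t) (W 1), b 1⁆ := by
  -- Since every index is at least 1, order ξ² with two interactions leaves only W₁ in both places.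
  have hf : (Finset.Nat.antidiagonalTuple 2 2).filter (fun N => ∀ i, 1 ≤ N i) = {![1, 1]} := by
    decide
  rw [stationaryTerm, hf, Finset.sum_singleton, pow_one]
  congr 1
  have hset : {t : Fin 1 → ℝ | (∀ i, 0 < t i) ∧ StrictMono t} =
      (MeasurableEquiv.funUnique (Fin 1) ℝ) ⁻¹' Set.Ioi 0 := by
    ext t
    simp [Fin.forall_fin_one, Subsingleton.strictMono]
  rw [hset, ← (volume_preserving_funUnique (Fin 1) ℝ).setIntegral_preimage_emb
    (MeasurableEquiv.measurableEmbedding _)]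
  rfl

variable {F : FieldAlgebra d 𝔄} {β μ : Reservoir → ℝ} {ω : 𝔄 →L[ℂ] ℂ}

/-- At first order in g there is no time integral, so invariance of ω removes γ. -/
theorem stationaryTerm_one_eq (hω : IsProductEquilibrium F β μ ω) (τ : ℝ → 𝔄 →⋆ₐ[ℂ] 𝔄) (W : ℕ → 𝔄)
    {γ : 𝔄 →⋆ₐ[ℂ] 𝔄} {θ : Reservoir → ℝ → ℝ} (hγ : HasPhase F γ θ) (l : ℕ) :
    stationaryTerm ω τ W (fun N => γ (W N)) 1 l = stationaryTerm ω τ W W 1 l := by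
  simp only [stationaryTerm, nestedCommutator, hγ.apply_eq hω]

theorem hasPhase_freeEvolution {α : Reservoir → ℝ → 𝔄 →⋆ₐ[ℂ] 𝔄} (hα : IsFreeEvolution F α) (t : ℝ) :
    HasPhase F (freeEvolution α t) fun _ κ => t * κ ^ 2 := by
  have h : ∀ r, HasPhase F (α r t) fun r' κ => if r' = r then t * κ ^ 2 else 0 := fun r =>
    ⟨_, fun f => isPhase_phase r _ (by fun_prop) f, hα r t⟩
  have hc := (h Reservoir.I).comp (h Reservoir.II)
  have e : (fun (_ : Reservoir) (κ : ℝ) => t * κ ^ 2) = fun r' κ =>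
      (if r' = Reservoir.II then t * κ ^ 2 else 0) + if r' = Reservoir.I then t * κ ^ 2 else 0 := by
    ext r κ
    cases r <;> simp
  rw [e]
  exact hc

/-- `γ` multiplies the creation operators `a*(k,r)` by `exp (i s (a_r |k|² + b_r))`. -/
def IsQuadraticFlow (F : FieldAlgebra d 𝔄) (γ : ℝ → 𝔄 →⋆ₐ[ℂ] 𝔄) (a b : Reservoir → ℝ) : Prop :=
  ∀ s, HasPhase F (γ s) fun r κ => s * (a r * κ ^ 2 + b r)

theorem IsFreeEvolution.isQuadraticFlow {α : Reservoir → ℝ → 𝔄 →⋆ₐ[ℂ] 𝔄}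
    (hα : IsFreeEvolution F α) (r : Reservoir) :
    IsQuadraticFlow F (α r) (fun r' => if r' = r then 1 else 0) fun _ => 0 := fun s => by
  have e : (fun (r' : Reservoir) (κ : ℝ) => s * ((if r' = r then (1 : ℝ) else 0) * κ ^ 2 + 0)) =
      fun r' κ => if r' = r then s * κ ^ 2 else 0 := by
    ext r' κ
    split_ifs <;> simp
  rw [e]
  exact ⟨_, fun f => isPhase_phase r _ (by fun_prop) f, hα r s⟩

theorem IsGauge.isQuadraticFlow {φ : Reservoir → ℝ → 𝔄 →⋆ₐ[ℂ] 𝔄}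
    (hφ : IsGauge F φ) (r : Reservoir) :
    IsQuadraticFlow F (φ r) (fun _ => 0) fun r' => if r' = r then 1 else 0 := fun s => by
  have e : (fun (r' : Reservoir) (κ : ℝ) => s * (0 * κ ^ 2 + (if r' = r then (1 : ℝ) else 0))) =
      fun r' _ => if r' = r then s else 0 := by
    ext r' κ
    split_ifs <;> simp
  rw [e]
  exact ⟨_, fun f => isPhase_phase r _ (by fun_prop) f, hφ r s⟩

theorem currentTerm_one (hω : IsProductEquilibrium F β μ ω) (τ : ℝ → 𝔄 →⋆ₐ[ℂ] 𝔄) (W : ℕ → 𝔄)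
    {γ : ℝ → 𝔄 →⋆ₐ[ℂ] 𝔄} {a b : Reservoir → ℝ} (hγ : IsQuadraticFlow F γ a b) (l : ℕ) :
    currentTerm ω τ W γ 1 l = 0 := by
  rw [currentTerm, funext fun s => stationaryTerm_one_eq hω τ W (hγ s) l, deriv_const, neg_zero]

theorem phaseTrace_eq_sum_correlation (β μ : Reservoir → ℝ)
    (K : Reservoir → Reservoir → Space d × Space d → ℂ) (a b : Reservoir → ℝ) (t s : ℝ) :
    phaseTrace β μ K (fun r κ => -t * κ ^ 2 - s * (a r * κ ^ 2 + b r)) =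
      ∑ r', ∑ r, correlation (fermi β μ r) (fun z => ‖K r r' z‖ ^ 2) (a r) (a r') (b r) (b r') t s := by
  refine Finset.sum_congr rfl fun r' _ => Finset.sum_congr rfl fun r _ => ?_
  rw [correlation, oscillation, ← integral_const_mul]
  congr 1
  ext z
  rw [← mul_assoc, ← Complex.exp_add]
  congr 2
  push_cast
  ring

/-- The matrix elements `ŵ₁((-k,r),(l,r'))`. -/
noncomputable def momentumKernel (w : Kernel d) (r r' : Reservoir) (z : Space d × Space d) : ℂ :=
  kernelFourier w r r' (-z.1) z.2

theorem continuous_momentumKernel {w : Kernel d} (hw : IsRegularKernel w) (r r' : Reservoir) :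
    Continuous (momentumKernel w r r') := by
  have h := (continuous_doubleFourier (memLp_one_iff_integrable.1 (hw r r').1)).comp
    (by fun_prop : Continuous fun z : Space d × Space d => (-z.1, z.2))
  exact h

section Current

variable {α : Reservoir → ℝ → 𝔄 →⋆ₐ[ℂ] 𝔄} {w : Kernel d} {W : ℕ → 𝔄}
  {γ : ℝ → 𝔄 →⋆ₐ[ℂ] 𝔄} {a b : Reservoir → ℝ}

theorem momentumKernel_conj_symm (hω : IsProductEquilibrium F β μ ω) (hw : IsRegularKernel w)
    (hW : IsOneBodyInteraction F w (W 1)) (hsa : IsSelfAdjoint (W 1)) (r r' : Reservoir)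
    (z : Space d × Space d) :
    momentumKernel w r' r z.swap = (starRingEnd ℂ) (momentumKernel w r r' z) := by
  obtain ⟨f, g, hs, hK, hX⟩ := hW
  exact kernel_conj_symm hω.map_one hs hX hsa (continuous_momentumKernel hw) hK r r' z

theorem apply_commutator_eq (hα : IsFreeEvolution F α) (hω : IsProductEquilibrium F β μ ω)
    (hw : IsRegularKernel w) (hW : IsOneBodyInteraction F w (W 1)) (hsa : IsSelfAdjoint (W 1))
    (hγ : IsQuadraticFlow F γ a b) (t s : ℝ) :
    ω ⁅freeEvolution α (-t) (W 1), γ s (W 1)⁆ =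
      (∑ r', ∑ r, correlation (fermi β μ r) (fun z => ‖momentumKernel w r r' z‖ ^ 2)
        (a r) (a r') (b r) (b r') t s) -
      (starRingEnd ℂ) (∑ r', ∑ r, correlation (fermi β μ r)
        (fun z => ‖momentumKernel w r r' z‖ ^ 2) (a r) (a r') (b r) (b r') t s) := by
  have hs := momentumKernel_conj_symm hω hw hW hsa
  obtain ⟨f, g, hsum, hK, hX⟩ := hW
  rw [apply_commutator (K := momentumKernel w) hsum hK hs hω hX (hasPhase_freeEvolution hα (-t)) (hγ s),
    ← phaseTrace_eq_sum_correlation]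

theorem isDispersive_normSq_momentumKernel (hw : IsRegularKernel w) (r r' : Reservoir) :
    IsDispersive fun z => ‖momentumKernel w r r' z‖ ^ 2 :=
  isDispersive_kernel hw r r'

theorem isDispersive_norm_sq_mul_normSq_momentumKernel (hw : IsRegularKernel w) (r r' : Reservoir) :
    IsDispersive fun z => ‖z.2‖ ^ 2 * ‖momentumKernel w r r' z‖ ^ 2 :=
  isDispersive_norm_sq_mul_kernel hw r r'

theorem integrable_sum_correlation (hd : 3 ≤ d) (hβ : ∀ r, 0 < β r) (hw : IsRegularKernel w)
    (a b : Reservoir → ℝ) (s : ℝ) :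
    Integrable fun t => ∑ r', ∑ r, correlation (fermi β μ r)
      (fun z => ‖momentumKernel w r r' z‖ ^ 2) (a r) (a r') (b r) (b r') t s :=
  integrable_finsetSum _ fun r' _ => integrable_finsetSum _ fun r _ =>
    integrable_correlation hd (isWeight_fermi hβ r) (isDispersive_normSq_momentumKernel hw r r')
      _ _ _ _ s

theorem integrable_apply_commutator (hd : 3 ≤ d) (hβ : ∀ r, 0 < β r) (hα : IsFreeEvolution F α)
    (hω : IsProductEquilibrium F β μ ω)
    (hw : IsRegularKernel w) (hW : IsOneBodyInteraction F w (W 1)) (hsa : IsSelfAdjoint (W 1))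
    (hγ : IsQuadraticFlow F γ a b) (s : ℝ) :
    Integrable fun t => ω ⁅freeEvolution α (-t) (W 1), γ s (W 1)⁆ := by
  simp_rw [apply_commutator_eq hα hω hw hW hsa hγ]
  have h := integrable_sum_correlation (μ := μ) hd hβ hw a b s
  exact h.sub (h.congr' (Complex.continuous_conj.comp_aestronglyMeasurable h.1)
    (Eventually.of_forall fun t => (RCLike.norm_conj _).symm))

/-- Hermiticity relates the (I, II) kernel to the (II, I) kernel with exchanged momenta, and the
exchange is harmless on the shell because the prefactor depends only on |k|. -/
theorem integral_fermi_mul_swap (hd : 3 ≤ d) (hβ : ∀ r, 0 < β r) (hω : IsProductEquilibrium F β μ ω)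
    (hw : IsRegularKernel w) (hW : IsOneBodyInteraction F w (W 1)) (hsa : IsSelfAdjoint (W 1))
    (x y : ℝ) :
    ∫ k : Space d, fermi β μ Reservoir.I k * ((x * ‖k‖ ^ 2 + y) * shellIntegral k fun l =>
        ‖momentumKernel w Reservoir.I Reservoir.II (k, l)‖ ^ 2) =
      ∫ k : Space d, fermi β μ Reservoir.I k * ((x * ‖k‖ ^ 2 + y) * onShellWeight w k) := by
  have : NeZero d := ⟨by omega⟩
  have hI : ∀ r r', Integrable fun k : Space d => (fermi β μ Reservoir.I k * (x * ‖k‖ ^ 2 + y)) *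
      shellIntegral k fun l => ‖momentumKernel w r r' (k, l)‖ ^ 2 := fun r r' => by
    have hM := isDispersive_normSq_momentumKernel hw r r'
    have h1 := integrable_mul_shellIntegral hd (isWeight_fermi (μ := μ) hβ Reservoir.I) hM
    have h2 := integrable_mul_shellIntegral hd
      (isWeight_norm_sq_mul_fermi (μ := μ) hβ Reservoir.I) hM
    refine ((h2.const_mul x).add (h1.const_mul y)).congr (Eventually.of_forall fun k => ?_)
    simp only [Pi.add_apply]
    ring
  have hs : ∀ z : Space d × Space d, ‖momentumKernel w Reservoir.II Reservoir.I z.swap‖ =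
      ‖momentumKernel w Reservoir.I Reservoir.II z‖ := fun z => by
    rw [momentumKernel_conj_symm hω hw hW hsa, RCLike.norm_conj]
  have e : ∀ k : Space d, fermi β μ Reservoir.I k * (x * ‖k‖ ^ 2 + y) =
      (fun κ => 1 / (Real.exp (β Reservoir.I * (κ ^ 2 - μ Reservoir.I)) + 1) * (x * κ ^ 2 + y)) ‖k‖ :=
    fun k => rfl
  have h1 := hI Reservoir.I Reservoir.II
  have h2 := hI Reservoir.II Reservoir.I
  simp_rw [← mul_assoc]
  have hsw : ∀ k l : Space d, ‖momentumKernel w Reservoir.II Reservoir.I (k, l)‖ ^ 2 =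
      ‖momentumKernel w Reservoir.I Reservoir.II (l, k)‖ ^ 2 := fun k l => by
    rw [← hs (l, k)]; rfl
  have hos : ∀ k : Space d, onShellWeight w k = shellIntegral k fun l =>
      ‖momentumKernel w Reservoir.I Reservoir.II (l, k)‖ ^ 2 := fun k => by
    simp only [← hsw]; rfl
  simp_rw [hsw] at h2
  simp_rw [hos]
  simp_rw [e] at h1 h2 ⊢
  exact integral_mul_shellIntegral_swap
    (φ := fun κ => 1 / (Real.exp (β Reservoir.I * (κ ^ 2 - μ Reservoir.I)) + 1) * (x * κ ^ 2 + y))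
    (N := fun z => ‖momentumKernel w Reservoir.I Reservoir.II z‖ ^ 2)
    ((continuous_momentumKernel hw _ _).norm.pow 2) h1 h2

/-- The term of order `g²ξ²` of the current of the charge with one-particle energies
`a_r |k|² + b_r`. -/
noncomputable def onShellCurrent (β μ : Reservoir → ℝ) (w : Kernel d) (a b : Reservoir → ℝ) : ℝ :=
  2 * Real.pi * ∫ k : Space d, (fermi β μ Reservoir.II k - fermi β μ Reservoir.I k) *
    (((a Reservoir.I - a Reservoir.II) * ‖k‖ ^ 2 + (b Reservoir.I - b Reservoir.II)) *
      onShellWeight w k)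

theorem integrable_fermi_mul_onShellWeight (hd : 3 ≤ d) (hβ : ∀ r, 0 < β r) (hw : IsRegularKernel w)
    (r : Reservoir) (x y : ℝ) :
    Integrable fun k : Space d => fermi β μ r k * ((x * ‖k‖ ^ 2 + y) * onShellWeight w k) := by
  have hM := isDispersive_normSq_momentumKernel hw Reservoir.II Reservoir.I
  have h1 := integrable_mul_shellIntegral hd (isWeight_fermi (μ := μ) hβ r) hM
  have h2 := integrable_mul_shellIntegral hd (isWeight_norm_sq_mul_fermi (μ := μ) hβ r) hM
  refine ((h2.const_mul x).add (h1.const_mul y)).congr (Eventually.of_forall fun k => ?_)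
  simp only [Pi.add_apply, onShellWeight, momentumKernel]
  ring

theorem sum_reservoir {G : Type*} [AddCommMonoid G] (f : Reservoir → G) :
    ∑ r, f r = f Reservoir.I + f Reservoir.II := by
  have : (Finset.univ : Finset Reservoir) = {Reservoir.I, Reservoir.II} := rfl
  rw [this, Finset.sum_pair (by decide)]

/-- Terms with r = r' transfer no charge on the shell. The two cross terms carry opposite charges,
and after the exchange of momenta they share one weight, leaving the difference ρ_II - ρ_I. -/
theorem sum_integral_correlationDeriv (hd : 3 ≤ d) (hβ : ∀ r, 0 < β r)
    (hω : IsProductEquilibrium F β μ ω) (hw : IsRegularKernel w)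
    (hW : IsOneBodyInteraction F w (W 1)) (hsa : IsSelfAdjoint (W 1)) (a b : Reservoir → ℝ) :
    ∑ r', ∑ r, ∫ t, correlationDeriv (fermi β μ r) (fun z => ‖momentumKernel w r r' z‖ ^ 2)
      (a r) (a r') (b r) (b r') t 0 = (onShellCurrent β μ w a b : ℂ) := by
  simp_rw [fun r r' => integral_correlationDeriv hd (isWeight_fermi (μ := μ) hβ r)
    (isWeight_norm_sq_mul_fermi hβ r) (isDispersive_normSq_momentumKernel hw r r')
    (isDispersive_norm_sq_mul_normSq_momentumKernel hw r r')]
  simp only [sum_reservoir, sub_self, zero_mul, add_zero, mul_zero, integral_zero,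
    Complex.ofReal_zero, zero_add]
  rw [integral_fermi_mul_swap hd hβ hω hw hW hsa]
  have h1 := integrable_fermi_mul_onShellWeight (μ := μ) hd hβ hw Reservoir.I
    (a Reservoir.II - a Reservoir.I) (b Reservoir.II - b Reservoir.I)
  have h2 := integrable_fermi_mul_onShellWeight (μ := μ) hd hβ hw Reservoir.II
    (a Reservoir.I - a Reservoir.II) (b Reservoir.I - b Reservoir.II)
  have e : ∫ k : Space d, (fermi β μ Reservoir.II k - fermi β μ Reservoir.I k) *
      (((a Reservoir.I - a Reservoir.II) * ‖k‖ ^ 2 + (b Reservoir.I - b Reservoir.II)) *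
      onShellWeight w k) =
      (∫ k : Space d, fermi β μ Reservoir.II k *
        (((a Reservoir.I - a Reservoir.II) * ‖k‖ ^ 2 + (b Reservoir.I - b Reservoir.II)) *
        onShellWeight w k)) +
      ∫ k : Space d, fermi β μ Reservoir.I k *
        (((a Reservoir.II - a Reservoir.I) * ‖k‖ ^ 2 + (b Reservoir.II - b Reservoir.I)) *
        onShellWeight w k) := by
    rw [← integral_add h2 h1]
    congr 1
    ext k
    ring
  rw [onShellCurrent, e]
  push_cast
  simp only [onShellWeight, momentumKernel]
  ring

/-- The second-order term is i(C - C̄), with C the half-line integral of the summed correlations. As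
C' = iD, its derivative is i(iD + iD̄) = -(D + D̄), which is minus the integral over the whole time
axis. -/
theorem hasDerivAt_stationaryTerm (hd : 3 ≤ d) (hβ : ∀ r, 0 < β r) (hα : IsFreeEvolution F α)
    (hω : IsProductEquilibrium F β μ ω) (hw : IsRegularKernel w)
    (hW : IsOneBodyInteraction F w (W 1)) (hsa : IsSelfAdjoint (W 1))
    (hγ : IsQuadraticFlow F γ a b) :
    HasDerivAt (fun s : ℝ => stationaryTerm ω (freeEvolution α) W (fun N => γ s (W N)) 2 2)
      (-(onShellCurrent β μ w a b : ℂ)) 0 := by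
  have hM := isDispersive_normSq_momentumKernel hw
  have hM1 := isDispersive_norm_sq_mul_normSq_momentumKernel hw
  have hc := isWeight_fermi (d := d) (μ := μ) hβ
  have hc1 := isWeight_norm_sq_mul_fermi (d := d) (μ := μ) hβ
  have hint : ∀ s, ∫ t in Set.Ioi (0 : ℝ), ω ⁅freeEvolution α (-t) (W 1), γ s (W 1)⁆ =
      (∑ r', ∑ r, ∫ t in Set.Ioi (0 : ℝ), correlation (fermi β μ r)
        (fun z => ‖momentumKernel w r r' z‖ ^ 2) (a r) (a r') (b r) (b r') t s) -
      star (∑ r', ∑ r, ∫ t in Set.Ioi (0 : ℝ), correlation (fermi β μ r)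
        (fun z => ‖momentumKernel w r r' z‖ ^ 2) (a r) (a r') (b r) (b r') t s) := fun s => by
    have h := (integrable_sum_correlation (μ := μ) hd hβ hw a b s).integrableOn (s := Set.Ioi 0)
    have e : ∫ t in Set.Ioi (0 : ℝ), ∑ r', ∑ r, correlation (fermi β μ r)
        (fun z => ‖momentumKernel w r r' z‖ ^ 2) (a r) (a r') (b r) (b r') t s =
        ∑ r', ∑ r, ∫ t in Set.Ioi (0 : ℝ), correlation (fermi β μ r)
        (fun z => ‖momentumKernel w r r' z‖ ^ 2) (a r) (a r') (b r) (b r') t s := by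
      rw [integral_finsetSum _ fun r' _ => integrable_finsetSum _ fun r _ =>
        (integrable_correlation hd (hc r) (hM r r') _ _ _ _ s).integrableOn]
      refine Finset.sum_congr rfl fun r' _ => ?_
      rw [integral_finsetSum _ fun r _ =>
        (integrable_correlation hd (hc r) (hM r r') _ _ _ _ s).integrableOn]
    simp_rw [apply_commutator_eq hα hω hw hW hsa hγ]
    rw [integral_sub h (h.congr' (Complex.continuous_conj.comp_aestronglyMeasurable h.1)
      (Eventually.of_forall fun t => (RCLike.norm_conj _).symm)), integral_conj, e]
    rfl
  simp_rw [stationaryTerm_two_two, hint]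
  have hd' : HasDerivAt (fun s => ∑ r', ∑ r, ∫ t in Set.Ioi (0 : ℝ), correlation (fermi β μ r)
        (fun z => ‖momentumKernel w r r' z‖ ^ 2) (a r) (a r') (b r) (b r') t s)
      (∑ r', ∑ r, ∫ t in Set.Ioi (0 : ℝ), Complex.I * correlationDeriv (fermi β μ r)
        (fun z => ‖momentumKernel w r r' z‖ ^ 2) (a r) (a r') (b r) (b r') t 0) 0 :=
    HasDerivAt.fun_sum fun r' _ => HasDerivAt.fun_sum fun r _ =>
      hasDerivAt_integral_correlation hd (hc r) (hc1 r) (hM r r') (hM1 r r') _ _ _ _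
  refine ((hd'.fun_sub hd'.star).const_mul Complex.I).congr_deriv ?_
  have hsum := sum_integral_correlationDeriv hd hβ hω hw hW hsa a b
  simp_rw [← fun r r' => integral_Ioi_correlationDeriv_add_conj hd (hc r) (hc1 r) (hM r r')
    (hM1 r r') (a r) (a r') (b r) (b r'), Finset.sum_add_distrib, ← map_sum] at hsum
  rw [← hsum]
  simp_rw [integral_const_mul, ← Finset.mul_sum]
  rw [star_mul', RCLike.star_def, Complex.conj_I]
  linear_combination ((∑ r', ∑ r, ∫ t in Set.Ioi (0 : ℝ), correlationDeriv (fermi β μ r)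
        (fun z => ‖momentumKernel w r r' z‖ ^ 2) (a r) (a r') (b r) (b r') t 0) +
      (starRingEnd ℂ) (∑ r', ∑ r, ∫ t in Set.Ioi (0 : ℝ), correlationDeriv (fermi β μ r)
        (fun z => ‖momentumKernel w r r' z‖ ^ 2) (a r) (a r') (b r) (b r') t 0)) * Complex.I_sq

theorem currentTerm_two_two (hd : 3 ≤ d) (hβ : ∀ r, 0 < β r) (hα : IsFreeEvolution F α)
    (hω : IsProductEquilibrium F β μ ω) (hw : IsRegularKernel w)
    (hW : IsOneBodyInteraction F w (W 1)) (hsa : IsSelfAdjoint (W 1))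
    (hγ : IsQuadraticFlow F γ a b) :
    currentTerm ω (freeEvolution α) W γ 2 2 = (onShellCurrent β μ w a b : ℂ) := by
  rw [currentTerm, (hasDerivAt_stationaryTerm hd hβ hα hω hw hW hsa hγ).deriv, neg_neg]

end Current

end Stationary

end Tunnelling

/-! ### Entropy production. -/

namespace Tunnelling

open Filter Topology Complex

variable {d : ℕ}

section EntropyProduction

variable {𝔄 : Type*} [CStarAlgebra 𝔄] {F : FieldAlgebra d 𝔄} {β μ : Reservoir → ℝ}
  {ω : 𝔄 →L[ℂ] ℂ} {α φ : Reservoir → ℝ → 𝔄 →⋆ₐ[ℂ] 𝔄} {w : Kernel d} {W : ℕ → 𝔄}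

theorem entropyProduction_one (hα : IsFreeEvolution F α) (hφ : IsGauge F φ)
    (hω : IsProductEquilibrium F β μ ω) (W : ℕ → 𝔄) (l : ℕ) :
    entropyProduction β μ ω α φ W 1 l = 0 :=
  Finset.sum_eq_zero fun r _ => by
    rw [energyCurrent, particleCurrent, currentTerm_one hω _ W (hα.isQuadraticFlow r),
      currentTerm_one hω _ W (hφ.isQuadraticFlow r)]
    ring

/-- The current depends only on differences between the reservoirs. This gives the conservation
laws: at this order the gains of the two reservoirs are opposite. -/
theorem onShellCurrent_swap (β μ : Reservoir → ℝ) (w : Kernel d) {a b a' b' : Reservoir → ℝ}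
    (ha : a' Reservoir.I - a' Reservoir.II = -(a Reservoir.I - a Reservoir.II))
    (hb : b' Reservoir.I - b' Reservoir.II = -(b Reservoir.I - b Reservoir.II)) :
    onShellCurrent β μ w a' b' = -onShellCurrent β μ w a b := by
  rw [onShellCurrent, onShellCurrent, ← mul_neg, ← integral_neg, ha, hb]
  congr 2
  ext k
  ring

theorem shellIntegral_mul_thermalFactor (β μ : Reservoir → ℝ) (w : Kernel d) (k : Space d) :
    (shellIntegral k fun l =>
      ‖kernelFourier w Reservoir.II Reservoir.I (-k) l‖ ^ 2 * thermalFactor β μ k) =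
      onShellWeight w k * thermalFactor β μ k := by
  simp_rw [mul_comm _ (thermalFactor β μ k)]
  exact shellIntegral_mul_left (fun _ => thermalFactor β μ k) _

/-- Since x^I - x^II is affine in |k|², the thermal factor is the integrand of a combination of the
energy and the particle current. -/
theorem onShellWeight_mul_thermalFactor (β μ : Reservoir → ℝ) (w : Kernel d) (k : Space d) :
    onShellWeight w k * thermalFactor β μ k =
      (fermi β μ Reservoir.II k - fermi β μ Reservoir.I k) *
        (((β Reservoir.I - β Reservoir.II) * ‖k‖ ^ 2 +
          -(β Reservoir.I * μ Reservoir.I - β Reservoir.II * μ Reservoir.II)) *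
          onShellWeight w k) := by
  rw [thermalFactor_eq]
  simp only [reducedEnergy]
  ring

theorem integrable_fermi_sub_mul_onShellWeight (hd : 3 ≤ d) (hβ : ∀ r, 0 < β r)
    (hw : IsRegularKernel w) (x y : ℝ) :
    Integrable fun k : Space d => (fermi β μ Reservoir.II k - fermi β μ Reservoir.I k) *
      ((x * ‖k‖ ^ 2 + y) * onShellWeight w k) := by
  simp_rw [sub_mul]
  exact (integrable_fermi_mul_onShellWeight hd hβ hw _ x y).sub
    (integrable_fermi_mul_onShellWeight hd hβ hw _ x y)

theorem integrable_onShellWeight_mul_thermalFactor (hd : 3 ≤ d) (hβ : ∀ r, 0 < β r)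
    (hw : IsRegularKernel w) :
    Integrable fun k : Space d => onShellWeight w k * thermalFactor β μ k := by
  simp_rw [onShellWeight_mul_thermalFactor]
  exact integrable_fermi_sub_mul_onShellWeight hd hβ hw _ _

theorem continuous_onShellWeight (hw : IsRegularKernel w) : Continuous (onShellWeight w) :=
  continuous_shellIntegral ((continuous_momentumKernel hw Reservoir.II Reservoir.I).norm.pow 2)

theorem onShellWeight_nonneg (w : Kernel d) (k : Space d) : 0 ≤ onShellWeight w k :=
  shellIntegral_nonneg fun _ => sq_nonneg _

theorem entropyProduction_two_two_eq_currents (hd : 3 ≤ d) (hβ : ∀ r, 0 < β r)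
    (hα : IsFreeEvolution F α) (hφ : IsGauge F φ) (hω : IsProductEquilibrium F β μ ω)
    (hw : IsRegularKernel w) (hW : IsOneBodyInteraction F w (W 1)) (hsa : IsSelfAdjoint (W 1)) :
    entropyProduction β μ ω α φ W 2 2 =
      ((β Reservoir.I - β Reservoir.II : ℝ) : ℂ) * energyCurrent ω α W Reservoir.I 2 2 -
        ((β Reservoir.I * μ Reservoir.I - β Reservoir.II * μ Reservoir.II : ℝ) : ℂ) *
          particleCurrent ω α φ W Reservoir.I 2 2 := by
  have hP := fun r => currentTerm_two_two hd hβ hα hω hw hW hsa (hα.isQuadraticFlow r)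
  have hJ := fun r => currentTerm_two_two hd hβ hα hω hw hW hsa (hφ.isQuadraticFlow r)
  rw [entropyProduction, sum_reservoir]
  simp only [energyCurrent, particleCurrent, hP, hJ]
  rw [onShellCurrent_swap β μ w (a := fun r' => if r' = Reservoir.I then 1 else 0)
      (b := fun _ => 0) (a' := fun r' => if r' = Reservoir.II then 1 else 0) (b' := fun _ => 0)
      (by simp) (by simp),
    onShellCurrent_swap β μ w (b := fun r' => if r' = Reservoir.I then 1 else 0)
      (a := fun _ => 0) (b' := fun r' => if r' = Reservoir.II then 1 else 0) (a' := fun _ => 0)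
      (by simp) (by simp)]
  push_cast
  ring

theorem entropyProduction_two_two (hd : 3 ≤ d) (hβ : ∀ r, 0 < β r)
    (hα : IsFreeEvolution F α) (hφ : IsGauge F φ) (hω : IsProductEquilibrium F β μ ω)
    (hw : IsRegularKernel w) (hW : IsOneBodyInteraction F w (W 1)) (hsa : IsSelfAdjoint (W 1)) :
    entropyProduction β μ ω α φ W 2 2 =
      ((2 * Real.pi * ∫ k, onShellWeight w k * thermalFactor β μ k : ℝ) : ℂ) := by
  rw [entropyProduction_two_two_eq_currents hd hβ hα hφ hω hw hW hsa, energyCurrent,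
    particleCurrent, currentTerm_two_two hd hβ hα hω hw hW hsa (hα.isQuadraticFlow _),
    currentTerm_two_two hd hβ hα hω hw hW hsa (hφ.isQuadraticFlow _)]
  norm_cast
  have h1 := integrable_fermi_sub_mul_onShellWeight (μ := μ) hd hβ hw 1 0
  have h2 := integrable_fermi_sub_mul_onShellWeight (μ := μ) hd hβ hw 0 1
  have e : ∫ k : Space d, onShellWeight w k * thermalFactor β μ k =
      (β Reservoir.I - β Reservoir.II) * (∫ k : Space d,
        (fermi β μ Reservoir.II k - fermi β μ Reservoir.I k) *
          ((1 * ‖k‖ ^ 2 + 0) * onShellWeight w k)) -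
      (β Reservoir.I * μ Reservoir.I - β Reservoir.II * μ Reservoir.II) * ∫ k : Space d,
        (fermi β μ Reservoir.II k - fermi β μ Reservoir.I k) *
          ((0 * ‖k‖ ^ 2 + 1) * onShellWeight w k) := by
    rw [← integral_const_mul, ← integral_const_mul,
      ← integral_sub (h1.const_mul _) (h2.const_mul _)]
    simp_rw [onShellWeight_mul_thermalFactor]
    congr 1
    ext k
    ring
  rw [e, onShellCurrent, onShellCurrent]
  simp only [if_true, reduceCtorEq, if_false, sub_zero]
  ring_nf

end EntropyProduction

end Tunnelling

open Tunnelling Tunnelling.Reservoir in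
theorem mainTheorem4 {d : ℕ} (hd : 3 ≤ d) {𝔄 : Type*} [CStarAlgebra 𝔄] (F : FieldAlgebra d 𝔄)
    (α φ : Reservoir → ℝ → 𝔄 →⋆ₐ[ℂ] 𝔄) (hα : IsFreeEvolution F α) (hφ : IsGauge F φ)
    (β μ : Reservoir → ℝ) (hβ : ∀ r, 0 < β r)
    (ω : 𝔄 →L[ℂ] ℂ) (hω : IsProductEquilibrium F β μ ω)
    (w : Kernel d) (hw : IsRegularKernel w)
    (W : ℕ → 𝔄) (hW : IsOneBodyInteraction F w (W 1)) (hsa : IsSelfAdjoint (W 1)) :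
    -- the terms of order g²ξ² of the currents are well defined
    (∀ γ ∈ ({α I, α II, φ I, φ II} : Set (ℝ → 𝔄 →⋆ₐ[ℂ] 𝔄)),
      (∀ s, IntegrableOn (fun t => ω ⁅freeEvolution α (-t) (W 1), γ s (W 1)⁆) (Set.Ioi 0)) ∧
      DifferentiableAt ℝ
        (fun s : ℝ => stationaryTerm ω (freeEvolution α) W (fun N => γ s (W N)) 2 2) 0) ∧
    -- the terms of lower order of the entropy production rate vanish
    entropyProduction β μ ω α φ W 1 1 = 0 ∧ entropyProduction β μ ω α φ W 1 2 = 0 ∧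
    -- the leading term in terms of the currents
    entropyProduction β μ ω α φ W 2 2 =
      ((β I - β II : ℝ) : ℂ) * energyCurrent ω α W I 2 2 -
        ((β I * μ I - β II * μ II : ℝ) : ℂ) * particleCurrent ω α φ W I 2 2 ∧
    -- the leading term as an integral, with a non-negative thermal factor
    Integrable (fun k : Space d => shellIntegral k fun l =>
      ‖kernelFourier w II I (-k) l‖ ^ 2 * thermalFactor β μ k) ∧
    entropyProduction β μ ω α φ W 2 2 =
      ((2 * Real.pi * ∫ k : Space d, shellIntegral k fun l =>
        ‖kernelFourier w II I (-k) l‖ ^ 2 * thermalFactor β μ k : ℝ) : ℂ) ∧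
    (∀ k : Space d, 0 ≤ thermalFactor β μ k) ∧
    -- strict positivity
    ((∃ k : Space d, onShellWeight w k ≠ 0) → (β I, μ I) ≠ (β II, μ II) →
      0 < (entropyProduction β μ ω α φ W 2 2).re) ∧
    ((β I, μ I) = (β II, μ II) → entropyProduction β μ ω α φ W 2 2 = 0) := by
  have hE := entropyProduction_two_two hd hβ hα hφ hω hw hW hsa
  simp_rw [shellIntegral_mul_thermalFactor]
  refine ⟨fun γ hγ => ?_, entropyProduction_one hα hφ hω W 1, entropyProduction_one hα hφ hω W 2,
    entropyProduction_two_two_eq_currents hd hβ hα hφ hω hw hW hsa,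
    integrable_onShellWeight_mul_thermalFactor hd hβ hw, hE, thermalFactor_nonneg β μ,
    fun hne h => ?_, fun h => ?_⟩
  · have hq : ∃ a b, IsQuadraticFlow F γ a b := by
      rcases hγ with rfl | rfl | rfl | rfl
      exacts [⟨_, _, hα.isQuadraticFlow I⟩, ⟨_, _, hα.isQuadraticFlow II⟩,
        ⟨_, _, hφ.isQuadraticFlow I⟩, ⟨_, _, hφ.isQuadraticFlow II⟩]
    obtain ⟨a, b, hq⟩ := hq
    exact ⟨fun s => (integrable_apply_commutator hd hβ hα hω hw hW hsa hq s).integrableOn,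
      (hasDerivAt_stationaryTerm hd hβ hα hω hw hW hsa hq).differentiableAt⟩
  · have : NeZero d := ⟨by omega⟩
    rw [hE, Complex.ofReal_re]
    exact mul_pos Real.two_pi_pos (integral_shell_mul_thermalFactor_pos hβ h
      (continuous_onShellWeight hw) (onShellWeight_nonneg w)
      (integrable_onShellWeight_mul_thermalFactor hd hβ hw) hne)
  · rw [hE]
    simp [thermalFactor_eq_zero h]
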